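/- **Setting.** Let $l\ge 1$ be an odd integer, $m\in\mathbb Z$, and put $\zeta=e^{2\pi i/l}\in\mathbb C$. Assume $$\zeta^4\ne 1,\qquad \zeta^m\neq\zeta^{-m},\qquad \zeta^m\ne\zeta^{2}\zeta^{-m},\qquad \zeta^{-m}\neq\zeta^2\zeta^{m}.$$ Let $q,Q$ be indeterminates, let $\mathcal O$ be the localization of $\mathbb C[q^{\pm1},Q^{\pm1}]$ at the maximal ideal $\mathfrak m=\langle q-\zeta,\,Q-\zeta^m\rangle$, and let $\mathcal K=\mathbb C(q,Q)$ be its fraction field; its residue field is $\mathbb C$, with $q\mapsto\zeta$, $Q\mapsto \zeta^m$. Fix $n\ge1$. For a commutative ring $R$ with elements $q,Q$ such that $q$, $Q$ and $Q-Q^{-1}$ are invertible, the blob algebra over $R$ is the associative unital $R$-algebra on generators $e,U_1,\dots,U_{n-1}$ with relations $U_i^2=-(q+q^{-1})U_i$; $U_iU_jU_i=U_i$ if $|i-j|=1$; $U_iU_j=U_jU_i$ if $|i-j|>1$; $U_1eU_1=y_eU_1$; $e^2=e$; $U_ie=eU_i$ if $i\ge2$, where $$y_e=-\frac{Qq^{-1}-Q^{-1}q}{Q-Q^{-1}}.$$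 Write $b_n^{\mathcal O}$, $b_n^{\mathcal K}$ and $b_n(m)$ for this algebra over $\mathcal O$, over $\mathcal K$, and over $\mathbb C$ with $(q,Q)=(\zeta,\zeta^m)$. **Bitableaux.** A one-line bipartition of $n$ is $\boldsymbol\lambda=((a),(b))$ with $a,b\ge 0$, $a+b=n$. Put $f(\boldsymbol\lambda)=a-b$, and let $\boldsymbol\mu\succeq\boldsymbol\lambda$ if $|f(\boldsymbol\mu)|<|f(\boldsymbol\lambda)|$, or if $|f(\boldsymbol\mu)|=|f(\boldsymbol\lambda)|$ and $f(\boldsymbol\mu)\le f(\boldsymbol\lambda)$. Let $\mathrm{Std}(\boldsymbol\lambda)$ be the set of standard $\boldsymbol\lambda$-bitableaux, that is, fillings of two rows of lengths $a$ and $b$ by $1,\dots,n$ that increase along each row, and $\mathrm{Std}(n)$ the union of these sets over all one-line bipartitions of $n$. For $\mathfrak s,\mathfrak t\in \mathrm{Std}(\boldsymbol\lambda)$ let $\mathfrak s\succeq\mathfrak t$ if for all $k$ the shape of the entries $\le k$ of $\mathfrak s$ is $\succeq$ that of $\mathfrak t$. There is a unique $\mathfrak t^{\boldsymbol\lambda}\in\mathrm{Std}(\boldsymbol\lambda)$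 with $\mathfrak t^{\boldsymbol\lambda}\succeq\mathfrak t$ for all $\mathfrak t\in\mathrm{Std}(\boldsymbol\lambda)$. The content $c_{\mathfrak t}(k)$ is $q^{2(c-1)}Q$ or $q^{2(c-1)}Q^{-1}$ if $k$ is in column $c$ of the first or second row of $\mathfrak t$, respectively; the residue of $\mathfrak t$ at $k$ is the value of $c_{\mathfrak t}(k)$ at $(q,Q)=(\zeta,\zeta^m)$. Let $\boldsymbol i^{\boldsymbol\lambda}$ be the residue sequence of $\mathfrak t^{\boldsymbol\lambda}$, and $\mathrm{Std}(\boldsymbol i^{\boldsymbol\lambda})\subseteq \mathrm{Std}(n)$ the set of bitableaux with the same residue sequence. **Diagram basis.** A blob diagram is a planar $(n,n)$-diagram of non-crossing lines, some of which may be decorated by a blob; no line to the right of the leftmost vertical line is decorated, and a decorated horizontal line is not nested inside another line. The blob algebra has the blob diagrams as a basis, with concatenation as multiplication ($xy$ is $x$ on top of $y$): $U_i$ is the usual cup-cap diagram, $e$ is the identity diagram with a blob on the first line, several blobs on a line equal one blob, and an undecorated (decorated) closed loop is removed with a factor $-(q+q^{-1})$ (respectively $y_e$). A node is covered if its line is decorated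 or lies inside a decorated horizontal line or to the right of a decorated vertical line. To each edge of a blob diagram with $v$ vertical lines and $h$ horizontal lines on each edge a bitableau is attached. If there is no decorated vertical line, its shape is $((h+v),(h))$ and the entries of its second row are the uncovered right endpoints and the covered left endpoints of the horizontal lines of that edge; otherwise its shape is $((h),(h+v))$ and the entries of its first row are the uncovered left endpoints and the covered right endpoints. For $\mathfrak s,\mathfrak t\in\mathrm{Std}(\boldsymbol\lambda)$ let $m_{\mathfrak s\mathfrak t}$ be the unique blob diagram with top bitableau $\mathfrak s$ and bottom bitableau $\mathfrak t$, and let $b_n^{\boldsymbol\lambda}(m)$ be the ideal of $b_n(m)$ spanned by the $m_{\mathfrak s\mathfrak t}$ with $\mathfrak s,\mathfrak t\in\mathrm{Std}(\boldsymbol\mu)$, $\boldsymbol\mu\succ\boldsymbol\lambda$. **Idempotents.** In $b_n^{\mathcal K}$ let $L_1=Q-(Q-Q^{-1})e$, $L_{k+1}=(U_k+q)L_k(U_k+q)$, and for $\mathfrak t\in\mathrm{Std}(n)$ let $$F_{\mathfrak t}=\prod_{k=1}^n\ \prod_{\substack{\mathfrak s\in\mathrm{Std}(n)\\ c_{\mathfrak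 s}(k)\ne c_{\mathfrak t}(k)}}\frac{L_k-c_{\mathfrak s}(k)}{c_{\mathfrak t}(k)-c_{\mathfrak s}(k)},\qquad f_{\mathfrak t\mathfrak t}=F_{\mathfrak t}\,m_{\mathfrak t\mathfrak t}\,F_{\mathfrak t}.$$ **Theorem.** For each $\mathfrak t\in\mathrm{Std}(n)$ there is exactly one scalar $\gamma_{\mathfrak t}\in\mathcal K$ with $f_{\mathfrak t\mathfrak t}f_{\mathfrak t\mathfrak t}=\gamma_{\mathfrak t}f_{\mathfrak t\mathfrak t}$, and $\gamma_{\mathfrak t}\neq0$. Let $\boldsymbol\lambda=((a),(b))$ be a one-line bipartition of $n$. The element $$\sum_{\mathfrak s\in\mathrm{Std}(\boldsymbol i^{\boldsymbol\lambda})}\gamma_{\mathfrak s}^{-1}f_{\mathfrak s\mathfrak s}\in b_n^{\mathcal K}$$ is the image of exactly one element of $b_n^{\mathcal O}$. Let $e^b(\boldsymbol i^{\boldsymbol\lambda})\in b_n(m)$ be the reduction of this element modulo $\mathfrak m$. Then there is $r\in\mathbb C^\times$ such that $$e^b(\boldsymbol i^{\boldsymbol\lambda})\equiv r\,m_{\mathfrak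 t^{\boldsymbol\lambda}\mathfrak t^{\boldsymbol\lambda}}\pmod{b_n^{\boldsymbol\lambda}(m)}.$$ -/

import Mathlib

/-! ### Decorated matchings and concatenation with the diagrammatic generators -/

/-- A fixed-point free pairing of the points of `V` by lines, each of which may carry a blob:
`dec x` says that the line ending at `x` is decorated. -/
@[ext] structure DecMatching (V : Type) where
  partner : V → V
  partner_partner : ∀ x, partner (partner x) = x
  partner_ne : ∀ x, partner x ≠ x
  dec : V → Bool
  dec_partner : ∀ x, dec (partner x) = dec x

namespace DecMatching
variable {V : Type} [DecidableEq V]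

/-- Concatenation, from above, with the diagram `U_i`, where `a, b` are the top nodes `i, i + 1`:
the lines ending at `a` and `b` are joined to one line, which is decorated if one of them was
(if `a` and `b` are joined to each other this closes a loop, which is removed), and there is a new
undecorated line from `a` to `b`. -/
def cap (a b : V) (hab : a ≠ b) (D : DecMatching V) : DecMatching V where
  partner x :=
    if x = a then b
    else if x = b then a
    else if x = D.partner a then D.partner b
    else if x = D.partner b then D.partner a
    else D.partner x
  partner_partner x := by
    have h1 := D.partner_partner
    have h2 := D.partner_ne
    by_cases ha : x = a
    · grind (splits := 40)
    by_cases hb : x = b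
    · grind (splits := 40)
    by_cases hc : x = D.partner a
    · grind (splits := 40)
    by_cases hd : x = D.partner b
    · grind (splits := 40)
    grind (splits := 40)
  partner_ne x := by
    have := D.partner_partner
    have := D.partner_ne
    grind (splits := 40)
  dec x :=
    if x = a ∨ x = b then false
    else if x = D.partner a ∨ x = D.partner b then D.dec a || D.dec b
    else D.dec x
  dec_partner x := by
    have := D.partner_partner
    have := D.partner_ne
    have := D.dec_partner
    grind (splits := 40)

/-- The factor which comes out of concatenating `U_i` with `D`: the value `y` of a decorated loop or
the value `-δ` of an undecorated loop if a loop was closed, and `1` otherwise. -/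
def capScalar {R : Type*} [CommRing R] (δ y : R) (a b : V) (D : DecMatching V) : R :=
  if D.partner a = b then (if D.dec a then y else -δ) else 1

/-- Concatenation, from above, with the diagram `e`, where `a` is the first top node: the line
ending at `a` becomes decorated. -/
def blob (a : V) (D : DecMatching V) : DecMatching V where
  partner := D.partner
  partner_partner := D.partner_partner
  partner_ne := D.partner_ne
  dec x := if x = a ∨ x = D.partner a then true else D.dec x
  dec_partner x := by
    have := D.partner_partner
    have := D.dec_partner
    grind (splits := 40)

theorem cap_swap (a b : V) (hab : a ≠ b) (D : DecMatching V) :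
    D.cap b a hab.symm = D.cap a b hab := by
  have := D.partner_partner
  ext x
  · simp only [cap]; grind (splits := 40)
  · simp only [cap]; grind (splits := 40)

theorem cap_cap (a b : V) (hab : a ≠ b) (D : DecMatching V) :
    (D.cap a b hab).cap a b hab = D.cap a b hab := by
  have := D.partner_partner
  ext x
  · simp only [cap]; grind (splits := 40)
  · simp only [cap]; grind (splits := 40)

theorem cap_cap_cap (a b c : V) (hab : a ≠ b) (hbc : b ≠ c) (hac : a ≠ c)
    (D : DecMatching V) :
    ((D.cap a b hab).cap b c hbc).cap a b hab = D.cap a b hab := by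
  have h1 := D.partner_partner
  have h2 := D.partner_ne
  have h3 := D.dec_partner
  ext x
  · simp only [cap]; grind (splits := 40)
  · simp only [cap]; grind (splits := 40)

theorem cap_comm (a b c d : V) (hab : a ≠ b) (hcd : c ≠ d) (hac : a ≠ c) (had : a ≠ d)
    (hbc : b ≠ c) (hbd : b ≠ d) (D : DecMatching V) :
    (D.cap a b hab).cap c d hcd = (D.cap c d hcd).cap a b hab := by
  have h1 := D.partner_partner
  have h2 := D.partner_ne
  have h3 := D.dec_partner
  ext x
  · simp only [cap]; grind (splits := 40)
  · simp only [cap]; grind (splits := 40)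

theorem cap_blob_cap (a b : V) (hab : a ≠ b) (D : DecMatching V) :
    ((D.cap a b hab).blob a).cap a b hab = D.cap a b hab := by
  have h1 := D.partner_partner
  ext x
  · simp only [cap, blob]; grind (splits := 40)
  · simp only [cap, blob]; grind (splits := 40)

theorem blob_blob (a : V) (D : DecMatching V) : (D.blob a).blob a = D.blob a := by
  ext x
  · rfl
  · simp only [blob]; grind (splits := 40)

theorem blob_cap (a b c : V) (hab : a ≠ b) (hac : a ≠ c) (hbc : b ≠ c) (D : DecMatching V) :
    (D.blob c).cap a b hab = (D.cap a b hab).blob c := by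
  have h1 := D.partner_partner
  have h2 := D.partner_ne
  have h3 := D.dec_partner
  ext x
  · rfl
  · simp only [cap, blob]; grind (splits := 40)

section Scalars
variable {R : Type*} [CommRing R] (δ y : R)

theorem capScalar_swap (a b : V) (D : DecMatching V) :
    D.capScalar δ y b a = D.capScalar δ y a b := by
  have h1 := D.partner_partner
  have h3 := D.dec_partner
  simp only [capScalar]; grind (splits := 40)

theorem capScalar_cap (a b : V) (hab : a ≠ b) (D : DecMatching V) :
    (D.cap a b hab).capScalar δ y a b = -δ := by
  simp [capScalar, cap]

theorem capScalar_cap_blob (a b : V) (hab : a ≠ b) (D : DecMatching V) :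
    ((D.cap a b hab).blob a).capScalar δ y a b = y := by
  simp [capScalar, cap, blob]

theorem capScalar_cap_ne (a b c : V) (hab : a ≠ b) (hac : a ≠ c) (D : DecMatching V) :
    (D.cap a b hab).capScalar δ y b c = 1 := by
  simp [capScalar, cap, hac, hab.symm]

theorem capScalar_cap_cap (a b c : V) (hab : a ≠ b) (hbc : b ≠ c) (hac : a ≠ c)
    (D : DecMatching V) : ((D.cap a b hab).cap b c hbc).capScalar δ y a b = 1 := by
  have h1 := D.partner_partner
  have h2 := D.partner_ne
  simp only [capScalar, cap]; grind (splits := 40)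

theorem capScalar_blob (a b c : V) (hac : a ≠ c) (hbc : b ≠ c) (D : DecMatching V) :
    (D.blob c).capScalar δ y a b = D.capScalar δ y a b := by
  have h1 := D.partner_partner
  simp only [capScalar, blob]; grind (splits := 40)

theorem capScalar_comm (a b c d : V) (hab : a ≠ b) (hcd : c ≠ d) (hac : a ≠ c) (had : a ≠ d)
    (hbc : b ≠ c) (hbd : b ≠ d) (D : DecMatching V) :
    D.capScalar δ y a b * (D.cap a b hab).capScalar δ y c d =
      D.capScalar δ y c d * (D.cap c d hcd).capScalar δ y a b := by
  have h1 := D.partner_partner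
  have h2 := D.partner_ne
  have h3 := D.dec_partner
  by_cases e1 : D.partner a = b
  · simp only [capScalar, cap]; grind (splits := 40)
  by_cases e2 : D.partner c = d
  · simp only [capScalar, cap]; grind (splits := 40)
  have f1 : D.capScalar δ y a b = 1 := by simp [capScalar, e1]
  have f2 : D.capScalar δ y c d = 1 := by simp [capScalar, e2]
  rw [f1, f2, one_mul, one_mul]
  simp only [capScalar, cap]; grind (splits := 40)

end Scalars

section Operators
variable (R : Type*) [CommRing R] (δ y : R)

/-- Concatenation with `U_i`, extended linearly. -/
noncomputable def capOp (a b : V) (hab : a ≠ b) : Module.End R (DecMatching V →₀ R) :=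
  Finsupp.linearCombination R fun D => Finsupp.single (D.cap a b hab) (D.capScalar δ y a b)

/-- Concatenation with `e`, extended linearly. -/
noncomputable def blobOp (a : V) : Module.End R (DecMatching V →₀ R) :=
  Finsupp.linearCombination R fun D => Finsupp.single (D.blob a) 1

@[simp] theorem capOp_single (a b : V) (hab : a ≠ b) (D : DecMatching V) (r : R) :
    capOp R δ y a b hab (Finsupp.single D r) =
      Finsupp.single (D.cap a b hab) (r * D.capScalar δ y a b) := by
  simp [capOp]

@[simp] theorem blobOp_single (a : V) (D : DecMatching V) (r : R) :
    blobOp R a (Finsupp.single D r) = Finsupp.single (D.blob a) r := by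
  simp [blobOp]

theorem capOp_swap (a b : V) (hab : a ≠ b) :
    capOp R δ y b a hab.symm = capOp R δ y a b hab := by
  apply Finsupp.lhom_ext; intro D r
  simp [-Finsupp.single_mul, cap_swap a b hab, capScalar_swap δ y a b]

theorem capOp_sq (a b : V) (hab : a ≠ b) :
    capOp R δ y a b hab * capOp R δ y a b hab = -(δ • capOp R δ y a b hab) := by
  apply Finsupp.lhom_ext; intro D r
  simp [-Finsupp.single_mul, cap_cap, capScalar_cap, ← Finsupp.single_neg]
  congr 1; ring

theorem capOp_tl (a b c : V) (hab : a ≠ b) (hbc : b ≠ c) (hac : a ≠ c) :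
    capOp R δ y a b hab * capOp R δ y b c hbc * capOp R δ y a b hab = capOp R δ y a b hab := by
  apply Finsupp.lhom_ext; intro D r
  simp [-Finsupp.single_mul, cap_cap_cap a b c hab hbc hac, capScalar_cap_ne δ y a b c hab hac,
    capScalar_cap_cap δ y a b c hab hbc hac]

theorem capOp_comm (a b c d : V) (hab : a ≠ b) (hcd : c ≠ d) (hac : a ≠ c) (had : a ≠ d)
    (hbc : b ≠ c) (hbd : b ≠ d) :
    capOp R δ y a b hab * capOp R δ y c d hcd = capOp R δ y c d hcd * capOp R δ y a b hab := by
  apply Finsupp.lhom_ext; intro D r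
  simp only [Module.End.mul_apply, capOp_single, mul_assoc]
  rw [cap_comm a b c d hab hcd hac had hbc hbd,
    capScalar_comm δ y a b c d hab hcd hac had hbc hbd]

theorem capOp_blobOp_capOp (a b : V) (hab : a ≠ b) :
    capOp R δ y a b hab * blobOp R a * capOp R δ y a b hab = y • capOp R δ y a b hab := by
  apply Finsupp.lhom_ext; intro D r
  simp [-Finsupp.single_mul, cap_blob_cap, capScalar_cap_blob]
  congr 1; ring

theorem blobOp_sq (a : V) : blobOp R a * blobOp R a = blobOp R a := by
  apply Finsupp.lhom_ext; intro D r
  simp [-Finsupp.single_mul, blob_blob]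

theorem capOp_blobOp (a b c : V) (hab : a ≠ b) (hac : a ≠ c) (hbc : b ≠ c) :
    capOp R δ y a b hab * blobOp R c = blobOp R c * capOp R δ y a b hab := by
  apply Finsupp.lhom_ext; intro D r
  simp [-Finsupp.single_mul, blob_cap a b c hab hac hbc, capScalar_blob δ y a b c hac hbc]

end Operators

end DecMatching

/-! ### The blob algebra -/

/-- The generators `e, U_1, …, U_{n-1}`; the index of `U` starts at `0`. -/
inductive BlobGen (n : ℕ) : Type
  | e : BlobGen n
  | U : Fin (n - 1) → BlobGen n

/-- The Gaussian integer `[2] = q + q⁻¹`. -/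
noncomputable def gaussTwo {R : Type*} [CommRing R] (q : R) : R := q + Ring.inverse q

/-- The parameter `y_e = -[m-1]/[m]`, written in terms of `q` and `Q = q ^ m`:
`y_e = -(Q q⁻¹ - Q⁻¹ q) / (Q - Q⁻¹)`. -/
noncomputable def blobParam {R : Type*} [CommRing R] (q Q : R) : R :=
  -((Q * Ring.inverse q - Ring.inverse Q * q) * Ring.inverse (Q - Ring.inverse Q))

open FreeAlgebra in
/-- The defining relations of the blob algebra. -/
inductive BlobRel (R : Type*) [CommRing R] (n : ℕ) (q Q : R) :
    FreeAlgebra R (BlobGen n) → FreeAlgebra R (BlobGen n) → Prop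
  | U_sq (i : Fin (n - 1)) :
      BlobRel R n q Q (ι R (.U i) * ι R (.U i)) (-(gaussTwo q • ι R (.U i)))
  | U_U_U (i j : Fin (n - 1)) (h : (i : ℕ) + 1 = j ∨ (j : ℕ) + 1 = i) :
      BlobRel R n q Q (ι R (.U i) * ι R (.U j) * ι R (.U i)) (ι R (.U i))
  | U_comm (i j : Fin (n - 1)) (h : (i : ℕ) + 1 < j ∨ (j : ℕ) + 1 < i) :
      BlobRel R n q Q (ι R (.U i) * ι R (.U j)) (ι R (.U j) * ι R (.U i))
  | U_e_U (i : Fin (n - 1)) (h : (i : ℕ) = 0) :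
      BlobRel R n q Q (ι R (.U i) * ι R .e * ι R (.U i)) (blobParam q Q • ι R (.U i))
  | e_sq : BlobRel R n q Q (ι R .e * ι R .e) (ι R .e)
  | U_e_comm (i : Fin (n - 1)) (h : 0 < (i : ℕ)) :
      BlobRel R n q Q (ι R (.U i) * ι R .e) (ι R .e * ι R (.U i))

/-- The blob algebra `b_n` over `R` with parameters `q` and `Q`. -/
abbrev Blob (R : Type*) [CommRing R] (n : ℕ) (q Q : R) : Type _ := RingQuot (BlobRel R n q Q)

/-- The generators as elements of the blob algebra. -/
noncomputable def Blob.gen {R : Type*} [CommRing R] {n : ℕ} (q Q : R) (g : BlobGen n) :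
    Blob R n q Q :=
  RingQuot.mkAlgHom R (BlobRel R n q Q) (FreeAlgebra.ι R g)

theorem Blob.rel {R : Type*} [CommRing R] {n : ℕ} {q Q : R} {x y : FreeAlgebra R (BlobGen n)}
    (h : BlobRel R n q Q x y) : RingQuot.mkAlgHom R (BlobRel R n q Q) x =
      RingQuot.mkAlgHom R (BlobRel R n q Q) y :=
  RingQuot.mkAlgHom_rel R h

/-! ### Blob diagrams -/

/-- The `2n` points of an `(n,n)`-diagram: `(true, k)` is the `k`-th node of the top edge and
`(false, k)` is the `k`-th node of the bottom edge. -/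
abbrev Node (n : ℕ) : Type := Bool × Fin n

/-- The identity diagram: `n` undecorated vertical lines. -/
def DecMatching.one (n : ℕ) : DecMatching (Node n) where
  partner x := (!x.1, x.2)
  partner_partner x := by simp
  partner_ne x h := by simpa using congrArg Prod.fst h
  dec _ := false
  dec_partner _ := rfl

/-- The top nodes at which `U_i` acts. -/
def topL {n : ℕ} (i : Fin (n - 1)) : Node n := (true, ⟨i, by omega⟩)

/-- The top nodes at which `U_i` acts. -/
def topR {n : ℕ} (i : Fin (n - 1)) : Node n := (true, ⟨i + 1, by omega⟩)

theorem topL_ne_topR {n : ℕ} (i : Fin (n - 1)) : topL i ≠ topR i := by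
  simp [topL, topR, Fin.ext_iff]

/-- Concatenation of diagrams with a generator on top. -/
noncomputable def genOp (R : Type*) [CommRing R] (n : ℕ) [NeZero n] (q Q : R) :
    BlobGen n → Module.End R (DecMatching (Node n) →₀ R)
  | .e => DecMatching.blobOp R (true, 0)
  | .U i => DecMatching.capOp R (gaussTwo q) (blobParam q Q) (topL i) (topR i) (topL_ne_topR i)

theorem genOp_rel (R : Type*) [CommRing R] (n : ℕ) [NeZero n] (q Q : R)
    ⦃x y : FreeAlgebra R (BlobGen n)⦄ (h : BlobRel R n q Q x y) :
    FreeAlgebra.lift R (genOp R n q Q) x = FreeAlgebra.lift R (genOp R n q Q) y := by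
  induction h with
  | U_sq i => simpa [genOp] using DecMatching.capOp_sq R _ _ _ _ _
  | U_U_U i j h =>
    rcases h with h | h
    · have hj : topL j = topR i := by simp [topL, topR, h]
      have h3 : topR i ≠ topR j := by simp [topR, Fin.ext_iff]; omega
      have h4 : topL i ≠ topR j := by simp [topR, topL, Fin.ext_iff]; omega
      have := DecMatching.capOp_tl R (gaussTwo q) (blobParam q Q) _ _ _ (topL_ne_topR i) h3 h4
      simpa [genOp, hj] using this
    · have hj : topR j = topL i := by simp [topL, topR, h]
      have h3 : topL i ≠ topL j := by simp [topL, Fin.ext_iff]; omega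
      have h4 : topR i ≠ topL j := by simp [topR, topL, Fin.ext_iff]; omega
      have := DecMatching.capOp_tl R (gaussTwo q) (blobParam q Q) _ _ _ (topL_ne_topR i).symm h3 h4
      rw [DecMatching.capOp_swap R _ _ _ _ (topL_ne_topR i),
        DecMatching.capOp_swap R _ _ (topL j) (topL i) h3.symm] at this
      simpa [genOp, hj] using this
  | U_comm i j h =>
    simp only [map_mul, FreeAlgebra.lift_ι_apply, genOp]
    apply DecMatching.capOp_comm <;> simp [topL, topR, Fin.ext_iff] <;> omega
  | U_e_U i h =>
    have hi : topL i = (true, 0) := by simp [topL, h]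
    have := DecMatching.capOp_blobOp_capOp R (gaussTwo q) (blobParam q Q) _ _ (topL_ne_topR i)
    simpa [genOp, hi] using this
  | e_sq => simpa [genOp] using DecMatching.blobOp_sq R _
  | U_e_comm i h =>
    simp only [map_mul, FreeAlgebra.lift_ι_apply, genOp]
    apply DecMatching.capOp_blobOp <;> simp [topL, topR, Fin.ext_iff]
    omega

/-- The action of the blob algebra on the free module on decorated pairings of the `2n` points,
by concatenation of diagrams. -/
noncomputable def blobAct (R : Type*) [CommRing R] (n : ℕ) [NeZero n] (q Q : R) :
    Blob R n q Q →ₐ[R] Module.End R (DecMatching (Node n) →₀ R) :=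
  RingQuot.liftAlgHom R ⟨FreeAlgebra.lift R (genOp R n q Q), genOp_rel R n q Q⟩

/-- The diagrammatic realization `x ↦ x · 1` of the elements of the blob algebra as linear
combinations of diagrams. It is injective, its image is the span of the blob diagrams, and it takes
products to concatenations of diagrams. -/
noncomputable def blobRealization (R : Type*) [CommRing R] (n : ℕ) [NeZero n] (q Q : R) :
    Blob R n q Q →ₗ[R] (DecMatching (Node n) →₀ R) :=
  (LinearMap.applyₗ (Finsupp.single (DecMatching.one n) (1 : R))).comp
    (blobAct R n q Q).toLinearMap

namespace DecMatching
variable {n : ℕ}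

/-- The node `k` of the edge `b` lies on a vertical line, i.e. on a line between the two edges. -/
def IsVertical (D : DecMatching (Node n)) (b : Bool) (k : Fin n) : Prop :=
  (D.partner (b, k)).1 ≠ b

/-- The node `k` of the edge `b` is the left endpoint of a horizontal line. -/
def IsLeft (D : DecMatching (Node n)) (b : Bool) (k : Fin n) : Prop :=
  ∃ j, k < j ∧ D.partner (b, k) = (b, j)

/-- The node `k` of the edge `b` is the right endpoint of a horizontal line. -/
def IsRight (D : DecMatching (Node n)) (b : Bool) (k : Fin n) : Prop :=
  ∃ j, j < k ∧ D.partner (b, k) = (b, j)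

/-- The order of the nodes along the boundary of the frame: the top edge from left to right, then
the bottom edge from right to left. -/
def pos (x : Node n) : ℕ := if x.1 then (x.2 : ℕ) else 2 * n - 1 - (x.2 : ℕ)

/-- A blob diagram on `n` points: the lines do not cross, no line to the right of the leftmost
vertical line is decorated, and a decorated horizontal line is not nested inside another one. -/
structure IsBlobDiagram (D : DecMatching (Node n)) : Prop where
  planar : ∀ x y, ¬ (pos x < pos y ∧ pos y < pos (D.partner x) ∧
    pos (D.partner x) < pos (D.partner y))
  not_right_of_vertical : ∀ b k, D.dec (b, k) = true → ∀ j, j < k → ¬ D.IsVertical b j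
  outermost : ∀ b k, D.dec (b, k) = true →
    ∀ i j, i < k → k < j → D.partner (b, i) ≠ (b, j)

/-- The node `k` of the edge `b` is covered: its line is decorated, or is covered by a decorated
horizontal line or by a decorated leftmost vertical line. -/
def IsCovered (D : DecMatching (Node n)) (b : Bool) (k : Fin n) : Prop :=
  D.dec (b, k) = true ∨
  (∃ i j, i < k ∧ k < j ∧ D.partner (b, i) = (b, j) ∧ D.dec (b, i) = true) ∨
  (∃ i, i < k ∧ D.IsVertical b i ∧ D.dec (b, i) = true)

/-- The leftmost vertical line exists and is decorated. -/
def VerticalDecorated (D : DecMatching (Node n)) : Prop :=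
  ∃ k, D.IsVertical true k ∧ D.dec (true, k) = true

/-- The node `k` of the edge `b` is placed in the second component of the bitableau of that edge.
If there is no decorated vertical line, these are the uncovered right endpoints and the covered left
endpoints of horizontal lines; otherwise the uncovered left endpoints and the covered right
endpoints are placed in the first component and all other nodes in the second one. -/
def InSecond (D : DecMatching (Node n)) (b : Bool) (k : Fin n) : Prop :=
  (¬ D.VerticalDecorated ∧ ((¬ D.IsCovered b k ∧ D.IsRight b k) ∨
    (D.IsCovered b k ∧ D.IsLeft b k))) ∨
  (D.VerticalDecorated ∧ ¬ ((¬ D.IsCovered b k ∧ D.IsLeft b k) ∨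
    (D.IsCovered b k ∧ D.IsRight b k)))

end DecMatching

/-! ### One-line bipartitions and standard bitableaux -/

/-- One-line bipartitions `((a),(b))` of `n`. -/
abbrev OneLine (n : ℕ) : Type := {p : ℕ × ℕ // p.1 + p.2 = n}

noncomputable instance (n : ℕ) : Fintype (OneLine n) :=
  Fintype.subtype (Finset.HasAntidiagonal.antidiagonal n) fun _ =>
    Finset.HasAntidiagonal.mem_antidiagonal

/-- Standard bitableaux of shape `((a),(b))`: bijections from the nodes of the two rows to the
entries `1, …, n` (here `Fin n`), increasing along both rows. -/
abbrev StdTab {n : ℕ} (lam : OneLine n) : Type :=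
  {t : (Fin lam.1.1 ⊕ Fin lam.1.2) ≃ Fin n //
    StrictMono (fun c => t (Sum.inl c)) ∧ StrictMono (fun c => t (Sum.inr c))}

/-- All one-line standard bitableaux of total degree `n`. -/
abbrev StdAll (n : ℕ) : Type := Σ lam : OneLine n, StdTab lam

noncomputable instance {n : ℕ} (lam : OneLine n) : Fintype (StdTab lam) := Fintype.ofFinite _

/-- The order `μ ⪰ λ` on pairs `((a),(b))`, through the value of `a - b`. -/
def ShapeGE (mu lam : ℕ × ℕ) : Prop :=
  |(mu.1 : ℤ) - mu.2| < |(lam.1 : ℤ) - lam.2| ∨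
    (|(mu.1 : ℤ) - mu.2| = |(lam.1 : ℤ) - lam.2| ∧ (mu.1 : ℤ) - mu.2 ≤ (lam.1 : ℤ) - lam.2)

/-- The strict order `μ ≻ λ`. -/
def ShapeGT (mu lam : ℕ × ℕ) : Prop := ShapeGE mu lam ∧ mu ≠ lam

/-- The shape of the bitableau which is left after removing all entries greater than `k`. -/
def restrictShape {n : ℕ} {lam : OneLine n} (t : StdTab lam) (k : Fin n) : ℕ × ℕ :=
  ((Finset.univ.filter fun c => t.1 (Sum.inl c) ≤ k).card,
    (Finset.univ.filter fun c => t.1 (Sum.inr c) ≤ k).card)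

/-- The order `s ⪰ t` on standard bitableaux of a given shape. -/
def TabGE {n : ℕ} {lam : OneLine n} (s t : StdTab lam) : Prop :=
  ∀ k, ShapeGE (restrictShape s k) (restrictShape t k)

/-- The content of `t` at `k`: `q ^ (2 (c - 1)) Q` or `q ^ (2 (c - 1)) Q⁻¹` if `k` is in column `c`
of the first or second component; columns are counted from `0` here. -/
def content {F : Type*} [Field F] (q Q : F) {n : ℕ} (t : StdAll n) (k : Fin n) : F :=
  match t.2.1.symm k with
  | Sum.inl c => q ^ (2 * (c : ℕ)) * Q
  | Sum.inr c => q ^ (2 * (c : ℕ)) * Q⁻¹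

/-- The element `m_{st}` of the blob algebra: the one realized by the unique blob diagram whose top
edge has the bitableau `s` and whose bottom edge has the bitableau `t`. -/
noncomputable def mElt {R : Type*} [CommRing R] {n : ℕ} [NeZero n] (q Q : R) {lam : OneLine n}
    (s t : StdTab lam) : Blob R n q Q :=
  Classical.epsilon fun x => ∃ D : DecMatching (Node n), D.IsBlobDiagram ∧
    (∀ k, D.InSecond true k ↔ (s.1.symm k).isRight = true) ∧
    (∀ k, D.InSecond false k ↔ (t.1.symm k).isRight = true) ∧
    blobRealization R n q Q x = Finsupp.single D 1

/-- The ideal `b_n^λ`, spanned by the `m_{st}` with `s, t` of shape `μ ≻ λ`. -/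
noncomputable def cellIdeal {R : Type*} [CommRing R] {n : ℕ} [NeZero n] (q Q : R)
    (lam : OneLine n) : Submodule R (Blob R n q Q) :=
  Submodule.span R {x | ∃ (mu : OneLine n) (s t : StdTab mu),
    ShapeGT mu.1 lam.1 ∧ x = mElt q Q s t}

/-! ### Jucys-Murphy elements and the seminormal form -/

section Seminormal
variable {F : Type*} [Field F] {n : ℕ}

/-- The element `U_0 = -[m] e`, with `[m] = (Q - Q⁻¹) / (q - q⁻¹)`. -/
noncomputable def blobUzero (q Q : F) : Blob F n q Q :=
  -(((Q - Q⁻¹) / (q - q⁻¹)) • Blob.gen q Q BlobGen.e)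

/-- `L_{k+1} = (U_k + q) ⋯ (U_1 + q) ((q - q⁻¹) U_0 + Q) (U_1 + q) ⋯ (U_k + q)`. -/
noncomputable def jmAux (q Q : F) : ℕ → Blob F n q Q
  | 0 => (q - q⁻¹) • blobUzero q Q + algebraMap F _ Q
  | k + 1 =>
    if h : k < n - 1 then
      (Blob.gen q Q (BlobGen.U ⟨k, h⟩) + algebraMap F _ q) * jmAux q Q k *
        (Blob.gen q Q (BlobGen.U ⟨k, h⟩) + algebraMap F _ q)
    else 0

/-- The Jucys-Murphy elements; `jm q Q k` is `L_{k+1}`. -/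
noncomputable def jm (q Q : F) (k : Fin n) : Blob F n q Q := jmAux q Q k

open Classical Polynomial in
/-- The element `F_t`, the product over all `k` and over all `s` with `c_s(k) ≠ c_t(k)` of
`(L_k - c_s(k)) / (c_t(k) - c_s(k))`. -/
noncomputable def seminormalF (q Q : F) (t : StdAll n) : Blob F n q Q :=
  (List.ofFn fun k : Fin n =>
    aeval (jm q Q k) (∏ s : StdAll n with content q Q s k ≠ content q Q t k,
      (C (content q Q t k - content q Q s k)⁻¹ * (X - C (content q Q s k)) : F[X]))).prod

variable [NeZero n]

/-- The seminormal basis element `f_{st} = F_s m_{st} F_t`. -/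
noncomputable def seminormalElt (q Q : F) {lam : OneLine n} (s t : StdTab lam) : Blob F n q Q :=
  seminormalF q Q ⟨lam, s⟩ * mElt q Q s t * seminormalF q Q ⟨lam, t⟩

/-- The diagonal seminormal basis element `f_{tt}`. -/
noncomputable def seminormalDiag (q Q : F) (t : StdAll n) : Blob F n q Q :=
  seminormalElt q Q t.2 t.2

end Seminormal

/-! ### The modular system -/

/-- The root of unity `exp (2 π i / l)`. -/
noncomputable def zeta (l : ℕ) : ℂ := Complex.exp (2 * Real.pi * Complex.I / l)

/-- The standing conditions on the parameters `q = exp (2 π i / l)` and `Q = q ^ m`. -/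
structure Admissible (l : ℕ) (m : ℤ) : Prop where
  odd : Odd l
  q_pow_four : zeta l ^ 4 ≠ 1
  Q_ne_inv : zeta l ^ m ≠ (zeta l ^ m)⁻¹
  Q_ne : zeta l ^ m ≠ zeta l ^ 2 * (zeta l ^ m)⁻¹
  Q_inv_ne : (zeta l ^ m)⁻¹ ≠ zeta l ^ 2 * zeta l ^ m

/-- Evaluation of polynomials in `q` and `Q` (the variables `X 0` and `X 1`) at the point
`(exp (2 π i / l), exp (2 π i / l) ^ m)`. -/
noncomputable def evalPoint (l : ℕ) (m : ℤ) : MvPolynomial (Fin 2) ℂ →+* ℂ :=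
  MvPolynomial.eval ![zeta l, zeta l ^ m]

instance (l : ℕ) (m : ℤ) : (RingHom.ker (evalPoint l m)).IsPrime := RingHom.ker_isPrime _

/-- The local ring `𝒪` of rational functions in `q` and `Q` that are defined at the point
`(exp (2 π i / l), exp (2 π i / l) ^ m)`. Under the standing conditions, `q`, `Q`, `q ^ 4 - 1`,
`Q - Q⁻¹`, `Q - Q⁻¹ q ^ 2` and `Q⁻¹ - Q q ^ 2` are units in `𝒪`. -/
abbrev LocRing (l : ℕ) (m : ℤ) : Type :=
  Localization.AtPrime (RingHom.ker (evalPoint l m))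

/-- The field `𝒦 = ℂ(q, Q)` of fractions of `𝒪`. -/
abbrev GenField (l : ℕ) (m : ℤ) : Type := FractionRing (LocRing l m)

section
variable (l : ℕ) (m : ℤ)

/-- The element `q` of `𝒪`. -/
noncomputable def qLoc : LocRing l m := algebraMap (MvPolynomial (Fin 2) ℂ) _ (MvPolynomial.X 0)

/-- The element `Q` of `𝒪`. -/
noncomputable def QLoc : LocRing l m := algebraMap (MvPolynomial (Fin 2) ℂ) _ (MvPolynomial.X 1)

/-- The element `q` of `𝒦`. -/
noncomputable def qGen : GenField l m := algebraMap (LocRing l m) _ (qLoc l m)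

/-- The element `Q` of `𝒦`. -/
noncomputable def QGen : GenField l m := algebraMap (LocRing l m) _ (QLoc l m)

/-- Reduction `𝒪 → ℂ` modulo the maximal ideal. -/
noncomputable def residueMap : LocRing l m →+* ℂ :=
  IsLocalization.lift (M := (RingHom.ker (evalPoint l m)).primeCompl) (g := evalPoint l m)
    fun y => isUnit_iff_ne_zero.mpr y.2

theorem residueMap_algebraMap (p : MvPolynomial (Fin 2) ℂ) :
    residueMap l m (algebraMap _ _ p) = evalPoint l m p :=
  IsLocalization.lift_eq _ _

theorem residueMap_qLoc : residueMap l m (qLoc l m) = zeta l := by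
  rw [qLoc, residueMap_algebraMap]; simp [evalPoint]

theorem residueMap_QLoc : residueMap l m (QLoc l m) = zeta l ^ m := by
  rw [QLoc, residueMap_algebraMap]; simp [evalPoint]

theorem isUnit_algebraMap_locRing (p : MvPolynomial (Fin 2) ℂ) (hp : evalPoint l m p ≠ 0) :
    IsUnit (algebraMap _ (LocRing l m) p) :=
  IsLocalization.map_units (M := (RingHom.ker (evalPoint l m)).primeCompl) _ ⟨p, hp⟩

theorem zeta_ne_zero : zeta l ≠ 0 := Complex.exp_ne_zero _

theorem isUnit_qLoc : IsUnit (qLoc l m) :=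
  isUnit_algebraMap_locRing l m _ (by simpa [evalPoint] using zeta_ne_zero l)

theorem isUnit_QLoc : IsUnit (QLoc l m) :=
  isUnit_algebraMap_locRing l m _ (by simpa [evalPoint] using zpow_ne_zero m (zeta_ne_zero l))

variable {l m}

theorem isUnit_QLoc_sub (h : Admissible l m) :
    IsUnit (QLoc l m - Ring.inverse (QLoc l m)) := by
  have h1 : QLoc l m * (QLoc l m - Ring.inverse (QLoc l m)) =
      algebraMap (MvPolynomial (Fin 2) ℂ) _ (MvPolynomial.X 1 ^ 2 - 1) := by
    rw [mul_sub, Ring.mul_inverse_cancel _ (isUnit_QLoc l m)]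
    simp [QLoc, sq]
  have h2 : IsUnit (QLoc l m * (QLoc l m - Ring.inverse (QLoc l m))) := by
    rw [h1]
    refine isUnit_algebraMap_locRing l m _ fun h0 => h.Q_ne_inv ?_
    have h3 : (zeta l ^ m) ^ 2 - 1 = 0 := by simpa [evalPoint] using h0
    have h4 := zpow_ne_zero m (zeta_ne_zero l)
    field_simp
    linear_combination h3
  exact isUnit_of_mul_isUnit_right h2

end

/-! ### Change of scalars -/

section ChangeOfScalars
variable {R S : Type*} [CommRing R] [CommRing S] (f : R →+* S)

theorem map_ringInverse {a : R} (ha : IsUnit a) : f (Ring.inverse a) = Ring.inverse (f a) := by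
  obtain ⟨u, rfl⟩ := ha
  rw [Ring.inverse_unit]
  exact (Ring.inverse_unit (Units.map (f : R →* S) u)).symm

theorem map_gaussTwo {q : R} (hq : IsUnit q) : f (gaussTwo q) = gaussTwo (f q) := by
  simp [gaussTwo, map_ringInverse f hq]

theorem map_blobParam {q Q : R} (hq : IsUnit q) (hQ : IsUnit Q)
    (hd : IsUnit (Q - Ring.inverse Q)) : f (blobParam q Q) = blobParam (f q) (f Q) := by
  simp [blobParam, map_ringInverse f hq, map_ringInverse f hQ, map_ringInverse f hd]

/-- The base change map between blob algebras along `f`: it is `f` on scalars and maps generators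
to generators. -/
noncomputable def Blob.map (n : ℕ) {q Q : R} (hq : IsUnit q) (hQ : IsUnit Q)
    (hd : IsUnit (Q - Ring.inverse Q)) {q' Q' : S} (h1 : f q = q') (h2 : f Q = Q') :
    Blob R n q Q →+* Blob S n q' Q' :=
  letI := f.toAlgebra
  (RingQuot.liftAlgHom R (s := BlobRel R n q Q)
    ⟨FreeAlgebra.lift R fun g => (Blob.gen q' Q' g : Blob S n q' Q'), by
      have hg : ∀ x : Blob S n q' Q', (gaussTwo q • x) = gaussTwo q' • x := by
        intro x
        have he : algebraMap R S (gaussTwo q) = gaussTwo q' := by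
          rw [← h1]; exact map_gaussTwo f hq
        rw [← he]
        exact (algebraMap_smul S (gaussTwo q) x).symm
      have hy : ∀ x : Blob S n q' Q', (blobParam q Q • x) = blobParam q' Q' • x := by
        intro x
        have he : algebraMap R S (blobParam q Q) = blobParam q' Q' := by
          rw [← h1, ← h2]; exact map_blobParam f hq hQ hd
        rw [← he]
        exact (algebraMap_smul S (blobParam q Q) x).symm
      intro x y h
      induction h with
      | U_sq i =>
        simpa [hg, Blob.gen] using Blob.rel (BlobRel.U_sq (R := S) (q := q') (Q := Q') i)
      | U_U_U i j h =>
        simpa [Blob.gen] using Blob.rel (BlobRel.U_U_U (R := S) (q := q') (Q := Q') i j h)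
      | U_comm i j h =>
        simpa [Blob.gen] using Blob.rel (BlobRel.U_comm (R := S) (q := q') (Q := Q') i j h)
      | U_e_U i h =>
        simpa [hy, Blob.gen] using Blob.rel (BlobRel.U_e_U (R := S) (q := q') (Q := Q') i h)
      | e_sq =>
        simpa [Blob.gen] using Blob.rel (BlobRel.e_sq (R := S) (n := n) (q := q') (Q := Q'))
      | U_e_comm i h =>
        simpa [Blob.gen] using Blob.rel (BlobRel.U_e_comm (R := S) (q := q') (Q := Q') i h)⟩
    ).toRingHom

theorem Blob.map_gen (n : ℕ) {q Q : R} (hq : IsUnit q) (hQ : IsUnit Q)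
    (hd : IsUnit (Q - Ring.inverse Q)) {q' Q' : S} (h1 : f q = q') (h2 : f Q = Q')
    (g : BlobGen n) : Blob.map f n hq hQ hd h1 h2 (Blob.gen q Q g) = Blob.gen q' Q' g := by
  let := f.toAlgebra
  simp [Blob.map, Blob.gen]

theorem Blob.map_algebraMap (n : ℕ) {q Q : R} (hq : IsUnit q) (hQ : IsUnit Q)
    (hd : IsUnit (Q - Ring.inverse Q)) {q' Q' : S} (h1 : f q = q') (h2 : f Q = Q') (r : R) :
    Blob.map f n hq hQ hd h1 h2 (algebraMap R _ r) = algebraMap S _ (f r) := by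
  let := f.toAlgebra
  simp only [Blob.map]
  exact (AlgHom.commutes _ r).trans (IsScalarTower.algebraMap_apply R S _ r)

end ChangeOfScalars

section ModularSystem
variable (l : ℕ) (m : ℤ) (n : ℕ)

/-- The blob algebra `b_n^𝒪(m)`. -/
abbrev BlobO : Type := Blob (LocRing l m) n (qLoc l m) (QLoc l m)

/-- The blob algebra `b_n^𝒦(m)`. -/
abbrev BlobK : Type := Blob (GenField l m) n (qGen l m) (QGen l m)

/-- The blob algebra `b_n(m)` over `ℂ`, with `q = exp (2 π i / l)` and `Q = q ^ m`. -/
abbrev BlobC : Type := Blob ℂ n (zeta l) (zeta l ^ m)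

variable {l m}

/-- The canonical map `b_n^𝒪(m) → b_n^𝒦(m)`. -/
noncomputable def blobToK (h : Admissible l m) : BlobO l m n →+* BlobK l m n :=
  Blob.map (algebraMap (LocRing l m) (GenField l m)) n (isUnit_qLoc l m) (isUnit_QLoc l m)
    (isUnit_QLoc_sub h) rfl rfl

/-- Reduction `b_n^𝒪(m) → b_n(m)` modulo the maximal ideal. -/
noncomputable def blobReduce (h : Admissible l m) : BlobO l m n →+* BlobC l m n :=
  Blob.map (residueMap l m) n (isUnit_qLoc l m) (isUnit_QLoc l m)
    (isUnit_QLoc_sub h) (residueMap_qLoc l m) (residueMap_QLoc l m)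

end ModularSystem

/-- `s ≈ t`: the bitableaux `s` and `t` have the same residues in `ℂ`, i.e. the same residue
sequence. -/
def SameResidues (l : ℕ) (m : ℤ) {n : ℕ} (s t : StdAll n) : Prop :=
  ∀ k, content (zeta l) (zeta l ^ m) s k = content (zeta l) (zeta l ^ m) t k

open Classical in
/-- The idempotent `e^b(i)` of `b_n^𝒦(m)`, where `i` is the residue sequence of `t`: the sum of
`(γ_s)⁻¹ f_{ss}` over all `s` with residue sequence `i`. -/
noncomputable def residueIdem (l : ℕ) (m : ℤ) {n : ℕ} [NeZero n] (γ : StdAll n → GenField l m)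
    (t : StdAll n) : BlobK l m n :=
  ∑ s : StdAll n with SameResidues l m s t,
    (γ s)⁻¹ • seminormalDiag (qGen l m) (QGen l m) s

/-! A one-line bitableau is a sequence of `n` signs (`true` for an entry of the second row), hence a
walk on the integers. Its height `lv` after `k` steps is the value of `f` on the shape of the
entries `≤ k`. For shapes of equal size the order `⪰` compares the numbers `rk f = |2 f + 1|`, the
smaller one being the more dominant. The maximal walk with a given end oscillates between `0` and
`-1` and then runs straight to its end; every other walk with this end arises from it by adding
boxes, that is, by exchanging two neighbouring steps so that the walk is pushed outward at one point
(`exists_boxChain`).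

Diagram basis. Normal words show that the blob algebra over any ring is spanned by `(2n choose n)`
elements. If `y_e` is a unit, each pair of walks with a common end gives an element `pairElt`: box
moves, times the word `topWord` of the maximal walk, times reversed box moves, rescaled by a power
of `y_e⁻¹`. It is realized by exactly one diagram, the one with the two prescribed bitableaux. There
are `(2n choose n)` such pairs, so these elements form a basis (`pairCoord_injective`), they are the
`m_{st}` (`mElt_eq`), and their coordinates commute with the maps from `𝒪` to `𝒦` and to `ℂ`
(`pairCoord_map`).

Seminormal representation. Over `𝒦` the algebra acts by matrices indexed by walks. The `L_k` are
diagonal with the contents as eigenvalues (`seminormalRep_jm`), `topWord` is diagonal too, and the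
diagram basis is triangular with non-zero leading entries, so the representation is faithful
(`seminormalRep_injective`). The element `F_t` becomes a diagonal matrix unit, `f_{tt} = γ_t F_t`
with `γ_t` the entry of `m_{tt}` at `(t,t)`, and the sum in the theorem becomes the indicator matrix
of a residue class.

Integrality. For each member of the class, a product of polynomials in the `L_k` whose denominators
are units of `𝒪` has eigenvalue `1` on it and `0` outside the class. One minus the product of the
complements of these elements is the indicator matrix, so the sum lies in `b_n^𝒪`
(`residueIdem_mem_range_blobToK`).

Leading term. Suppose a walk has the residues of the maximal one and first leaves it at height `j`.
Then `ζ^(2j) ζ^(2m) = 1`, and the conditions on the parameters exclude `j = -1, 0, 1`. So the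
maximal walk is already on its straight part, the other one turns back, and it ends at smaller rank
(`SameResidues.eq_or_rk_lt`). Hence on all blocks of rank at least that of `λ` the indicator matrix
equals the matrix of `y_e^(-h) m_{TT}`, where `T` is the maximal bitableau and `h = min(a, b)`. By
triangularity the two elements differ only by diagrams of more dominant shapes
(`pairCoord_residueIdem`), and reduction modulo the maximal ideal gives the claim with `r` the value
of `y_e^(-h)`. -/

/-! ### Normal words in the blob algebra -/

/-- The relations of the generators `g 0 = e, g 1 = U_1, …` of the blob algebra. -/
structure IsBlobFamily {R A : Type*} [CommRing R] [Ring A] [Algebra R A] (n : ℕ) (g : ℕ → A)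
    (d y : R) : Prop where
  sq_zero : g 0 * g 0 = g 0
  sq : ∀ i, 1 ≤ i → i < n → g i * g i = d • g i
  up : ∀ i, 1 ≤ i → i + 1 < n → g i * (g (i + 1) * g i) = g i
  down : ∀ i, 1 ≤ i → i + 1 < n → g (i + 1) * (g i * g (i + 1)) = g (i + 1)
  comm : ∀ i j, i + 2 ≤ j → j < n → g i * g j = g j * g i
  loop : 1 < n → g 1 * (g 0 * g 1) = y • g 1

section NormalWords
variable {R A : Type*} [CommRing R] [Ring A] [Algebra R A]

/-- The descending product `g (M - 1) * ⋯ * g j`. -/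
def descProd (g : ℕ → A) : ℕ → ℕ → A
  | 0, _ => 1
  | M + 1, j => if j ≤ M then g M * descProd g M j else 1

/-- The normal words in `g 0, …, g (m - 1)` whose last factor ends in a `g j` with `j < p`. -/
def normalWords (g : ℕ → A) : ℕ → ℕ → List A
  | 0, _ => [1]
  | m + 1, p => normalWords g m p ++ (List.range (min p (m + 1))).flatMap fun j =>
      (normalWords g m (max j 1)).map (· * descProd g (m + 1) j)

variable (R) in
/-- The span of the normal words. -/
def normalSpan (g : ℕ → A) (m p : ℕ) : Submodule R A :=
  Submodule.span R {x | x ∈ normalWords g m p}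

variable {g : ℕ → A}

theorem descProd_of_le {M j : ℕ} (h : M ≤ j) : descProd g M j = 1 := by
  cases M with
  | zero => rfl
  | succ M => rw [descProd, if_neg (by omega)]

theorem descProd_succ {M j : ℕ} (h : j ≤ M) :
    descProd g (M + 1) j = g M * descProd g M j := by
  rw [descProd, if_pos h]

theorem descProd_self (M : ℕ) : descProd g (M + 1) M = g M := by
  rw [descProd_succ le_rfl, descProd_of_le le_rfl, mul_one]

theorem descProd_mul {M j k : ℕ} (h1 : j ≤ k) (h2 : k ≤ M) :
    descProd g M j = descProd g M k * descProd g k j := by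
  induction M, h2 using Nat.le_induction with
  | base => rw [descProd_of_le le_rfl, one_mul]
  | succ M h ih => rw [descProd_succ (h1.trans h), descProd_succ h, ih, mul_assoc]

theorem mem_normalWords_succ {m p : ℕ} {x : A} :
    x ∈ normalWords g (m + 1) p ↔ x ∈ normalWords g m p ∨
      ∃ j, j < p ∧ j ≤ m ∧ ∃ w ∈ normalWords g m (max j 1), w * descProd g (m + 1) j = x := by
  simp only [normalWords, List.mem_append, List.mem_flatMap, List.mem_range, List.mem_map,
    lt_min_iff, Nat.lt_succ_iff, and_assoc]

theorem one_mem_normalSpan (m p : ℕ) : 1 ∈ normalSpan R g m p := by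
  apply Submodule.subset_span
  induction m with
  | zero => simp [normalWords]
  | succ m ih => exact mem_normalWords_succ.2 (Or.inl ih)

theorem normalSpan_mono_left {m m' p : ℕ} (h : m ≤ m') :
    normalSpan R g m p ≤ normalSpan R g m' p := by
  induction m', h using Nat.le_induction with
  | base => exact le_rfl
  | succ m' h ih =>
    exact ih.trans (Submodule.span_mono fun x hx => mem_normalWords_succ.2 (Or.inl hx))

theorem normalSpan_mono_right {m p p' : ℕ} (h : p ≤ p') :
    normalSpan R g m p ≤ normalSpan R g m p' := by
  apply Submodule.span_mono
  induction m with
  | zero => exact fun x hx => hx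
  | succ m ih =>
    intro x hx
    rcases mem_normalWords_succ.1 hx with hx | ⟨j, hj, h'⟩
    · exact mem_normalWords_succ.2 (Or.inl (ih hx))
    · exact mem_normalWords_succ.2 (Or.inr ⟨j, hj.trans_le h, h'⟩)

theorem mul_descProd_mem {m p j : ℕ} (hj : j ≤ m) (hp : j < p) {x : A}
    (hx : x ∈ normalSpan R g m (max j 1)) :
    x * descProd g (m + 1) j ∈ normalSpan R g (m + 1) p := by
  induction hx using Submodule.span_induction with
  | mem x hx =>
    exact Submodule.subset_span (mem_normalWords_succ.2 (Or.inr ⟨j, hp, hj, x, hx, rfl⟩))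
  | zero => rw [zero_mul]; exact zero_mem _
  | add x y _ _ h1 h2 => rw [add_mul]; exact add_mem h1 h2
  | smul a x _ h => rw [smul_mul_assoc]; exact Submodule.smul_mem _ _ h

theorem normalSpan_le_full (m p : ℕ) : normalSpan R g m p ≤ normalSpan R g m (m + 1) := by
  induction m with
  | zero => exact Submodule.span_mono fun x hx => hx
  | succ m ih =>
    refine Submodule.span_le.2 fun x hx => ?_
    rcases mem_normalWords_succ.1 hx with hx | ⟨j, hj, hm, w, hw, rfl⟩
    · exact normalSpan_mono_right (Nat.le_succ _)
        (normalSpan_mono_left (Nat.le_succ _) (ih (Submodule.subset_span hx)))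
    · exact mul_descProd_mem hm (by omega) (Submodule.subset_span hw)

/-- To multiply the span of the normal words into a submodule it is enough to treat the two kinds
of normal words. -/
theorem mul_mem_of_normalSpan_succ {m p : ℕ} {z : A} {S : Submodule R A}
    (h1 : ∀ x ∈ normalSpan R g m p, x * z ∈ S)
    (h2 : ∀ j, j < p → j ≤ m → ∀ x ∈ normalSpan R g m (max j 1),
      x * descProd g (m + 1) j * z ∈ S) {x : A}
    (hx : x ∈ normalSpan R g (m + 1) p) : x * z ∈ S := by
  induction hx using Submodule.span_induction with
  | mem x hx =>
    rcases mem_normalWords_succ.1 hx with hx | ⟨j, hj, hm, w, hw, rfl⟩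
    · exact h1 _ (Submodule.subset_span hx)
    · exact h2 j hj hm _ (Submodule.subset_span hw)
  | zero => rw [zero_mul]; exact zero_mem _
  | add x y _ _ h1 h2 => rw [add_mul]; exact add_mem h1 h2
  | smul a x _ h => rw [smul_mul_assoc]; exact Submodule.smul_mem _ _ h

variable {n : ℕ} {d y : R}

theorem IsBlobFamily.commute_descProd (hg : IsBlobFamily n g d y) {i j M : ℕ} (h : i + 2 ≤ j)
    (hM : M ≤ n) : Commute (g i) (descProd g M j) := by
  induction M with
  | zero => exact Commute.one_right _
  | succ M ih =>
    by_cases hj : j ≤ M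
    · rw [descProd_succ hj]
      exact Commute.mul_right (hg.comm i M (by omega) hM) (ih (by omega))
    · rw [descProd_of_le (by omega)]; exact Commute.one_right _

theorem IsBlobFamily.commute_descProd' (hg : IsBlobFamily n g d y) {i j M : ℕ} (h : M + 1 ≤ i)
    (hi : i < n) : Commute (g i) (descProd g M j) := by
  induction M with
  | zero => exact Commute.one_right _
  | succ M ih =>
    by_cases hj : j ≤ M
    · rw [descProd_succ hj]
      exact Commute.mul_right (hg.comm M i (by omega) hi).symm (ih (by omega))
    · rw [descProd_of_le (by omega)]; exact Commute.one_right _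

theorem IsBlobFamily.commute_descProd_descProd (hg : IsBlobFamily n g d y) {i j M M' : ℕ}
    (h : M' + 1 ≤ j) (hM : M ≤ n) : Commute (descProd g M' i) (descProd g M j) := by
  induction M' with
  | zero => exact Commute.one_left _
  | succ M' ih =>
    by_cases hj : i ≤ M'
    · rw [descProd_succ hj]
      exact Commute.mul_left (hg.commute_descProd (by omega) hM) (ih (by omega))
    · rw [descProd_of_le (by omega)]; exact Commute.one_left _

/-- The last factor `g j'` of the first product commutes with everything in the second one down to
`g (j' + 2)`, and there `g j' * g (j' + 1) * g j' = g j'` applies. The remaining tail `g j' ⋯ g j`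
commutes back to the left. The case `j' = 0` is excluded because `e U_1 e` does not collapse; this
is why the end `0` may repeat in normal words. -/
theorem IsBlobFamily.descProd_mul_descProd (hg : IsBlobFamily n g d y) {i m j j' : ℕ}
    (h1 : j ≤ j') (h2 : 1 ≤ j') (h3 : j' ≤ i) (h4 : i + 1 ≤ m) (h5 : m < n) :
    descProd g (i + 1) j' * descProd g (m + 1) j =
      descProd g (i + 1) j * descProd g (m + 1) (j' + 2) := by
  rw [descProd_mul (g := g) (M := i + 1) (Nat.le_succ j') (by omega), descProd_self,
    descProd_mul (g := g) (M := m + 1) (j := j) (k := j' + 2) (by omega) (by omega),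
    descProd_mul (g := g) (M := i + 1) (j := j) (k := j' + 1) (by omega) (by omega)]
  have hc := (hg.commute_descProd (i := j') (j := j' + 2) (M := m + 1) le_rfl h5).eq
  have hc' := (hg.commute_descProd_descProd (M' := j' + 1) (i := j) (j := j' + 2) (M := m + 1)
    le_rfl h5).eq
  rw [mul_assoc, mul_assoc, hc', ← mul_assoc (g j'), hc,
    descProd_succ (show j ≤ j' + 1 by omega), descProd_succ h1]
  have := hg.up j' h2 (by omega)
  simp only [mul_assoc] at this ⊢
  rw [← mul_assoc (g (j' + 1)), ← mul_assoc (g j'), this]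

/-- Induction on the number of generators in the left factor. If its last end lies below `max j 1`
the product is normal already. Otherwise `descProd_mul_descProd` exchanges the tails, the shorter
product is absorbed by induction, and the new last end is `j' + 2`, whence the bound `p + 2`. -/
theorem IsBlobFamily.normalSpan_mul_descProd (hg : IsBlobFamily n g d y) (m' : ℕ) :
    ∀ m p j, m' ≤ m → j ≤ m → m < n → ∀ x ∈ normalSpan R g m' p,
      x * descProd g (m + 1) j ∈ normalSpan R g (m + 1) (max (p + 2) (j + 1)) := by
  induction m' with
  | zero =>
    intro m p j _ hj _ x hx
    refine mul_descProd_mem hj (by omega) ?_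
    have : x ∈ normalSpan R g 0 (max j 1) := hx
    exact normalSpan_mono_left (Nat.zero_le _) this
  | succ m' ih =>
    intro m p j hm hj hn x hx
    refine mul_mem_of_normalSpan_succ (g := g) (fun x hx => ih m p j (by omega) hj hn x hx) ?_ hx
    intro j' hp hj' w hw
    by_cases hc : j' < max j 1
    · refine mul_descProd_mem hj (by omega) ?_
      exact normalSpan_mono_left hm (mul_descProd_mem hj' hc hw)
    · rw [mul_assoc, hg.descProd_mul_descProd (by omega) (by omega) hj' hm hn, ← mul_assoc]
      have h1 := ih m' _ j le_rfl (by omega) (by omega) w hw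
      have h2 := normalSpan_mono_left hm (normalSpan_mono_right
        (show max (max j' 1 + 2) (j + 1) ≤ max (j' + 2) 1 by omega) h1)
      -- In the other case `j' + 2 = m + 1` and the second product is empty.
      by_cases hc' : j' + 2 ≤ m
      · exact mul_descProd_mem hc' (by omega) h2
      · rw [descProd_of_le (g := g) (M := m + 1) (j := j' + 2) (by omega), mul_one]
        exact normalSpan_mono_left (Nat.le_succ _) (normalSpan_mono_right
          (show max (j' + 2) 1 ≤ max (p + 2) (j + 1) by omega) h2)

theorem IsBlobFamily.mul_descProd_mem_full (hg : IsBlobFamily n g d y) {m j : ℕ} (hj : j ≤ m)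
    (hm : m < n) {x : A} (hx : x ∈ normalSpan R g m (m + 1)) :
    x * descProd g (m + 1) j ∈ normalSpan R g (m + 1) (m + 2) :=
  normalSpan_le_full _ _ (hg.normalSpan_mul_descProd m m _ j le_rfl hj hm x hx)

theorem descProd_mem_of_closed {S : Submodule R A} {m : ℕ}
    (h : ∀ k, k < m → ∀ x ∈ S, x * g k ∈ S) (M j : ℕ) (hM : M ≤ m) {x : A} (hx : x ∈ S) :
    x * descProd g M j ∈ S := by
  induction M generalizing x with
  | zero => simpa [descProd] using hx
  | succ M ih =>
    by_cases hj : j ≤ M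
    · rw [descProd_succ hj, ← mul_assoc]
      exact ih (by omega) (h M (by omega) x hx)
    · rw [descProd_of_le (by omega), mul_one]; exact hx

/-- The span of all normal words is a right ideal. For a last factor `g m ⋯ g j` multiplied by `g k`
there are five cases. If `k < j - 1` then `g k` commutes to the left; if `k = j - 1` the factor gets
longer; if `k = j` the relation for squares applies; if `k = j + 1` the relation `down` or `loop`
shortens the factor to end in `g (j + 1)`. If `k > j + 1` the factor breaks into a product in
smaller generators, absorbed by induction, and the factor that ends in `g k`. -/
theorem IsBlobFamily.normalSpan_mul_gen (hg : IsBlobFamily n g d y) (m : ℕ) (hm : m ≤ n) :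
    ∀ k, k < m → ∀ x ∈ normalSpan R g m (m + 1), x * g k ∈ normalSpan R g m (m + 1) := by
  induction m with
  | zero => intro k hk; omega
  | succ m ih =>
    have ih := ih (by omega)
    intro k hk x hx
    refine mul_mem_of_normalSpan_succ (g := g) (fun x hx => ?_) ?_ hx
    · have hx := normalSpan_le_full _ _ hx
      rcases Nat.lt_succ_iff_lt_or_eq.1 hk with hk | rfl
      · exact normalSpan_mono_left (Nat.le_succ _)
          (normalSpan_mono_right (Nat.le_succ _) (ih k hk x hx))
      · rw [← descProd_self (g := g) k]
        exact hg.mul_descProd_mem_full le_rfl hm hx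
    · intro j _ hj x hx
      have hx' := normalSpan_le_full _ _ hx
      rw [mul_assoc]
      have hs : descProd g (m + 1) j = descProd g (m + 1) (j + 1) * g j := by
        rw [descProd_mul (Nat.le_succ j) (by omega), descProd_self]
      rcases lt_trichotomy k j with hkj | rfl | hkj
      · rcases Nat.eq_or_lt_of_le (Nat.succ_le_of_lt hkj) with rfl | hkj
        · have : descProd g (m + 1) (k + 1) * g k = descProd g (m + 1) k := by
            rw [descProd_mul (j := k) (k := k + 1) (by omega) (by omega), descProd_self]
          rw [Nat.succ_eq_add_one, this]
          exact hg.mul_descProd_mem_full (by omega) hm hx'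
        · rw [← (hg.commute_descProd (by omega) hm).eq, ← mul_assoc]
          exact hg.mul_descProd_mem_full hj hm (ih k (by omega) x hx')
      · rcases Nat.eq_zero_or_pos k with rfl | hk0
        · rw [hs, mul_assoc, hg.sq_zero, ← hs]
          exact hg.mul_descProd_mem_full hj hm hx'
        · rw [hs, mul_assoc, hg.sq k hk0 (by omega), mul_smul_comm, mul_smul_comm, ← hs]
          exact Submodule.smul_mem _ _ (hg.mul_descProd_mem_full hj hm hx')
      · rcases Nat.eq_or_lt_of_le (Nat.succ_le_of_lt hkj) with rfl | hkj
        · rw [Nat.succ_eq_add_one] at *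
          have hs' : descProd g (m + 1) (j + 1) = descProd g (m + 1) (j + 2) * g (j + 1) := by
            rw [descProd_mul (j := j + 1) (k := j + 2) (by omega) (by omega), descProd_self]
          rcases Nat.eq_zero_or_pos j with rfl | hj0
          · rw [hs, hs', mul_assoc, mul_assoc, hg.loop (by omega), mul_smul_comm, mul_smul_comm,
              ← hs']
            exact Submodule.smul_mem _ _ (hg.mul_descProd_mem_full (by omega) hm hx')
          · rw [hs, hs', mul_assoc, mul_assoc, hg.down j hj0 (by omega), ← hs']
            exact hg.mul_descProd_mem_full (by omega) hm hx'
        · obtain ⟨k, rfl⟩ : ∃ i, k = i + 1 := ⟨k - 1, by omega⟩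
          have hs' : descProd g (m + 1) (k + 1) = descProd g (m + 1) (k + 2) * g (k + 1) := by
            rw [descProd_mul (j := k + 1) (k := k + 2) (by omega) (by omega), descProd_self]
          have h1 : descProd g (m + 1) j = descProd g (m + 1) (k + 1) *
              (g k * descProd g k j) := by
            rw [descProd_mul (j := j) (k := k + 1) (by omega) (by omega),
              descProd_succ (by omega : j ≤ k)]
          have h2 := (hg.commute_descProd' (i := k + 1) (j := j) (M := k) le_rfl (by omega)).eq
          have h3 := (hg.commute_descProd_descProd (M' := k) (i := j) (j := k + 1) (M := m + 1)
            le_rfl hm).eq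
          have h4 : descProd g (m + 1) j * g (k + 1) =
              descProd g k j * descProd g (m + 1) (k + 1) := by
            rw [h1, h3, mul_assoc, mul_assoc, ← h2, ← mul_assoc (g k), ← mul_assoc _ (g k * _), hs',
              mul_assoc _ (g (k + 1)), hg.down k (by omega) (by omega)]
          rw [h4, ← mul_assoc]
          exact hg.mul_descProd_mem_full (by omega) hm
            (descProd_mem_of_closed ih _ _ (by omega) hx')

-- Both sides obey a Pascal recursion in `(m, p)`, with the value `2 ^ m` on the edge `p = 0`, where
-- all factors end in `g 0` and each of them may be present or not. For `p = m` only the central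
-- binomial coefficient is left in the sum.
open Finset in
theorem length_normalWords (m p : ℕ) (hp : p ≤ m) :
    (normalWords g m (p + 1)).length = ∑ k ∈ Ico p (m + 1), (m + p).choose k := by
  have hrec : ∀ m p, (normalWords g (m + 1) p).length = (normalWords g m p).length +
      ∑ j ∈ range (min p (m + 1)), (normalWords g m (max j 1)).length := by
    intro m p
    simp only [normalWords, List.length_append, List.length_flatMap, List.length_map]
    rfl
  have hstab : ∀ m p, m + 1 ≤ p →
      (normalWords g m p).length = (normalWords g m (m + 1)).length := by
    intro m
    induction m with
    | zero => intros; rfl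
    | succ m ih =>
      intro p h
      rw [hrec, hrec, ih _ (by omega), ih (m + 1 + 1) (by omega), min_eq_right (by omega),
        min_eq_right (by omega)]
  have hpas : ∀ m p, p ≤ m → 1 ≤ p → (normalWords g (m + 1) (p + 1)).length =
      (normalWords g (m + 1) p).length + (normalWords g m (p + 1)).length := by
    intro m p h h1
    rw [hrec, hrec, min_eq_left (by omega), min_eq_left (by omega), sum_range_succ,
      max_eq_left h1]
    ring
  have hlast : ∀ m, (normalWords g (m + 1) (m + 2)).length =
      (normalWords g (m + 1) (m + 1)).length := by
    intro m
    rw [hrec, hrec, hstab m (m + 2) (by omega), min_eq_right (by omega), min_eq_right (by omega)]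
  have hpascal : ∀ m p, p ≤ m → ∑ k ∈ Ico (p + 1) (m + 2), (m + p + 2).choose k =
      ∑ k ∈ Ico p (m + 2), (m + p + 1).choose k +
        ∑ k ∈ Ico (p + 1) (m + 1), (m + p + 1).choose k := by
    intro m p h
    have e1 : ∑ k ∈ Ico (p + 1) (m + 2), (m + p + 2).choose k =
        ∑ k ∈ Ico (p + 1) (m + 2), (m + p + 1).choose (k - 1) +
          ∑ k ∈ Ico (p + 1) (m + 2), (m + p + 1).choose k := by
      rw [← sum_add_distrib]
      refine sum_congr rfl fun k hk => ?_
      obtain ⟨k, rfl⟩ : ∃ i, k = i + 1 := ⟨k - 1, by have := (mem_Ico.1 hk).1; omega⟩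
      rw [Nat.choose_succ_succ]; rfl
    have e2 : ∑ k ∈ Ico (p + 1) (m + 2), (m + p + 1).choose (k - 1) =
        ∑ k ∈ Ico p (m + 1), (m + p + 1).choose k := by
      rw [← sum_Ico_add' (fun k => (m + p + 1).choose (k - 1)) p (m + 1) 1]
      rfl
    rw [e1, e2, sum_Ico_succ_top (a := p + 1) (b := m + 1) (by omega),
      sum_Ico_succ_top (a := p) (b := m + 1) (by omega)]
    ring
  induction m generalizing p with
  | zero => obtain rfl : p = 0 := by omega
            simp [normalWords]
  | succ m ih =>
    induction p with
    | zero =>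
      rw [hrec, min_eq_left (by omega)]
      have := ih 0 (Nat.zero_le _)
      simp only [zero_add, range_one, sum_singleton, add_zero] at this ⊢
      rw [max_eq_right (Nat.zero_le _), this]
      have h1 := Nat.sum_range_choose m
      have h2 := Nat.sum_range_choose (m + 1)
      rw [range_eq_Ico] at h1 h2
      rw [h1, h2]; ring
    | succ p ihp =>
      rcases Nat.eq_or_lt_of_le hp with h | h
      · obtain rfl : p = m := by omega
        rw [hlast, ihp (by omega)]
        rw [sum_Ico_succ_top (by omega), sum_Ico_succ_top (by omega), Ico_self, sum_empty,
          sum_Ico_succ_top (by omega), Ico_self, sum_empty,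
          show p + 1 + (p + 1) = (p + 1 + p) + 1 by ring, Nat.choose_succ_succ]
        ring
      · rw [hpas _ _ (by omega) (by omega), ihp (by omega), ih _ (by omega)]
        have := hpascal m p (by omega)
        rw [show m + 1 + (p + 1) = m + p + 2 by ring, show m + 1 + p = m + p + 1 by ring,
          show m + (p + 1) = m + p + 1 by ring]
        exact this.symm

open Finset in
/-- An algebra that is generated by a family with the blob relations is spanned by at most
`(2n choose n)` elements. -/
theorem IsBlobFamily.exists_span_eq_top (hg : IsBlobFamily n g d y)
    (hgen : Algebra.adjoin R {x | ∃ k < n, g k = x} = ⊤) :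
    ∃ v : Fin ((2 * n).choose n) → A, Submodule.span R (Set.range v) = ⊤ := by
  have hlen : (normalWords g n (n + 1)).length = (2 * n).choose n := by
    rw [length_normalWords n n le_rfl, sum_Ico_succ_top le_rfl, Ico_self, sum_empty, zero_add,
      two_mul]
  refine ⟨fun i => (normalWords g n (n + 1)).get (i.cast hlen.symm), ?_⟩
  have hr : Set.range (fun i : Fin ((2 * n).choose n) =>
      (normalWords g n (n + 1)).get (i.cast hlen.symm)) = {x | x ∈ normalWords g n (n + 1)} := by
    ext x
    simp only [Set.mem_range, Set.mem_ofPred_eq, List.mem_iff_get]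
    exact ⟨fun ⟨i, h⟩ => ⟨_, h⟩, fun ⟨i, h⟩ => ⟨i.cast hlen, h⟩⟩
  rw [hr, eq_top_iff]
  intro x _
  have hx : x ∈ Algebra.adjoin R {x | ∃ k < n, g k = x} := by rw [hgen]; exact Algebra.mem_top
  clear * - hg hx
  have key : ∀ z ∈ normalSpan R g n (n + 1), z * x ∈ normalSpan R g n (n + 1) := by
    induction hx using Algebra.adjoin_induction with
    | mem x hx =>
      obtain ⟨k, hk, rfl⟩ := hx
      exact hg.normalSpan_mul_gen n le_rfl k hk
    | algebraMap r =>
      intro z hz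
      rw [← Algebra.commutes, ← Algebra.smul_def]
      exact Submodule.smul_mem _ _ hz
    | add x y _ _ h1 h2 => intro z hz; rw [mul_add]; exact add_mem (h1 z hz) (h2 z hz)
    | mul x y _ _ h1 h2 => intro z hz; rw [← mul_assoc]; exact h2 _ (h1 z hz)
  have := key 1 (one_mem_normalSpan _ _)
  rwa [one_mul] at this

end NormalWords

/-! ### The blob algebra is spanned by `(2n choose n)` elements. -/

namespace Blob
variable {R : Type*} [CommRing R] {n : ℕ} (q Q : R)

/-- The generators `e, U_1, U_2, …` in one sequence. -/
noncomputable def genSeq (k : ℕ) : Blob R n q Q :=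
  if k = 0 then gen q Q .e else if h : k - 1 < n - 1 then gen q Q (.U ⟨k - 1, h⟩) else 0

theorem isBlobFamily (hn : 1 ≤ n) :
    IsBlobFamily n (genSeq q Q : ℕ → Blob R n q Q) (-gaussTwo q) (blobParam q Q) where
  sq_zero := by
    simpa [genSeq, gen] using rel (BlobRel.e_sq (R := R) (n := n) (q := q) (Q := Q))
  sq i h1 h2 := by
    have h3 : i - 1 < n - 1 := by omega
    have h : (genSeq q Q i : Blob R n q Q) = gen q Q (.U ⟨i - 1, h3⟩) := by
      simp [genSeq, show i ≠ 0 by omega, h3]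
    have h' := rel (BlobRel.U_sq (q := q) (Q := Q) ⟨i - 1, h3⟩)
    rw [map_mul, map_neg, map_smul] at h'
    rw [h, gen, h']
    exact (neg_smul (gaussTwo q) (gen q Q (.U ⟨i - 1, h3⟩) : Blob R n q Q)).symm
  up i h1 h2 := by
    have h3 : i - 1 < n - 1 := by omega
    have h4 : i < n - 1 := by omega
    simpa [genSeq, gen, show i ≠ 0 by omega, h3, h4, mul_assoc] using
      rel (BlobRel.U_U_U (q := q) (Q := Q) ⟨i - 1, h3⟩ ⟨i, h4⟩ (Or.inl (by simp; omega)))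
  down i h1 h2 := by
    have h3 : i - 1 < n - 1 := by omega
    have h4 : i < n - 1 := by omega
    simpa [genSeq, gen, show i ≠ 0 by omega, h3, h4, mul_assoc] using
      rel (BlobRel.U_U_U (q := q) (Q := Q) ⟨i, h4⟩ ⟨i - 1, h3⟩ (Or.inr (by simp; omega)))
  comm i j h1 h2 := by
    have h4 : j - 1 < n - 1 := by omega
    rcases Nat.eq_zero_or_pos i with rfl | hi
    · simpa [genSeq, gen, show j ≠ 0 by omega, h4] using
        (rel (BlobRel.U_e_comm (q := q) (Q := Q) ⟨j - 1, h4⟩ (by simp; omega))).symm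
    · have h3 : i - 1 < n - 1 := by omega
      simpa [genSeq, gen, show i ≠ 0 by omega, show j ≠ 0 by omega, h3, h4] using
        rel (BlobRel.U_comm (q := q) (Q := Q) ⟨i - 1, h3⟩ ⟨j - 1, h4⟩ (Or.inl (by simp; omega)))
  loop h := by
    have h3 : 0 < n - 1 := by omega
    simpa [genSeq, gen, h3, mul_assoc] using
      rel (BlobRel.U_e_U (q := q) (Q := Q) ⟨0, h3⟩ rfl)

theorem adjoin_gen : Algebra.adjoin R (Set.range (gen q Q : BlobGen n → Blob R n q Q)) = ⊤ := by
  rw [eq_top_iff]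
  intro x _
  obtain ⟨a, rfl⟩ := RingQuot.mkAlgHom_surjective R (BlobRel R n q Q) x
  induction a using FreeAlgebra.induction with
  | grade0 r => rw [AlgHom.commutes]; exact Subalgebra.algebraMap_mem _ r
  | grade1 g => exact Algebra.subset_adjoin ⟨g, rfl⟩
  | mul a b ha hb => rw [map_mul]; exact Subalgebra.mul_mem _ (ha trivial) (hb trivial)
  | add a b ha hb => rw [map_add]; exact Subalgebra.add_mem _ (ha trivial) (hb trivial)

theorem exists_span_eq_top (hn : 1 ≤ n) :
    ∃ v : Fin ((2 * n).choose n) → Blob R n q Q, Submodule.span R (Set.range v) = ⊤ := by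
  refine (isBlobFamily q Q hn).exists_span_eq_top (top_le_iff.1 ?_)
  rw [← adjoin_gen]
  refine Algebra.adjoin_mono ?_
  rintro _ ⟨g, rfl⟩
  cases g with
  | e => exact ⟨0, hn, by simp [genSeq]⟩
  | U i => exact ⟨i + 1, by omega, by simp [genSeq]⟩

end Blob

/-! ### Sign sequences and box moves -/

namespace SignSeq
variable {n : ℕ}

/-- The number of entries `b` of `w` before position `k`. -/
def cnt (b : Bool) (w : Fin n → Bool) (k : ℕ) : ℕ :=
  (Finset.univ.filter fun j : Fin n => (j : ℕ) < k ∧ w j = b).card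

/-- The level of `w` before position `k`: entries `false` are steps up, entries `true` are steps
down. -/
def lv (w : Fin n → Bool) (k : ℕ) : ℤ := cnt false w k - cnt true w k

theorem cnt_zero (b : Bool) (w : Fin n → Bool) : cnt b w 0 = 0 := by simp [cnt]

theorem cnt_succ (b : Bool) (w : Fin n → Bool) (k : Fin n) :
    cnt b w (k + 1) = cnt b w k + if w k = b then 1 else 0 := by
  have : (Finset.univ.filter fun j : Fin n => (j : ℕ) < k + 1 ∧ w j = b) =
      (Finset.univ.filter fun j : Fin n => (j : ℕ) < k ∧ w j = b) ∪ if w k = b then {k} else ∅ := by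
    ext j
    split_ifs with h
    · simp only [Finset.mem_filter, Finset.mem_univ, true_and, Finset.mem_union,
        Finset.mem_singleton, Fin.ext_iff]
      constructor
      · rintro ⟨h1, h2⟩
        rcases Nat.lt_succ_iff_lt_or_eq.1 h1 with h3 | h3
        · exact Or.inl ⟨h3, h2⟩
        · exact Or.inr h3
      · rintro (⟨h1, h2⟩ | h1)
        · exact ⟨by omega, h2⟩
        · exact ⟨by omega, by rwa [Fin.ext h1]⟩
    · simp only [Finset.mem_filter, Finset.mem_univ, true_and, Finset.union_empty]
      constructor
      · rintro ⟨h1, h2⟩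
        rcases Nat.lt_succ_iff_lt_or_eq.1 h1 with h3 | h3
        · exact ⟨h3, h2⟩
        · exact absurd (Fin.ext h3 ▸ h2) h
      · rintro ⟨h1, h2⟩
        exact ⟨by omega, h2⟩
  rw [cnt, this, Finset.card_union_of_disjoint, ← cnt]
  · split_ifs <;> simp
  · split_ifs
    · simp
    · simp

theorem cnt_congr {b : Bool} {w w' : Fin n → Bool} {k : ℕ}
    (h : ∀ j : Fin n, (j : ℕ) < k → w j = w' j) : cnt b w k = cnt b w' k := by
  unfold cnt
  congr 1
  ext j
  simp only [Finset.mem_filter, Finset.mem_univ, true_and]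
  exact and_congr_right fun hj => by rw [h j hj]

theorem lv_zero (w : Fin n → Bool) : lv w 0 = 0 := by simp [lv, cnt_zero]

theorem lv_succ (w : Fin n → Bool) (k : Fin n) :
    lv w (k + 1) = lv w k + if w k then -1 else 1 := by
  unfold lv
  rw [cnt_succ, cnt_succ]
  cases w k <;> simp <;> ring

theorem lv_congr {w w' : Fin n → Bool} {k : ℕ} (h : ∀ j : Fin n, (j : ℕ) < k → w j = w' j) :
    lv w k = lv w' k := by
  unfold lv; rw [cnt_congr h, cnt_congr h]

theorem cnt_add_cnt (w : Fin n → Bool) {k : ℕ} (hk : k ≤ n) :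
    cnt false w k + cnt true w k = k := by
  induction k with
  | zero => simp [cnt_zero]
  | succ k ih =>
    have h1 := cnt_succ false w ⟨k, hk⟩
    have h2 := cnt_succ true w ⟨k, hk⟩
    simp only at h1 h2
    rw [h1, h2]
    have := ih (by omega)
    cases w ⟨k, hk⟩ <;> simp <;> omega

theorem lv_eq_iff {w w' : Fin n → Bool} {k : ℕ} (hk : k ≤ n) :
    lv w k = lv w' k ↔ cnt true w k = cnt true w' k := by
  have := cnt_add_cnt w hk
  have := cnt_add_cnt w' hk
  unfold lv
  omega

/-- The `k`-th position. -/
def lo (k : Fin (n - 1)) : Fin n := ⟨k, by omega⟩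

/-- The position after the `k`-th one. -/
def hi (k : Fin (n - 1)) : Fin n := ⟨k + 1, by omega⟩

/-- Exchange of the entries at two neighbouring positions. -/
def sw (k : Fin (n - 1)) (w : Fin n → Bool) : Fin n → Bool := w ∘ Equiv.swap (lo k) (hi k)

@[simp] theorem sw_lo (k : Fin (n - 1)) (w : Fin n → Bool) : sw k w (lo k) = w (hi k) := by
  simp [sw]

@[simp] theorem sw_hi (k : Fin (n - 1)) (w : Fin n → Bool) : sw k w (hi k) = w (lo k) := by
  simp [sw]

theorem sw_of_ne {k : Fin (n - 1)} {j : Fin n} (w : Fin n → Bool) (h1 : j ≠ lo k) (h2 : j ≠ hi k) :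
    sw k w j = w j := by
  simp [sw, Equiv.swap_apply_of_ne_of_ne h1 h2]

@[simp] theorem sw_sw (k : Fin (n - 1)) (w : Fin n → Bool) : sw k (sw k w) = w := by
  ext j; simp [sw]

theorem sw_eq_self {k : Fin (n - 1)} {w : Fin n → Bool} (h : w (lo k) = w (hi k)) : sw k w = w := by
  ext j
  by_cases h1 : j = lo k
  · subst h1; simp [h]
  by_cases h2 : j = hi k
  · subst h2; simp [h]
  rw [sw_of_ne w h1 h2]

theorem sw_ne_self {k : Fin (n - 1)} {w : Fin n → Bool} (h : w (lo k) ≠ w (hi k)) : sw k w ≠ w :=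
  fun h' => h (by rw [← sw_hi k w, h'])

theorem cnt_sw (b : Bool) (k : Fin (n - 1)) (w : Fin n → Bool) {z : ℕ} (hz : z ≠ k + 1) :
    cnt b (sw k w) z = cnt b w z := by
  unfold cnt
  refine Finset.card_equiv (Equiv.swap (lo k) (hi k)) fun j => ?_
  have : (j : ℕ) < z ↔ ((Equiv.swap (lo k) (hi k) j : Fin n) : ℕ) < z := by
    by_cases h1 : j = lo k
    · subst h1; simp only [Equiv.swap_apply_left]; simp only [lo, hi]; omega
    by_cases h2 : j = hi k
    · subst h2; simp only [Equiv.swap_apply_right]; simp only [lo, hi]; omega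
    rw [Equiv.swap_apply_of_ne_of_ne h1 h2]
  rw [Finset.mem_filter, Finset.mem_filter, ← this]
  simp [sw]

theorem lv_sw (k : Fin (n - 1)) (w : Fin n → Bool) {z : ℕ} (hz : z ≠ k + 1) :
    lv (sw k w) z = lv w z := by
  unfold lv; rw [cnt_sw _ _ _ hz, cnt_sw _ _ _ hz]

theorem lv_lo_succ (k : Fin (n - 1)) (w : Fin n → Bool) :
    lv w (k + 1) = lv w k + if w (lo k) then -1 else 1 := lv_succ w (lo k)

theorem lv_hi_succ (k : Fin (n - 1)) (w : Fin n → Bool) :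
    lv w (k + 2) = lv w (k + 1) + if w (hi k) then -1 else 1 := lv_succ w (hi k)

theorem lv_sw_n (k : Fin (n - 1)) (w : Fin n → Bool) : lv (sw k w) n = lv w n :=
  lv_sw k w (by omega)

/-- The rank `|2 f + 1|` of a level `f`. -/
def rk (f : ℤ) : ℕ := (2 * f + 1).natAbs

/-- The number of boxes that separate `w` from the maximal sequence. -/
def boxes (w : Fin n → Bool) : ℕ := ∑ z ∈ Finset.range (n + 1), (rk (lv w z) + 1) / 4

/-- A box can be added to `w` at `k`: the level has a valley there. -/
def Addable (w : Fin n → Bool) (k : Fin (n - 1)) : Prop :=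
  w (lo k) = decide (0 ≤ lv w k) ∧ w (hi k) = !decide (0 ≤ lv w k)

theorem Addable.ne {w : Fin n → Bool} {k : Fin (n - 1)} (h : Addable w k) : w (lo k) ≠ w (hi k) := by
  rw [h.1, h.2]; simp

theorem addable_or {w : Fin n → Bool} {k : Fin (n - 1)} (h : w (lo k) ≠ w (hi k)) :
    Addable w k ∨ Addable (sw k w) k := by
  unfold Addable
  rw [lv_sw k w (by omega), sw_lo, sw_hi]
  cases h1 : w (lo k) <;> cases h2 : w (hi k) <;> simp_all <;> omega

/-- Only the level after `k + 1` steps changes, by two and outward. This raises `rk` there by `4`,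
except when it is pushed out from `0` or `-1` across the axis, where `rk` passes from `1` to `3`;
the rounding in `(rk + 1) / 4` makes the increase one in all cases. -/
theorem Addable.boxes_sw {w : Fin n → Bool} {k : Fin (n - 1)} (h : Addable w k) :
    boxes (sw k w) = boxes w + 1 := by
  have hk : (k : ℕ) + 1 ∈ Finset.range (n + 1) := by have := k.2; simp; omega
  unfold boxes
  rw [← Finset.add_sum_erase _ _ hk, ← Finset.add_sum_erase _ _ hk]
  have : ∑ z ∈ (Finset.range (n + 1)).erase (k + 1), (rk (lv (sw k w) z) + 1) / 4 =
      ∑ z ∈ (Finset.range (n + 1)).erase (k + 1), (rk (lv w z) + 1) / 4 :=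
    Finset.sum_congr rfl fun z hz => by rw [lv_sw k w (Finset.ne_of_mem_erase hz)]
  rw [this, lv_lo_succ, lv_lo_succ, lv_sw k w (by omega), sw_lo, h.1, h.2]
  unfold rk
  by_cases h0 : 0 ≤ lv w k
  · simp [h0]; omega
  · simp [h0]; omega

theorem boxes_sw_le {w : Fin n → Bool} (k : Fin (n - 1)) : boxes (sw k w) ≤ boxes w + 1 := by
  by_cases h : w (lo k) = w (hi k)
  · rw [sw_eq_self h]; omega
  · rcases addable_or h with h | h
    · exact h.boxes_sw.le
    · have := h.boxes_sw
      rw [sw_sw] at this; omega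

theorem Addable.rk_le {w : Fin n → Bool} {k : Fin (n - 1)} (h : Addable w k) (z : ℕ) :
    rk (lv w z) ≤ rk (lv (sw k w) z) := by
  by_cases hz : z = k + 1
  · subst hz
    rw [lv_lo_succ, lv_lo_succ, lv_sw k w (by omega), sw_lo, h.1, h.2]
    unfold rk
    by_cases h0 : 0 ≤ lv w k
    · simp [h0]; omega
    · simp [h0]; omega
  · rw [lv_sw k w hz]

/-- The sequence that alternates on the first `2 h` positions and is constant afterwards. -/
def zigzag (n h : ℕ) (b : Bool) : Fin n → Bool := fun j =>
  if (j : ℕ) < 2 * h then decide ((j : ℕ) % 2 = 0) else b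

theorem lv_zigzag (h : ℕ) (b : Bool) {k : ℕ} (hk : k ≤ n) :
    lv (zigzag n h b) k = if k ≤ 2 * h then -((k % 2 : ℕ) : ℤ) else
      (if b then -1 else 1) * ((k : ℤ) - 2 * h) := by
  induction k with
  | zero => simp [lv_zero]
  | succ k ih =>
    have := lv_succ (zigzag n h b) ⟨k, hk⟩
    simp only at this
    rw [this, ih (by omega)]
    simp only [zigzag]
    cases b <;> simp <;> split_ifs <;> simp_all <;> omega

theorem lv_zigzag_n (h : ℕ) (b : Bool) (hh : 2 * h ≤ n) :
    lv (zigzag n h b) n = (if b then -1 else 1) * ((n : ℤ) - 2 * h) := by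
  rw [lv_zigzag h b le_rfl]
  split_ifs with h1 <;> [skip; skip; rfl; rfl] <;> obtain rfl : n = 2 * h := by omega
  all_goals simp

/-- The maximal sequence with final level `v`. -/
def top (n : ℕ) (v : ℤ) : Fin n → Bool := zigzag n ((n - v.natAbs) / 2) (decide (v < 0))

theorem zigzag_eq_top (h : ℕ) (b : Bool) (hh : 2 * h ≤ n) :
    zigzag n h b = top n (lv (zigzag n h b) n) := by
  rw [lv_zigzag_n h b hh, top]
  ext j
  have := j.2
  cases b
  · have e : (n - ((if false = true then -1 else 1) * ((n : ℤ) - 2 * h)).natAbs) / 2 = h := by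
      simp; omega
    rw [e]
    by_cases h1 : (j : ℕ) < 2 * h
    · simp [zigzag, h1]
    · simp [zigzag, h1]; omega
  · have e : (n - ((if true = true then -1 else 1) * ((n : ℤ) - 2 * h)).natAbs) / 2 = h := by
      simp; omega
    rw [e]
    by_cases h1 : (j : ℕ) < 2 * h
    · simp [zigzag, h1]
    · simp [zigzag, h1]; omega

/-- Call a step outward if it goes up from a level `≥ 0` or down from a level `< 0`. Without a
removable box an outward step is followed by steps in the same direction only. The inward steps
before it can only lead from `0` to `-1` and back. -/
theorem exists_removable_or_eq_top (w : Fin n → Bool) :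
    (∃ k, Addable (sw k w) k) ∨ w = top n (lv w n) := by
  by_cases hr : ∃ k, Addable (sw k w) k
  · exact Or.inl hr
  right
  have hr' : ∀ k : Fin (n - 1), w (lo k) = (!decide (0 ≤ lv w k)) →
      w (hi k) = w (lo k) := by
    intro k h1
    by_contra h2
    refine hr ⟨k, ?_⟩
    unfold Addable
    rw [sw_lo, sw_hi, lv_sw k w (by omega)]
    refine ⟨?_, h1⟩
    cases h3 : w (lo k) <;> cases h4 : w (hi k) <;> simp_all
  -- Prefixes are compared with a zigzag whose `h` and `b` may be revised at each step: `h` counts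
  -- the completed alternations and `b` is the direction taken afterwards.
  have key : ∀ k, k ≤ n → ∃ h b, 2 * h ≤ k ∧ ∀ j : Fin n, (j : ℕ) < k → w j = zigzag n h b j := by
    intro k
    induction k with
    | zero => exact fun _ => ⟨0, false, by omega, fun j hj => by omega⟩
    | succ k ih =>
      intro hk
      obtain ⟨h, b, h1, h2⟩ := ih (by omega)
      have hext : ∀ h' b', 2 * h' ≤ k + 1 → (∀ j : Fin n, (j : ℕ) < k →
          zigzag n h b j = zigzag n h' b' j) → w ⟨k, hk⟩ = zigzag n h' b' ⟨k, hk⟩ →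
          ∃ h b, 2 * h ≤ k + 1 ∧ ∀ j : Fin n, (j : ℕ) < k + 1 → w j = zigzag n h b j := by
        intro h' b' h3 h4 h5
        refine ⟨h', b', h3, fun j hj => ?_⟩
        rcases Nat.lt_succ_iff_lt_or_eq.1 hj with hj | hj
        · rw [h2 j hj, h4 j hj]
        · rw [show j = ⟨k, hk⟩ from Fin.ext hj, h5]
      by_cases hb : w ⟨k, hk⟩ = b
      · exact hext h b (by omega) (fun _ _ => rfl) (by rw [hb, zigzag, if_neg (by simp; omega)])
      rcases Nat.eq_or_lt_of_le h1 with h3 | h3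
      · refine hext h (!b) (by omega) (fun j hj => ?_) ?_
        · rw [zigzag, zigzag, if_pos (by omega), if_pos (by omega)]
        · rw [zigzag, if_neg (by simp; omega)]
          cases b <;> simpa using hb
      obtain ⟨k, rfl⟩ : ∃ i, k = i + 1 := ⟨k - 1, by omega⟩
      have hlo := h2 (lo ⟨k, by omega⟩) (by simp [lo])
      have hlv : lv w k = lv (zigzag n h b) k := lv_congr fun j hj => h2 j (by omega)
      rw [lv_zigzag h b (by omega)] at hlv
      rw [zigzag, if_neg (by simp [lo]; omega)] at hlo
      have h5 := hr' ⟨k, by omega⟩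
      simp only [hlo, hlv] at h5
      change _ → w ⟨k + 1, _⟩ = b at h5
      -- Equality means that exactly one step followed the alternations. An upward one is outward
      -- and cannot be reversed; a downward one followed by an upward one completes a further
      -- alternation.
      rcases Nat.eq_or_lt_of_le (Nat.le_of_lt_succ h3) with h4 | h4
      · cases b
        · rw [if_pos (by omega)] at h5
          exact absurd (h5 (by rw [← h4]; simp)) hb
        · refine hext (h + 1) true (by omega) (fun j hj => ?_) ?_
          · simp only [zigzag]
            rw [if_pos (show (j : ℕ) < 2 * (h + 1) by omega)]
            split_ifs
            · rfl
            · simp; omega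
          · rw [zigzag, if_pos (by simp; omega)]
            have : w ⟨k + 1, hk⟩ = false := by simpa using hb
            rw [this]; simp; omega
      · rw [if_neg (by omega)] at h5
        refine absurd (h5 ?_) hb
        cases b <;> simp <;> omega
  obtain ⟨h, b, h1, h2⟩ := key n le_rfl
  have : w = zigzag n h b := funext fun j => h2 j j.2
  rw [this]
  exact zigzag_eq_top h b h1

/-- `BoxChain T w ks z`: the sequence `w` arises from `T` by adding boxes at the positions `ks`,
the last one first; `z` of these boxes are added at level `0`. -/
inductive BoxChain (T : Fin n → Bool) : (Fin n → Bool) → List (Fin (n - 1)) → ℕ → Prop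
  | base : BoxChain T T [] 0
  | step (w : Fin n → Bool) (ks : List (Fin (n - 1))) (z : ℕ) (k : Fin (n - 1)) :
      BoxChain T w ks z → Addable w k →
        BoxChain T (sw k w) (k :: ks) (z + if lv w k = 0 then 1 else 0)

theorem exists_boxChain (w : Fin n → Bool) : ∃ ks z, BoxChain (top n (lv w n)) w ks z := by
  induction hb : boxes w using Nat.strong_induction_on generalizing w with
  | _ N ih =>
    rcases exists_removable_or_eq_top w with ⟨k, hk⟩ | h
    · have h1 := hk.boxes_sw
      rw [sw_sw] at h1
      obtain ⟨ks, z, h2⟩ := ih _ (by omega) (sw k w) rfl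
      rw [lv_sw_n] at h2
      have := BoxChain.step _ _ _ _ h2 hk
      rw [sw_sw] at this
      exact ⟨_, _, this⟩
    · rw [← h]; exact ⟨[], 0, .base⟩

theorem BoxChain.rk_le {T w : Fin n → Bool} {ks : List (Fin (n - 1))} {z : ℕ}
    (h : BoxChain T w ks z) (k : ℕ) : rk (lv T k) ≤ rk (lv w k) := by
  induction h with
  | base => exact le_rfl
  | step w ks z k' _ ha ih => exact ih.trans (ha.rk_le k)

theorem BoxChain.lv_n {T w : Fin n → Bool} {ks : List (Fin (n - 1))} {z : ℕ}
    (h : BoxChain T w ks z) : lv w n = lv T n := by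
  induction h with
  | base => rfl
  | step w ks z k' _ ha ih => rw [lv_sw_n, ih]

/-- Each added box can only increase the rank of a level, so the start of the chain has the smallest
ranks everywhere. This is the dominance of the maximal bitableau. -/
theorem rk_top_le (w : Fin n → Bool) (k : ℕ) : rk (lv (top n (lv w n)) k) ≤ rk (lv w k) := by
  obtain ⟨ks, z, h⟩ := exists_boxChain w
  exact h.rk_le k

theorem lv_top (w : Fin n → Bool) : lv (top n (lv w n)) n = lv w n := by
  obtain ⟨ks, z, h⟩ := exists_boxChain w
  exact h.lv_n.symm

theorem lv_mod_two (w : Fin n → Bool) {k : ℕ} (hk : k ≤ n) : lv w k % 2 = (k : ℤ) % 2 := by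
  have := cnt_add_cnt w hk
  unfold lv; omega

/-- The function `|2 f + 1|` identifies only `f` and `-1 - f`, which have different parities, while
the parity of the level is that of `k`. -/
theorem rk_inj {w w' : Fin n → Bool} {k : ℕ} (hk : k ≤ n) (h : rk (lv w k) = rk (lv w' k)) :
    lv w k = lv w' k := by
  have h1 := lv_mod_two w hk
  have h2 := lv_mod_two w' hk
  unfold rk at h; omega

theorem eq_of_lv {w w' : Fin n → Bool} (h : ∀ k, k ≤ n → lv w k = lv w' k) : w = w' := by
  ext j
  have h1 := lv_succ w j
  have h2 := lv_succ w' j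
  rw [h _ (by omega), h _ (by omega), h2] at h1
  cases h3 : w j <;> cases h4 : w' j <;> simp_all

theorem lv_half (w : Fin n → Bool) : 2 * ((n - (lv w n).natAbs) / 2) + (lv w n).natAbs = n := by
  have := cnt_add_cnt w le_rfl
  unfold lv; omega

end SignSeq

section

/-! ### Diagrams with a given height function -/

namespace DecMatching
variable {n : ℕ}

theorem pos_lt (x : Node n) : pos x < 2 * n := by
  have := x.2.2
  unfold pos; split_ifs <;> omega

theorem pos_inj {x y : Node n} (h : pos x = pos y) : x = y := by
  obtain ⟨a, i⟩ := x
  obtain ⟨b, j⟩ := y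
  have := i.2
  have := j.2
  cases a <;> cases b <;> simp [pos, Fin.ext_iff] at * <;> omega

theorem pos_true (k : Fin n) : pos ((true, k) : Node n) = k := rfl

theorem pos_false (k : Fin n) : pos ((false, k) : Node n) = 2 * n - 1 - k := rfl

/-- The lines of `D` join the steps of the height function `H` which leave some level and return
to it, on the side away from `0`; a line is decorated if it starts at level `0` and goes below. -/
def Good (H : ℕ → ℤ) (D : DecMatching (Node n)) : Prop :=
  ∀ x, pos x < pos (D.partner x) → H (pos x) = H (pos (D.partner x) + 1) ∧
    ((0 ≤ H (pos x) ∧ (∀ z, pos x < z → z ≤ pos (D.partner x) → H (pos x) < H z) ∧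
      D.dec x = false) ∨
    (H (pos x) ≤ 0 ∧ (∀ z, pos x < z → z ≤ pos (D.partner x) → H z < H (pos x)) ∧
      (D.dec x = true ↔ H (pos x) = 0)))

section Good
variable {H : ℕ → ℤ} {D : DecMatching (Node n)}

theorem Good.congr {H' : ℕ → ℤ} (h : Good H D) (hH : ∀ z, z ≤ 2 * n → H z = H' z) : Good H' D := by
  intro x hx
  have h1 := pos_lt (D.partner x)
  have h2 := h x hx
  rw [← hH _ (by omega), ← hH _ (by omega)]
  refine ⟨h2.1, h2.2.imp ?_ ?_⟩
  · rintro ⟨a, b, c⟩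
    exact ⟨a, fun z hz hz' => by rw [← hH z (by omega)]; exact b z hz hz', c⟩
  · rintro ⟨a, b, c⟩
    exact ⟨a, fun z hz hz' => by rw [← hH z (by omega)]; exact b z hz hz', c⟩

/-- Between the ends of a line the height stays strictly on one side of its starting level, away
from `0`. Together with `Good.dec_zero` it shows that decorated lines are exposed to the left side
of the diagram. -/
theorem Good.ne_zero (h : Good H D) {x : Node n} {z : ℕ} (h1 : pos x < z)
    (h2 : z ≤ pos (D.partner x)) : H z ≠ 0 := by
  rcases (h x (h1.trans_le h2)).2 with ⟨a, b, -⟩ | ⟨a, b, -⟩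
  · have := b z h1 h2; omega
  · have := b z h1 h2; omega

theorem pos_ne_partner (x : Node n) : pos x ≠ pos (D.partner x) :=
  fun h => D.partner_ne x (pos_inj h).symm

theorem Good.dec_zero (h : Good H D) {x : Node n} (hx : D.dec x = true) :
    H (pos x) = 0 ∨ H (pos x + 1) = 0 := by
  rcases lt_or_gt_of_ne (pos_ne_partner (D := D) x) with h1 | h1
  · rcases (h x h1).2 with ⟨-, -, c⟩ | ⟨-, -, c⟩
    · rw [hx] at c; cases c
    · exact Or.inl (c.1 hx)
  · have h2 := h (D.partner x)
    rw [D.partner_partner, D.dec_partner] at h2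
    obtain ⟨h3, h4⟩ := h2 h1
    rcases h4 with ⟨-, -, c⟩ | ⟨-, -, c⟩
    · rw [hx] at c; cases c
    · exact Or.inr (h3 ▸ c.1 hx)

/-- Two crossing lines would force contradictory inequalities between their starting levels. A
decorated line has an end where the height is `0`, and by `Good.ne_zero` no other line can enclose
that end; this excludes both a vertical line on its left and a horizontal line around it. -/
theorem Good.isBlobDiagram (h : Good H D) : D.IsBlobDiagram where
  planar x y := by
    rintro ⟨h1, h2, h3⟩
    have hx := h x (h1.trans h2)
    have hy := h y (h2.trans h3)
    rcases hx with ⟨e, ⟨a, b, -⟩ | ⟨a, b, -⟩⟩ <;> rcases hy with ⟨e', ⟨a', b', -⟩ | ⟨a', b', -⟩⟩ <;>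
    · have := b _ h1 h2.le
      have := b' (pos (D.partner x) + 1) (by omega) (by omega)
      omega
  not_right_of_vertical b k hk j hj hv := by
    have h0 := h.dec_zero hk
    have hj' := j.2
    have hk' := k.2
    have hjk : (j : ℕ) < k := hj
    generalize hp : D.partner (b, j) = p at hv
    obtain ⟨c, i⟩ := p
    have hi := i.2
    have hc : c = !b := by cases b <;> cases c <;> simp_all [IsVertical]
    subst hc
    cases b
    · have hp' : D.partner (true, i) = (false, j) := by
        rw [← D.partner_partner (false, j), hp]; rfl
      rw [pos_false] at h0
      rcases h0 with h0 | h0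
      · exact h.ne_zero (x := (true, i)) (by rw [pos_true]; omega)
          (by rw [hp', pos_false]; omega) h0
      · exact h.ne_zero (x := (true, i)) (by rw [pos_true]; omega)
          (by rw [hp', pos_false]; omega) h0
    · rw [pos_true] at h0
      have e : pos (D.partner (true, j)) = 2 * n - 1 - i := by rw [hp]; rfl
      rcases h0 with h0 | h0
      · exact h.ne_zero (x := (true, j)) (by rw [pos_true]; omega) (by omega) h0
      · exact h.ne_zero (x := (true, j)) (by rw [pos_true]; omega) (by omega) h0
  outermost b k hk i j hi hj hp := by
    have h0 := h.dec_zero hk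
    have hj' := j.2
    have hik : (i : ℕ) < k := hi
    have hkj : (k : ℕ) < j := hj
    cases b
    · have hp' : D.partner (false, j) = (false, i) := by
        rw [← D.partner_partner (false, i), hp]
      rw [pos_false] at h0
      rcases h0 with h0 | h0
      · exact h.ne_zero (x := (false, j)) (by rw [pos_false]; omega)
          (by rw [hp', pos_false]; omega) h0
      · exact h.ne_zero (x := (false, j)) (by rw [pos_false]; omega)
          (by rw [hp', pos_false]; omega) h0
    · rw [pos_true] at h0
      rcases h0 with h0 | h0
      · exact h.ne_zero (x := (true, i)) (by rw [pos_true]; omega)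
          (by rw [hp, pos_true]; omega) h0
      · exact h.ne_zero (x := (true, i)) (by rw [pos_true]; omega)
          (by rw [hp, pos_true]; omega) h0

/-- Every node below level `0` is covered by a decorated line that starts at level `0`. -/
theorem Good.exists_dec (h : Good H D) (h0 : H 0 = 0)
    (hs : ∀ i, i < 2 * n → H (i + 1) = H i + 1 ∨ H (i + 1) = H i - 1) (k : Fin n)
    (hk : H k < 0 ∨ H (k + 1) < 0) :
    ∃ i : Fin n, (i : ℕ) ≤ k ∧ D.dec (true, i) = true ∧ (i : ℕ) < pos (D.partner (true, i)) ∧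
      k ≤ pos (D.partner (true, i)) ∧ H (pos (D.partner (true, i)) + 1) = 0 := by
  classical
  have hk' := k.2
  -- The last zero of `H` up to `k`. The excursion below `0` that contains the step at `k` starts
  -- here, and the line of this node is the decorated line that bounds it.
  obtain ⟨i, hik, hi0, hmax⟩ : ∃ i, i ≤ (k : ℕ) ∧ H i = 0 ∧ ∀ z, i < z → z ≤ k → H z ≠ 0 := by
    refine ⟨Nat.findGreatest (fun z => H z = 0) k, Nat.findGreatest_le _,
      Nat.findGreatest_spec (P := fun z => H z = 0) (Nat.zero_le _) h0, fun z hz hz' h' => ?_⟩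
    exact absurd (Nat.le_findGreatest (P := fun z => H z = 0) hz' h') (by omega)
  have hdown : H (i + 1) = -1 := by
    rcases hs i (by omega) with h1 | h1
    · exfalso
      have hpos : ∀ z, i < z → z ≤ k → 0 < H z := by
        intro z hz
        induction z, hz using Nat.le_induction with
        | base => intro; rw [Nat.succ_eq_add_one, h1]; omega
        | succ z hz ih =>
          intro hz'
          have := ih (by omega)
          have := hmax (z + 1) (by omega) hz'
          rcases hs z (by omega) with h2 | h2 <;> omega
      rcases Nat.eq_or_lt_of_le hik with h2 | h2
      · rw [← h2, h1] at hk; omega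
      · have := hpos k h2 le_rfl
        rcases hs k (by omega) with h2 | h2 <;> omega
    · omega
  have hpi : pos ((true, ⟨i, by omega⟩) : Node n) = i := rfl
  have hleft : i < pos (D.partner (true, ⟨i, by omega⟩)) := by
    by_contra hc
    have hne := pos_ne_partner (D := D) (true, ⟨i, by omega⟩)
    have h2 := h (D.partner (true, ⟨i, by omega⟩))
    rw [D.partner_partner, hpi] at h2
    rw [hpi] at hne
    obtain ⟨h3, ⟨a, b, -⟩ | ⟨a, b, -⟩⟩ := h2 (by omega)
    · omega
    · have := b i (by omega) le_rfl
      omega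
  have hg := h (true, ⟨i, by omega⟩) (by rwa [hpi])
  rw [hpi] at hg
  obtain ⟨h3, h4⟩ := hg
  refine ⟨⟨i, by omega⟩, hik, ?_, hleft, ?_, by rw [← h3, hi0]⟩
  · rcases h4 with ⟨a, b, -⟩ | ⟨a, b, c⟩
    · have := b (i + 1) (by omega) (by omega)
      omega
    · exact c.2 hi0
  · by_contra hc
    exact hmax (pos (D.partner (true, ⟨i, by omega⟩)) + 1) (by omega) (by omega)
      (by rw [← h3, hi0])

/-- Decorated lines bound the excursions of the height below `0`, so covered nodes are those whose
step belongs to such an excursion. If the excursion is not finished at the right end of the edge,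
its line is the decorated vertical one. -/
theorem Good.isCovered_iff (h : Good H D) (h0 : H 0 = 0)
    (hs : ∀ i, i < 2 * n → H (i + 1) = H i + 1 ∨ H (i + 1) = H i - 1) (k : Fin n) :
    D.IsCovered true k ↔ H k < 0 ∨ H (k + 1) < 0 := by
  have hk' := k.2
  constructor
  · rintro (hd | ⟨i, j, hi, hj, hp, hd⟩ | ⟨i, hi, hv, hd⟩)
    · rcases lt_or_gt_of_ne (pos_ne_partner (D := D) (true, k)) with h1 | h1
      · rcases (h _ h1).2 with ⟨-, -, c⟩ | ⟨a, b, -⟩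
        · rw [hd] at c; cases c
        · have := b (k + 1) (by rw [pos_true]; omega) (by rw [pos_true] at h1; omega)
          rw [pos_true] at *; omega
      · have h2 := h (D.partner (true, k))
        rw [D.partner_partner, D.dec_partner] at h2
        obtain ⟨h3, ⟨-, -, c⟩ | ⟨a, b, -⟩⟩ := h2 h1
        · rw [hd] at c; cases c
        · have := b k h1 le_rfl
          rw [pos_true] at *; omega
    · have hik : (i : ℕ) < k := hi
      have hkj : (k : ℕ) < j := hj
      have e : pos (D.partner (true, i)) = j := by rw [hp]; rfl
      rcases (h (true, i) (by rw [e, pos_true]; omega)).2 with ⟨-, -, c⟩ | ⟨a, b, -⟩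
      · rw [hd] at c; cases c
      · have := b k (by rw [pos_true]; omega) (by omega)
        rw [pos_true] at *; omega
    · have hik : (i : ℕ) < k := hi
      have e : n ≤ pos (D.partner (true, i)) := by
        unfold IsVertical at hv
        have := (D.partner (true, i)).2.2
        unfold pos
        rw [if_neg hv]; omega
      rcases (h (true, i) (by rw [pos_true]; omega)).2 with ⟨-, -, c⟩ | ⟨a, b, -⟩
      · rw [hd] at c; cases c
      · have := b k (by rw [pos_true]; omega) (by omega)
        rw [pos_true] at *; omega
  · intro hk
    obtain ⟨i, hik, hd, h1, h2, h3⟩ := h.exists_dec h0 hs k hk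
    rcases Nat.eq_or_lt_of_le hik with h4 | h4
    · exact Or.inl (Fin.ext h4 ▸ hd)
    generalize hp : D.partner (true, i) = p at *
    obtain ⟨c, j⟩ := p
    cases c
    · exact Or.inr (Or.inr ⟨i, h4, by simp [IsVertical, hp], hd⟩)
    · rw [pos_true] at h2
      rcases Nat.eq_or_lt_of_le h2 with h5 | h5
      · obtain rfl : k = j := Fin.ext h5
        left
        rw [← hp, D.dec_partner]; exact hd
      · exact Or.inr (Or.inl ⟨i, j, h4, h5, hp, hd⟩)

theorem le_pos_of_isVertical {k : Fin n} (hv : D.IsVertical true k) :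
    n ≤ pos (D.partner (true, k)) := by
  unfold IsVertical at hv
  have := (D.partner (true, k)).2.2
  unfold pos
  rw [if_neg hv]; omega

theorem Good.verticalDecorated_iff [NeZero n] (h : Good H D) (h0 : H 0 = 0)
    (hs : ∀ i, i < 2 * n → H (i + 1) = H i + 1 ∨ H (i + 1) = H i - 1) :
    D.VerticalDecorated ↔ H n < 0 := by
  have hn := NeZero.pos n
  constructor
  · rintro ⟨k, hv, hd⟩
    have hk := k.2
    have e := le_pos_of_isVertical hv
    rcases (h (true, k) (by rw [pos_true]; omega)).2 with ⟨-, -, c⟩ | ⟨a, b, -⟩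
    · rw [hd] at c; cases c
    · have := b n (by rw [pos_true]; omega) (by omega)
      omega
  · intro hneg
    have hn1 : n - 1 + 1 = n := by omega
    obtain ⟨i, hik, hd, h1, h2, h3⟩ := h.exists_dec h0 hs ⟨n - 1, by omega⟩
      (Or.inr (by simpa [hn1] using hneg))
    refine ⟨i, fun hc => ?_, hd⟩
    have h4 := (D.partner (true, i)).2.2
    have h5 : pos (D.partner (true, i)) = (D.partner (true, i)).2 := by
      unfold pos; rw [if_pos hc]
    simp only at h2
    have h6 : pos (D.partner (true, i)) = n - 1 := by omega
    rw [h6, hn1] at h3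
    omega

/-- The rule that attaches a bitableau to an edge records the downward steps. Above `0` the nodes
are uncovered and right endpoints step down; below `0` they are covered and left endpoints step
down; vertical lines step down precisely when the height at `n` is negative, that is, when a
vertical line is decorated. -/
theorem Good.inSecond_iff [NeZero n] (h : Good H D) (h0 : H 0 = 0)
    (hs : ∀ i, i < 2 * n → H (i + 1) = H i + 1 ∨ H (i + 1) = H i - 1) (k : Fin n) :
    D.InSecond true k ↔ H (k + 1) = H k - 1 := by
  have hk := k.2
  unfold InSecond
  rw [h.isCovered_iff h0 hs, h.verticalDecorated_iff h0 hs]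
  generalize hp : D.partner (true, k) = p
  obtain ⟨c, j⟩ := p
  have hj := j.2
  have hne := pos_ne_partner (D := D) (true, k)
  have hgl := h (true, k)
  have hgr := h (D.partner (true, k))
  rw [D.partner_partner] at hgr
  rw [hp] at hne hgl hgr
  rw [pos_true] at hne hgl hgr
  have hst := hs k (by omega)
  cases c
  · have hl : ¬ D.IsLeft true k := by rintro ⟨i, _, hi⟩; rw [hp] at hi; simp at hi
    have hr : ¬ D.IsRight true k := by rintro ⟨i, _, hi⟩; rw [hp] at hi; simp at hi
    rw [pos_false] at *
    simp only [hl, hr, and_false, or_false, not_false_eq_true, and_true, false_or]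
    obtain ⟨-, ⟨a, b, -⟩ | ⟨a, b, -⟩⟩ := hgl (by omega)
    · have := b n (by omega) (by omega)
      have := b (k + 1) (by omega) (by omega)
      omega
    · have := b n (by omega) (by omega)
      have := b (k + 1) (by omega) (by omega)
      omega
  · rw [pos_true] at *
    have hl : D.IsLeft true k ↔ k < j := by
      unfold IsLeft; rw [hp]; simp
    have hr : D.IsRight true k ↔ j < k := by
      unfold IsRight; rw [hp]; simp
    rw [hl, hr, Fin.lt_def, Fin.lt_def]
    rcases lt_or_gt_of_ne hne with h1 | h1
    · obtain ⟨-, ⟨a, b, -⟩ | ⟨a, b, -⟩⟩ := hgl h1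
      · have := b (k + 1) (by omega) (by omega)
        omega
      · have := b (k + 1) (by omega) (by omega)
        omega
    · obtain ⟨e, ⟨a, b, -⟩ | ⟨a, b, -⟩⟩ := hgr h1
      · have := b k (by omega) (by omega)
        omega
      · have := b k (by omega) (by omega)
        omega

end Good

/-! ### Reflection of diagrams -/

/-- Reflection of nodes. -/
def flipNode (x : Node n) : Node n := (!x.1, x.2)

@[simp] theorem flipNode_flipNode (x : Node n) : flipNode (flipNode x) = x := by
  simp [flipNode]

theorem flipNode_inj {x y : Node n} : flipNode x = flipNode y ↔ x = y :=
  ⟨fun h => by rw [← flipNode_flipNode x, h, flipNode_flipNode], fun h => by rw [h]⟩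

theorem pos_flipNode (x : Node n) : pos (flipNode x) = 2 * n - 1 - pos x := by
  obtain ⟨a, i⟩ := x
  have := i.2
  cases a <;> simp [flipNode, pos]
  omega

/-- Reflection of a diagram in a horizontal line. -/
def flip (D : DecMatching (Node n)) : DecMatching (Node n) where
  partner x := flipNode (D.partner (flipNode x))
  partner_partner x := by simp [D.partner_partner]
  partner_ne x h := D.partner_ne (flipNode x) (by rw [← flipNode_inj, h, flipNode_flipNode])
  dec x := D.dec (flipNode x)
  dec_partner x := by simp [D.dec_partner]

@[simp] theorem flip_flip (D : DecMatching (Node n)) : D.flip.flip = D := by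
  ext x <;> simp [flip]

theorem Good.flip {H : ℕ → ℤ} {D : DecMatching (Node n)} (h : Good H D) :
    Good (fun z => H (2 * n - z)) D.flip := by
  intro x hx
  have e : D.flip.partner x = flipNode (D.partner (flipNode x)) := rfl
  have ed : D.flip.dec x = D.dec (D.partner (flipNode x)) := by rw [D.dec_partner]; rfl
  have h1 := pos_lt x
  have h2 := pos_lt (D.partner (flipNode x))
  have h4 := pos_flipNode x
  have h3 := h (D.partner (flipNode x))
  rw [D.partner_partner] at h3
  rw [e, pos_flipNode] at hx
  obtain ⟨h5, h6⟩ := h3 (by omega)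
  simp only [e, ed, pos_flipNode]
  have e1 : 2 * n - pos x = pos (flipNode x) + 1 := by omega
  have e2 : 2 * n - (2 * n - 1 - pos (D.partner (flipNode x)) + 1) =
    pos (D.partner (flipNode x)) := by omega
  rw [e1, e2, ← h5]
  refine ⟨rfl, h6.imp ?_ ?_⟩
  · rintro ⟨a, b, c⟩
    exact ⟨a, fun z hz hz' => b _ (by omega) (by omega), c⟩
  · rintro ⟨a, b, c⟩
    exact ⟨a, fun z hz hz' => b _ (by omega) (by omega), c⟩

theorem isCovered_flip (D : DecMatching (Node n)) (k : Fin n) :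
    D.flip.IsCovered true k ↔ D.IsCovered false k := by
  simp [IsCovered, IsVertical, flip, flipNode, Prod.ext_iff]

theorem inSecond_flip (D : DecMatching (Node n)) (k : Fin n) :
    D.flip.InSecond true k ↔ D.InSecond false k := by
  have hv : D.flip.VerticalDecorated ↔ D.VerticalDecorated := by
    have key : ∀ D : DecMatching (Node n), D.VerticalDecorated → D.flip.VerticalDecorated := by
      rintro D ⟨k, hk, hd⟩
      generalize hp : D.partner (true, k) = p at *
      obtain ⟨c, j⟩ := p
      obtain rfl : c = false := by simpa [IsVertical, hp] using hk
      have hp' : D.partner (false, j) = (true, k) := by rw [← hp, D.partner_partner]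
      refine ⟨j, ?_, ?_⟩
      · simp [IsVertical, flip, flipNode, hp']
      · simp only [flip, flipNode, Bool.not_true]
        rw [← hp, D.dec_partner]; exact hd
    exact ⟨fun h => by simpa using key _ h, key D⟩
  have hl : D.flip.IsLeft true k ↔ D.IsLeft false k := by
    simp [IsLeft, flip, flipNode, Prod.ext_iff]
  have hr : D.flip.IsRight true k ↔ D.IsRight false k := by
    simp [IsRight, flip, flipNode, Prod.ext_iff]
  unfold InSecond
  rw [hv, hl, hr, isCovered_flip]

end DecMatching

/-! ### The height function of a pair of sign sequences with a common end. -/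

namespace SignSeq
open DecMatching
variable {n : ℕ}

/-- The height function that follows `s` from left to right and then `t` from right to left. -/
def hgt (s t : Fin n → Bool) (z : ℕ) : ℤ := if z ≤ n then lv s z else lv t (2 * n - z)

theorem hgt_rev {s t : Fin n → Bool} (h : lv s n = lv t n) {z : ℕ} (hz : z ≤ 2 * n) :
    hgt s t (2 * n - z) = hgt t s z := by
  unfold hgt
  rcases lt_trichotomy z n with h1 | h1 | h1
  · rw [if_neg (by omega), if_pos (by omega), show 2 * n - (2 * n - z) = z by omega]
  · subst h1; rw [if_pos (by omega), if_pos le_rfl, show 2 * z - z = z by omega, h]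
  · rw [if_pos (by omega), if_neg (by omega)]

theorem hgt_step {s t : Fin n → Bool} (h : lv s n = lv t n) (i : ℕ) (hi : i < 2 * n) :
    hgt s t (i + 1) = hgt s t i + 1 ∨ hgt s t (i + 1) = hgt s t i - 1 := by
  rcases lt_or_ge i n with h1 | h1
  · have := lv_succ s ⟨i, h1⟩
    simp only at this
    unfold hgt
    rw [if_pos h1.le, if_pos (by omega), this]
    split_ifs <;> simp
    omega
  · have := lv_succ t ⟨2 * n - i - 1, by omega⟩
    simp only at this
    rw [show 2 * n - i - 1 + 1 = 2 * n - i by omega] at this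
    have e : hgt s t i = lv t (2 * n - i) := by
      unfold hgt
      split_ifs with h2
      · obtain rfl : i = n := by omega
        rw [show 2 * i - i = i by omega, h]
      · rfl
    rw [e, this, hgt, if_neg (by omega), show 2 * n - (i + 1) = 2 * n - i - 1 by omega]
    split_ifs <;> simp

theorem inSecond_of_good [NeZero n] {s t : Fin n → Bool} (h : lv s n = lv t n)
    {D : DecMatching (Node n)} (hD : Good (hgt s t) D) (k : Fin n) :
    (D.InSecond true k ↔ s k = true) := by
  have hk := k.2
  have h0 : hgt s t 0 = 0 := by simp [hgt, lv_zero]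
  rw [hD.inSecond_iff h0 (hgt_step h)]
  have := lv_succ s k
  unfold hgt
  rw [if_pos (by omega), if_pos (by omega), this]
  cases s k
  · simp; omega
  · simp; omega

theorem good_flip {s t : Fin n → Bool} (h : lv s n = lv t n) {D : DecMatching (Node n)}
    (hD : Good (hgt s t) D) : Good (hgt t s) D.flip :=
  hD.flip.congr fun _ hz => hgt_rev h hz

theorem inSecond_of_good' [NeZero n] {s t : Fin n → Bool} (h : lv s n = lv t n)
    {D : DecMatching (Node n)} (hD : Good (hgt s t) D) (k : Fin n) :
    (D.InSecond false k ↔ t k = true) := by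
  rw [← inSecond_flip]
  exact inSecond_of_good h.symm (good_flip h hD) k

end SignSeq

/-! ### Adding a box is concatenation with a generator. -/

namespace DecMatching
variable {n : ℕ}

-- The diagrammatic meaning of adding a box at `k`: the inward turn of the height becomes an outward
-- turn, and `U_k` transforms the diagram accordingly. A loop is closed only for a box at level `0`,
-- and it is then decorated, so the scalars that occur are `1` and `y_e`.
set_option maxHeartbeats 1000000 in
theorem Good.cap {H H' : ℕ → ℤ} {D : DecMatching (Node n)} (h : Good H D) (k : Fin (n - 1))
    (hH : ∀ z : ℕ, z ≠ k + 1 → H' z = H z) (h2 : H (k + 2) = H k)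
    (h1 : 0 ≤ H k ∧ H (k + 1) = H k - 1 ∧ H' (k + 1) = H k + 1 ∨
      H k < 0 ∧ H (k + 1) = H k + 1 ∧ H' (k + 1) = H k - 1) :
    Good H' (D.cap (topL k) (topR k) (topL_ne_topR k)) ∧
      (D.partner (topL k) = topR k ↔ H k = 0) ∧ (H k = 0 → D.dec (topL k) = true) := by
  have hk := k.2
  have hpa : pos (topL k) = k := rfl
  have hpb : pos (topR k) = k + 1 := rfl
  have hpn : ∀ x y : Node n, x ≠ y → pos x ≠ pos y := fun x y hxy hp => hxy (pos_inj hp)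
  have hab := topL_ne_topR k
  suffices ∀ (a b : Node n) (hab : a ≠ b), pos a = k → pos b = k + 1 →
      Good H' (D.cap a b hab) ∧ (D.partner a = b ↔ H k = 0) ∧ (H k = 0 → D.dec a = true) from
    this _ _ hab hpa hpb
  clear hpa hpb hab
  intro a b hab hpa hpb
  have hA := h a
  have hB := h b
  have hA' := h (D.partner a)
  have hB' := h (D.partner b)
  have hneA := pos_ne_partner (D := D) a
  have hneB := pos_ne_partner (D := D) b
  rw [D.partner_partner] at hA' hB'
  rw [hpa] at hA hA' hneA
  rw [hpb] at hB hB' hneB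
  have hdA := D.dec_partner a
  have hdB := D.dec_partner b
  have hpp := D.partner_partner
  rw [show (k : ℕ) + 1 + 1 = k + 2 by rfl] at hB'
  -- At level `0` the two steps go to `-1` and back, so they form one decorated line. Capping leaves
  -- the pairing unchanged and only removes the blob from this line.
  by_cases hj : H k = 0
  · have hlt : (k : ℕ) < pos (D.partner a) := by
      by_contra hc
      obtain ⟨e, ⟨x, y, -⟩ | ⟨x, y, -⟩⟩ := hA' (by omega)
      · omega
      · have := y k (by omega) le_rfl; omega
    obtain ⟨e, ⟨x, y, -⟩ | ⟨x, y, hd⟩⟩ := hA hlt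
    · have := y (k + 1) (by omega) (by omega); omega
    have hp : D.partner a = b := by
      refine pos_inj ?_
      rw [hpb]
      by_contra hc
      have := y (k + 2) (by omega) (by omega); omega
    refine ⟨?_, by simp [hp, hj], fun _ => hd.2 hj⟩
    have hp' : D.partner b = a := by rw [← hp, hpp]
    intro x hx
    have hcp : (D.cap a b hab).partner x = D.partner x := by
      simp only [DecMatching.cap]; split_ifs <;> simp_all
    rw [hcp] at hx ⊢
    by_cases hxa : x = a
    · subst hxa
      rw [hp, hpa, hpb, hH k (by omega), hH (k + 1 + 1) (by omega)]
      refine ⟨h2.symm, Or.inl ⟨hj.ge, fun z hz hz' => ?_, by simp [DecMatching.cap]⟩⟩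
      obtain rfl : z = k + 1 := by omega
      omega
    by_cases hxb : x = b
    · subst hxb; rw [hp', hpa, hpb] at hx; omega
    have hx'a : D.partner x ≠ a := fun h' => hxb (by rw [← hpp x, h', hp])
    have hx'b : D.partner x ≠ b := fun h' => hxa (by rw [← hpp x, h', hp'])
    have n1 := hpn _ _ hxa
    have n2 := hpn _ _ hxb
    have n3 := hpn _ _ hx'a
    have n4 := hpn _ _ hx'b
    have hcd : (D.cap a b hab).dec x = D.dec x := by
      simp only [DecMatching.cap]; simp [hxa, hxb, hp, hp']
    rw [hcd, hH (pos x) (by omega), hH (pos (D.partner x) + 1) (by omega)]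
    obtain ⟨e', h'⟩ := h x hx
    refine ⟨e', h'.imp ?_ ?_⟩
    · rintro ⟨u, v, w⟩
      refine ⟨u, fun z hz hz' => ?_, w⟩
      by_cases hzk : z = k + 1
      · have := v k (by omega) (by omega); omega
      · rw [hH z hzk]; exact v z hz hz'
    · rintro ⟨u, v, w⟩
      refine ⟨u, fun z hz hz' => ?_, w⟩
      by_cases hzk : z = k + 1
      · have := v k (by omega) (by omega); omega
      · rw [hH z hzk]; exact v z hz hz'
  -- At other levels the first node ends a line from the left and the second one starts a line to
  -- the right. Capping joins the outer ends of these two lines, and the new line from `a` to `b` is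
  -- nested inside the joined one.
  · have hltA : pos (D.partner a) < k := by
      by_contra hc
      obtain ⟨e, ⟨x, y, -⟩ | ⟨x, y, -⟩⟩ := hA (by omega)
      · have := y (k + 1) (by omega) (by omega); omega
      · have := y (k + 1) (by omega) (by omega); omega
    have hltB : (k : ℕ) + 1 < pos (D.partner b) := by
      by_contra hc
      have hne : pos (D.partner b) ≠ k := by
        intro h'
        have : D.partner b = a := pos_inj (by rw [hpa, h'])
        rw [← this, hpp, hpb] at hltA; omega
      obtain ⟨e, ⟨x, y, -⟩ | ⟨x, y, -⟩⟩ := hB' (by omega)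
      · have := y (k + 1) (by omega) (by omega); omega
      · have := y (k + 1) (by omega) (by omega); omega
    refine ⟨?_, by simp only [hj, iff_false]; rintro h'; rw [h', hpb] at hltA; omega,
      fun h' => absurd h' hj⟩
    obtain ⟨eA, gA⟩ := hA' hltA
    obtain ⟨eB, gB⟩ := hB hltB
    have hca : D.partner a ≠ a := D.partner_ne a
    have hcb : D.partner a ≠ b := by intro h'; rw [h', hpb] at hltA; omega
    have hda : D.partner b ≠ a := by intro h'; rw [h', hpa] at hltB; omega
    have hdb : D.partner b ≠ b := D.partner_ne b
    have hcd : D.partner a ≠ D.partner b := fun h' => hab (by rw [← hpp a, h', hpp])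
    intro x hx
    by_cases hxa : x = a
    · subst hxa
      have hcp : (D.cap x b hab).partner x = b := by simp [DecMatching.cap]
      have hcd : (D.cap x b hab).dec x = false := by simp [DecMatching.cap]
      rw [hcp, hcd, hpa, hpb, hH k (by omega), hH (k + 1 + 1) (by omega)]
      refine ⟨h2.symm, ?_⟩
      rcases h1 with ⟨u, v, w⟩ | ⟨u, v, w⟩
      · refine Or.inl ⟨u, fun z hz hz' => ?_, rfl⟩
        obtain rfl : z = k + 1 := by omega
        omega
      · refine Or.inr ⟨u.le, fun z hz hz' => ?_, by simp [hj]⟩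
        obtain rfl : z = k + 1 := by omega
        omega
    by_cases hxb : x = b
    · subst hxb
      have hcp : (D.cap a x hab).partner x = a := by simp [DecMatching.cap, hxa]
      rw [hcp] at hx; omega
    by_cases hxc : x = D.partner a
    · have hcp : (D.cap a b hab).partner x = D.partner b := by
        simp [DecMatching.cap, hxc, hca, hcb]
      have hcd : (D.cap a b hab).dec x = (D.dec a || D.dec b) := by
        simp [DecMatching.cap, hxc, hca, hcb]
      rw [hcp, hcd, hxc, hH _ (by omega), hH (pos (D.partner b) + 1) (by omega)]
      refine ⟨by omega, ?_⟩
      rcases gA with ⟨u, v, w⟩ | ⟨u, v, w⟩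
      · have vk := v k hltA le_rfl
        rcases gB with ⟨u', v', w'⟩ | ⟨u', v', w'⟩
        · refine Or.inl ⟨u, fun z hz hz' => ?_, by rw [← hdA, w, w']; rfl⟩
          rcases lt_trichotomy z (k + 1) with h3 | h3 | h3
          · rw [hH z (by omega)]; exact v z hz (by omega)
          · subst h3; omega
          · rw [hH z (by omega)]; have := v' z h3 hz'; omega
        · have := v' (k + 2) (by omega) (by omega); omega
      · have vk := v k hltA le_rfl
        rcases gB with ⟨u', v', w'⟩ | ⟨u', v', w'⟩
        · have := v' (k + 2) (by omega) (by omega); omega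
        · refine Or.inr ⟨u, fun z hz hz' => ?_, ?_⟩
          · rcases lt_trichotomy z (k + 1) with h3 | h3 | h3
            · rw [hH z (by omega)]; exact v z hz (by omega)
            · subst h3; omega
            · rw [hH z (by omega)]; have := v' z h3 hz'; omega
          · rw [← hdA, Bool.or_eq_true, w, w', ← eA, or_self]
    by_cases hxd : x = D.partner b
    · have hcp : (D.cap a b hab).partner x = D.partner a := by
        simp [DecMatching.cap, hxd, hda, hdb, hcd.symm]
      rw [hcp, hxd] at hx; omega
    have hcp : (D.cap a b hab).partner x = D.partner x := by
      simp [DecMatching.cap, hxa, hxb, hxc, hxd]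
    have hcdx : (D.cap a b hab).dec x = D.dec x := by
      simp [DecMatching.cap, hxa, hxb, hxc, hxd]
    rw [hcp] at hx ⊢
    have hx'a : D.partner x ≠ a := fun h' => hxc (by rw [← hpp x, h'])
    have hx'b : D.partner x ≠ b := fun h' => hxd (by rw [← hpp x, h'])
    have n1 := hpn _ _ hxa
    have n2 := hpn _ _ hxb
    have n3 := hpn _ _ hx'a
    have n4 := hpn _ _ hx'b
    rw [hcdx, hH (pos x) (by omega), hH (pos (D.partner x) + 1) (by omega)]
    obtain ⟨e', h'⟩ := h x hx
    refine ⟨e', h'.imp ?_ ?_⟩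
    · rintro ⟨u, v, w⟩
      refine ⟨u, fun z hz hz' => ?_, w⟩
      by_cases hzk : z = k + 1
      · have := v k (by omega) (by omega)
        subst hzk; omega
      · rw [hH z hzk]; exact v z hz hz'
    · rintro ⟨u, v, w⟩
      refine ⟨u, fun z hz hz' => ?_, w⟩
      by_cases hzk : z = k + 1
      · have := v k (by omega) (by omega)
        subst hzk; omega
      · rw [hH z hzk]; exact v z hz hz'

/-! ### The diagrams of the maximal bitableaux -/

/-- The neighbour `k + 1` or `k - 1` of an even or odd `k`. -/
def mate (k : ℕ) : ℕ := if k % 2 = 0 then k + 1 else k - 1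

theorem mate_mate (k : ℕ) : mate (mate k) = k := by unfold mate; split_ifs <;> omega

theorem mate_lt {k h : ℕ} (hk : k < 2 * h) : mate k < 2 * h := by unfold mate; split_ifs <;> omega

/-- The diagram with `h` decorated horizontal lines on each edge, between neighbouring nodes on the
left, and the first vertical line decorated according to `b`. -/
def topDiag (n h : ℕ) (hh : 2 * h ≤ n) (b : Bool) : DecMatching (Node n) where
  partner x := if hx : (x.2 : ℕ) < 2 * h then
    (x.1, ⟨mate x.2, (mate_lt hx).trans_le hh⟩) else (!x.1, x.2)
  partner_partner x := by
    by_cases hx : (x.2 : ℕ) < 2 * h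
    · simp [hx, mate_lt hx, mate_mate]
    · simp [hx]
  partner_ne x := by
    by_cases hx : (x.2 : ℕ) < 2 * h
    · simp only [hx, dif_pos, ne_eq, Prod.ext_iff, Fin.ext_iff, true_and]
      unfold mate; split_ifs <;> omega
    · simp [hx, Prod.ext_iff]
  dec x := decide ((x.2 : ℕ) < 2 * h) || (decide ((x.2 : ℕ) = 2 * h) && b)
  dec_partner x := by
    by_cases hx : (x.2 : ℕ) < 2 * h
    · simp [hx, mate_lt hx]
    · simp [hx]

-- The alternating part makes `h` dips from `0` to `-1` on each edge, one decorated line each. The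
-- straight part is matched with its mirror image on the other edge, and of these vertical lines
-- only the first starts at level `0`.
open SignSeq in
theorem good_topDiag (h : ℕ) (hh : 2 * h ≤ n) (b : Bool) :
    Good (hgt (zigzag n h b) (zigzag n h b)) (topDiag n h hh b) := by
  intro x hx
  have hlv : ∀ z, z ≤ n → hgt (zigzag n h b) (zigzag n h b) z =
      if z ≤ 2 * h then -((z % 2 : ℕ) : ℤ) else (if b then -1 else 1) * ((z : ℤ) - 2 * h) := by
    intro z hz; rw [hgt, if_pos hz, lv_zigzag h b hz]
  have hlv' : ∀ z, n ≤ z → z ≤ 2 * n → hgt (zigzag n h b) (zigzag n h b) z =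
      if 2 * n - z ≤ 2 * h then -(((2 * n - z) % 2 : ℕ) : ℤ) else
        (if b then -1 else 1) * (((2 * n - z : ℕ) : ℤ) - 2 * h) := by
    intro z hz hz'
    rw [← hgt_rev rfl hz', hlv _ (by omega)]
  generalize hgt (zigzag n h b) (zigzag n h b) = H at *
  obtain ⟨e, i⟩ := x
  have hi := i.2
  by_cases hx2 : (i : ℕ) < 2 * h
  · have hp : (topDiag n h hh b).partner (e, i) = (e, ⟨mate i, (mate_lt hx2).trans_le hh⟩) := by
      simp [topDiag, hx2]
    have hd : (topDiag n h hh b).dec (e, i) = true := by simp [topDiag, hx2]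
    have hm := mate_lt hx2
    rw [hp] at hx ⊢
    rw [hd]
    cases e
    · simp only [pos_false] at hx ⊢
      have hi2 : (i : ℕ) % 2 = 1 ∧ mate i = i - 1 := by
        unfold mate at *; split_ifs at * <;> omega
      have e1 : 2 * n - (2 * n - 1 - i) = i + 1 := by omega
      have e2 : 2 * n - (2 * n - 1 - mate i + 1) = i - 1 := by omega
      have H1 : H (2 * n - 1 - i) = 0 := by
        rw [hlv' _ (by omega) (by omega), e1, if_pos (by omega)]; omega
      have H2 : H (2 * n - 1 - mate i + 1) = 0 := by
        rw [hlv' _ (by omega) (by omega), e2, if_pos (by omega)]; omega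
      rw [H1, H2]
      refine ⟨rfl, Or.inr ⟨le_rfl, fun z hz hz' => ?_, by simp⟩⟩
      obtain rfl : z = 2 * n - 1 - i + 1 := by omega
      rw [hlv' _ (by omega) (by omega),
        show 2 * n - (2 * n - 1 - i + 1) = i by omega, if_pos (by omega)]; omega
    · simp only [pos_true] at hx ⊢
      have hi2 : (i : ℕ) % 2 = 0 ∧ mate i = i + 1 := by
        unfold mate at *; split_ifs at * <;> omega
      have H1 : H i = 0 := by
        rw [hlv _ (by omega), if_pos (by omega)]; omega
      have H2 : H (mate i + 1) = 0 := by
        rw [hlv _ (by omega), if_pos (by omega)]; omega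
      rw [H1, H2]
      refine ⟨rfl, Or.inr ⟨le_rfl, fun z hz hz' => ?_, by simp⟩⟩
      obtain rfl : z = i + 1 := by omega
      rw [hlv _ (by omega), if_pos (by omega)]; omega
  · have hp : (topDiag n h hh b).partner (e, i) = (!e, i) := by
      simp [topDiag, hx2]
    have hd : (topDiag n h hh b).dec (e, i) = (decide ((i : ℕ) = 2 * h) && b) := by
      simp [topDiag, hx2]
    rw [hp] at hx ⊢
    rw [hd]
    cases e
    · rw [pos_false, Bool.not_false, pos_true] at hx; omega
    · rw [Bool.not_true, pos_true, pos_false]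
      have H1 : H i = (if b then -1 else 1) * ((i : ℤ) - 2 * h) := by
        rw [hlv _ (by omega)]
        split_ifs with h1 <;> [skip; skip; rfl; rfl] <;> · obtain h3 : (i : ℕ) = 2 * h := by omega
                                                           rw [h3]; simp
      have H2 : H (2 * n - 1 - i + 1) = H i := by
        rcases Nat.eq_or_lt_of_le (show n ≤ 2 * n - 1 - i + 1 by omega) with h1 | h1
        · rw [H1, hlv' _ (by omega) (by omega)]
          omega
        · rw [H1, hlv' _ (by omega) (by omega), show 2 * n - (2 * n - 1 - i + 1) = i by omega]
          split_ifs with h1 <;> [skip; skip; rfl; rfl] <;> · obtain h3 : (i : ℕ) = 2 * h := by omega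
                                                             rw [h3]; simp
      have H3 : ∀ z, (i : ℕ) < z → z ≤ 2 * n - 1 - i → ∃ u : ℤ, (i : ℤ) - 2 * h < u ∧
          H z = (if b then -1 else 1) * u := by
        intro z hz hz'
        rcases le_total z n with h1 | h1
        · exact ⟨(z : ℤ) - 2 * h, by omega, by rw [hlv z h1, if_neg (by omega)]⟩
        · exact ⟨((2 * n - z : ℕ) : ℤ) - 2 * h, by omega,
            by rw [hlv' z h1 (by omega), if_neg (by omega)]⟩
      refine ⟨H2.symm, ?_⟩
      rw [H1]
      cases b
      · refine Or.inl ⟨by simp; omega, fun z hz hz' => ?_, by simp⟩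
        obtain ⟨u, h4, h5⟩ := H3 z hz hz'
        rw [h5]; simp; omega
      · refine Or.inr ⟨by simp; omega, fun z hz hz' => ?_, by simp; omega⟩
        obtain ⟨u, h4, h5⟩ := H3 z hz hz'
        rw [h5]; simp; omega

end DecMatching

end

section

/-! ### The two actions on diagrams -/

namespace DecMatching

section Blob
variable {V : Type} [DecidableEq V]

/-- Transport of the blob from the line at `a` to the line at `c`. -/
def shiftBlob (a c : V) (D : DecMatching V) : DecMatching V where
  partner := D.partner
  partner_partner := D.partner_partner
  partner_ne := D.partner_ne
  dec x := if x = a ∨ x = D.partner a then false else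
    if x = c ∨ x = D.partner c then D.dec c || D.dec a else D.dec x
  dec_partner x := by
    have := D.partner_partner
    have := D.dec_partner
    grind (splits := 40)

/-- On a diagram that already has a line from `a` to `b`, the product of the two generators restores
the pairing. Its only effect is to carry the blob of this line over to the line at `c`, which is how
blobs travel past horizontal lines in `pWord`. -/
theorem cap_cap_of_partner {a b c : V} (hab : a ≠ b) (hbc : b ≠ c) (hac : a ≠ c)
    (D : DecMatching V) (h : D.partner a = b) :
    (D.cap b c hbc).cap a b hab = D.shiftBlob a c := by
  have h1 := D.partner_partner
  have h2 := D.partner_ne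
  have h3 := D.dec_partner
  ext x
  · simp only [cap, shiftBlob]; grind (splits := 40)
  · simp only [cap, shiftBlob]; grind (splits := 40)

theorem capScalar_of_partner {R : Type*} [CommRing R] (δ y : R) {a b c : V} (hac : a ≠ c)
    (D : DecMatching V) (h : D.partner a = b) : D.capScalar δ y b c = 1 := by
  have h1 := D.partner_partner
  simp only [capScalar]; grind

theorem capScalar_cap_of_partner {R : Type*} [CommRing R] (δ y : R) {a b c : V} (hab : a ≠ b)
    (hbc : b ≠ c) (hac : a ≠ c) (D : DecMatching V) (h : D.partner a = b) :
    (D.cap b c hbc).capScalar δ y a b = 1 := by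
  have h1 := D.partner_partner
  have h2 := D.partner_ne
  simp only [capScalar, cap]; grind (splits := 40)

theorem shiftBlob_blob {a c : V} (D : DecMatching V) (ha : D.dec a = true) : (D.shiftBlob a c).blob a = D.blob c := by
  have h1 := D.partner_partner
  have h3 := D.dec_partner
  ext x
  · rfl
  · simp only [blob, shiftBlob]; grind (splits := 40)

theorem blob_comm (a b : V) (D : DecMatching V) : (D.blob a).blob b = (D.blob b).blob a := by
  ext x
  · rfl
  · simp only [blob]; grind

theorem blobOp_comm (R : Type*) [CommRing R] (a b : V) :
    blobOp R a * blobOp R b = blobOp R b * blobOp R a := by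
  apply Finsupp.lhom_ext; intro D r
  simp [-Finsupp.single_mul, blob_comm a b]

end Blob

variable {n : ℕ}

theorem flip_cap (a b : Node n) (hab : a ≠ b) (D : DecMatching (Node n)) :
    (D.cap a b hab).flip =
      D.flip.cap (flipNode a) (flipNode b) (fun h => hab (flipNode_inj.1 h)) := by
  have e : ∀ x c : Node n, flipNode x = c ↔ x = flipNode c :=
    fun x c => ⟨fun h => by rw [← h, flipNode_flipNode], fun h => by rw [h, flipNode_flipNode]⟩
  refine DecMatching.ext (funext fun x => ?_) (funext fun x => ?_)
  · simp only [flip, cap, e, flipNode_flipNode]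
    split_ifs <;> simp
  · simp only [flip, cap, e, flipNode_flipNode]

theorem flip_blob (a : Node n) (D : DecMatching (Node n)) :
    (D.blob a).flip = D.flip.blob (flipNode a) := by
  have e : ∀ x c : Node n, flipNode x = c ↔ x = flipNode c :=
    fun x c => ⟨fun h => by rw [← h, flipNode_flipNode], fun h => by rw [h, flipNode_flipNode]⟩
  refine DecMatching.ext (funext fun x => ?_) (funext fun x => ?_)
  · rfl
  · simp only [flip, blob, e, flipNode_flipNode]

theorem capScalar_flip {R : Type*} [CommRing R] (δ y : R) (a b : Node n)
    (D : DecMatching (Node n)) :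
    D.flip.capScalar δ y (flipNode a) (flipNode b) = D.capScalar δ y a b := by
  simp [capScalar, flip, flipNode_inj]

/-- Linear extension of the reflection of diagrams. -/
noncomputable def flipMap (R : Type*) [CommRing R] (n : ℕ) :
    (DecMatching (Node n) →₀ R) →ₗ[R] (DecMatching (Node n) →₀ R) :=
  Finsupp.lmapDomain R R flip

@[simp] theorem flipMap_single {R : Type*} [CommRing R] (D : DecMatching (Node n)) (r : R) :
    flipMap R n (Finsupp.single D r) = Finsupp.single D.flip r := by
  simp [flipMap]

theorem flipMap_flipMap {R : Type*} [CommRing R] (v : DecMatching (Node n) →₀ R) :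
    flipMap R n (flipMap R n v) = v := by
  have : flipMap R n ∘ₗ flipMap R n = LinearMap.id := by
    apply Finsupp.lhom_ext; intro D r; simp
  exact LinearMap.congr_fun this v

theorem topDiag_true (h : ℕ) (hh : 2 * h < n) :
    (topDiag n h hh.le false).blob (true, ⟨2 * h, hh⟩) = topDiag n h hh.le true := by
  refine DecMatching.ext (funext fun ⟨b, j⟩ => ?_) (funext fun ⟨b, j⟩ => ?_)
  · rfl
  · cases b <;> simp [blob, topDiag, Prod.ext_iff, Fin.ext_iff, Bool.or_comm]

theorem topDiag_pairs (h : ℕ) (hh : 2 * h ≤ n) (b : Bool) (i : ℕ) (hi : 2 * i + 1 < n)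
    (hih : i < h) : (topDiag n h hh b).partner (true, ⟨2 * i, by omega⟩) =
      (true, ⟨2 * i + 1, hi⟩) ∧ (topDiag n h hh b).dec (true, ⟨2 * i, by omega⟩) = true := by
  have e : 2 * i < 2 * h := by omega
  simp [topDiag, e, mate]

theorem topDiag_succ (h : ℕ) (hh : 2 * (h + 1) ≤ n)
    (hne : ((true, ⟨2 * h, by omega⟩) : Node n) ≠ (true, ⟨2 * h + 1, by omega⟩)) :
    ((topDiag n h (by omega) true).cap (true, ⟨2 * h, by omega⟩) (true, ⟨2 * h + 1, by omega⟩)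
      hne).blob (true, ⟨2 * h, by omega⟩) = topDiag n (h + 1) hh false := by
  have hb0 : 2 * h < n := by omega
  have hb1 : 2 * h + 1 < n := by omega
  refine DecMatching.ext (funext fun ⟨b, j⟩ => ?_) (funext fun ⟨b, j⟩ => ?_)
  · rcases lt_or_ge (j : ℕ) (2 * h) with h1 | h1
    · have h2 : (j : ℕ) < 2 * (h + 1) := by omega
      have h3 : (j : ℕ) ≠ 2 * h := by omega
      have h4 : (j : ℕ) ≠ 2 * h + 1 := by omega
      cases b <;> simp [blob, cap, topDiag, Prod.ext_iff, Fin.ext_iff, h1, h2, h3, h4]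
    rcases Nat.eq_or_lt_of_le h1 with h1 | h1
    · obtain rfl : j = ⟨2 * h, hb0⟩ := Fin.ext h1.symm
      have h2 : mate (2 * h) = 2 * h + 1 := by simp [mate]
      have h3 : 2 * h < 2 * (h + 1) := by omega
      cases b <;> simp [blob, cap, topDiag, h2, h3]
    rcases Nat.eq_or_lt_of_le (show 2 * h + 1 ≤ j from h1) with h1 | h1
    · obtain rfl : j = ⟨2 * h + 1, hb1⟩ := Fin.ext h1.symm
      have h2 : mate (2 * h + 1) = 2 * h := by unfold mate; split_ifs <;> omega
      have h3 : 2 * h + 1 < 2 * (h + 1) := by omega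
      cases b <;> simp [blob, cap, topDiag, h2, h3]
    · have h2 : ¬ (j : ℕ) < 2 * (h + 1) := by omega
      have h2' : ¬ (j : ℕ) < 2 * h := by omega
      have h3 : (j : ℕ) ≠ 2 * h := by omega
      have h4 : (j : ℕ) ≠ 2 * h + 1 := by omega
      cases b <;> simp [blob, cap, topDiag, Prod.ext_iff, Fin.ext_iff, h2, h2', h3, h4]
  · rcases lt_or_ge (j : ℕ) (2 * h) with h1 | h1
    · have h2 : (j : ℕ) < 2 * (h + 1) := by omega
      have h3 : (j : ℕ) ≠ 2 * h := by omega
      have h4 : (j : ℕ) ≠ 2 * h + 1 := by omega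
      cases b <;> simp [blob, cap, topDiag, Prod.ext_iff, Fin.ext_iff, h1, h2, h3, h4]
    rcases Nat.eq_or_lt_of_le h1 with h1 | h1
    · have h3 : (j : ℕ) < 2 * (h + 1) := by omega
      cases b <;> simp [blob, cap, topDiag, Prod.ext_iff, Fin.ext_iff, h3] <;> simp [← h1]
    rcases Nat.eq_or_lt_of_le (show 2 * h + 1 ≤ j from h1) with h1 | h1
    · have h3 : (j : ℕ) < 2 * (h + 1) := by omega
      cases b <;> simp [blob, cap, topDiag, Prod.ext_iff, Fin.ext_iff, h3] <;> simp [← h1]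
    · have h2 : ¬ (j : ℕ) < 2 * (h + 1) := by omega
      have h2' : ¬ (j : ℕ) < 2 * h := by omega
      have h3 : (j : ℕ) ≠ 2 * h := by omega
      have h4 : (j : ℕ) ≠ 2 * h + 1 := by omega
      cases b <;> simp [blob, cap, topDiag, Prod.ext_iff, Fin.ext_iff, h2, h2', h3, h4]

theorem flip_topDiag (h : ℕ) (hh : 2 * h ≤ n) (b : Bool) :
    (topDiag n h hh b).flip = topDiag n h hh b := by
  refine DecMatching.ext (funext fun ⟨e, j⟩ => ?_) (funext fun ⟨e, j⟩ => ?_)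
  · by_cases hj : (j : ℕ) < 2 * h <;> simp [DecMatching.flip, topDiag, flipNode, hj]
  · rfl

end DecMatching

open DecMatching

section Action
variable {R : Type*} [CommRing R] {n : ℕ} [NeZero n] (q Q : R)

/-- Concatenation of diagrams with a generator at the bottom. -/
noncomputable def botOp : BlobGen n → Module.End R (DecMatching (Node n) →₀ R)
  | .e => blobOp R (flipNode (true, 0))
  | .U i => capOp R (gaussTwo q) (blobParam q Q) (flipNode (topL i)) (flipNode (topR i))
      (fun h => topL_ne_topR i (flipNode_inj.1 h))

theorem flipMap_botOp (g : BlobGen n) (v : DecMatching (Node n) →₀ R) :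
    flipMap R n (botOp q Q g v) = genOp R n q Q g (flipMap R n v) := by
  have : flipMap R n ∘ₗ botOp q Q g = (genOp R n q Q g : _ →ₗ[R] _) ∘ₗ flipMap R n := by
    apply Finsupp.lhom_ext; intro D r
    cases g with
    | e => simp [botOp, genOp, flip_blob]
    | U i =>
      have := capScalar_flip (gaussTwo q) (blobParam q Q) (flipNode (topL i)) (flipNode (topR i)) D
      rw [flipNode_flipNode, flipNode_flipNode] at this
      simp [-Finsupp.single_mul, botOp, genOp, flip_cap, this]
  exact LinearMap.congr_fun this v

/-- The two operations touch disjoint sets of nodes. -/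
theorem genOp_comm_botOp (g g' : BlobGen n) :
    genOp R n q Q g * botOp q Q g' = botOp q Q g' * genOp R n q Q g := by
  have key : ∀ x y : Node n, x.1 = true → y.1 = true → x ≠ flipNode y := by
    rintro x y hx hy h
    rw [h, flipNode, hy] at hx
    cases hx
  have k0 := fun i : Fin (n - 1) => key (topL i) (true, 0) rfl rfl
  have k1 := fun i : Fin (n - 1) => key (topR i) (true, 0) rfl rfl
  have k2 := fun i : Fin (n - 1) => (key (true, 0) (topL i) rfl rfl).symm
  have k3 := fun i : Fin (n - 1) => (key (true, 0) (topR i) rfl rfl).symm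
  have k4 := fun i j : Fin (n - 1) => key (topL i) (topL j) rfl rfl
  have k5 := fun i j : Fin (n - 1) => key (topL i) (topR j) rfl rfl
  have k6 := fun i j : Fin (n - 1) => key (topR i) (topL j) rfl rfl
  have k7 := fun i j : Fin (n - 1) => key (topR i) (topR j) rfl rfl
  clear key
  cases g with
  | e =>
    cases g' with
    | e => exact blobOp_comm R _ _
    | U j =>
      rw [genOp, botOp]
      exact (capOp_blobOp R _ _ (flipNode (topL j)) (flipNode (topR j)) (true, 0) _
        (k2 j) (k3 j)).symm
  | U i =>
    cases g' with
    | e =>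
      rw [genOp, botOp]
      exact capOp_blobOp R _ _ (topL i) (topR i) (flipNode (true, 0)) _ (k0 i) (k1 i)
    | U j =>
      rw [genOp, botOp]
      exact capOp_comm R _ _ (topL i) (topR i) (flipNode (topL j)) (flipNode (topR j)) _ _
        (k4 i j) (k5 i j) (k6 i j) (k7 i j)

theorem botOp_one (g : BlobGen n) : botOp q Q g (Finsupp.single (DecMatching.one n) 1) =
    genOp R n q Q g (Finsupp.single (DecMatching.one n) 1) := by
  cases g with
  | e =>
    simp only [botOp, genOp, blobOp_single]
    congr 1
    refine DecMatching.ext (funext fun x => ?_) (funext fun x => ?_)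
    · rfl
    · simp only [blob, DecMatching.one, flipNode]
      simp [or_comm]
  | U i =>
    have e1 : (DecMatching.one n).capScalar (gaussTwo q) (blobParam q Q) (topL i) (topR i) = 1 := by
      simp [capScalar, DecMatching.one, topL, topR]
    have e2 : (DecMatching.one n).capScalar (gaussTwo q) (blobParam q Q) (flipNode (topL i))
        (flipNode (topR i)) = 1 := by
      simp [capScalar, DecMatching.one, topL, topR, flipNode]
    simp only [botOp, genOp, capOp_single, e1, e2]
    congr 1
    refine DecMatching.ext (funext fun x => ?_) (funext fun x => ?_)
    · simp only [cap, DecMatching.one, flipNode, topL, topR]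
      obtain ⟨b, j⟩ := x
      cases b <;> simp [Prod.ext_iff]
    · simp only [cap, DecMatching.one, flipNode, topL, topR]
      obtain ⟨b, j⟩ := x
      cases b <;> simp [Prod.ext_iff]

theorem blobAct_gen (g : BlobGen n) : blobAct R n q Q (Blob.gen q Q g) = genOp R n q Q g := by
  simp [blobAct, Blob.gen]

theorem blobRealization_apply (x : Blob R n q Q) :
    blobRealization R n q Q x = blobAct R n q Q x (Finsupp.single (DecMatching.one n) 1) := rfl

theorem blobRealization_mul (x y : Blob R n q Q) :
    blobRealization R n q Q (x * y) = blobAct R n q Q x (blobRealization R n q Q y) := by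
  rw [blobRealization_apply, map_mul]; rfl

theorem blobAct_comm_botOp (x : Blob R n q Q) (g : BlobGen n) :
    blobAct R n q Q x * botOp q Q g = botOp q Q g * blobAct R n q Q x := by
  have hx : x ∈ Algebra.adjoin R (Set.range (Blob.gen q Q : BlobGen n → Blob R n q Q)) := by
    rw [Blob.adjoin_gen]; exact Algebra.mem_top
  induction hx using Algebra.adjoin_induction with
  | mem x hx =>
    obtain ⟨g', rfl⟩ := hx
    rw [blobAct_gen]; exact genOp_comm_botOp q Q g' g
  | algebraMap r => rw [AlgHom.commutes]; exact Algebra.commutes r _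
  | add x y _ _ h1 h2 => rw [map_add, add_mul, mul_add, h1, h2]
  | mul x y _ _ h1 h2 => rw [map_mul, mul_assoc, h2, ← mul_assoc, h1, mul_assoc]

/-- Right multiplication is concatenation at the bottom: the bottom operation commutes with the
whole left action and agrees with the top operation on the identity diagram. -/
theorem blobRealization_mul_gen (x : Blob R n q Q) (g : BlobGen n) :
    blobRealization R n q Q (x * Blob.gen q Q g) = botOp q Q g (blobRealization R n q Q x) := by
  have := LinearMap.congr_fun (blobAct_comm_botOp q Q x g)
    (Finsupp.single (DecMatching.one n) 1)
  rw [blobRealization_mul, blobRealization_apply q Q (Blob.gen q Q g), blobAct_gen, ← botOp_one]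
  exact this

/-- The product of the generators `U_k` along a list of indices. -/
noncomputable def wordU (ks : List (Fin (n - 1))) : Blob R n q Q :=
  (ks.map fun k => Blob.gen q Q (.U k)).prod

/-- By reflection, adding boxes to the bottom edge is reduced to adding them to the top edge, so
that `BoxChain.exists_good` serves both edges. -/
theorem flipMap_blobRealization_mul_wordU (x : Blob R n q Q) (ks : List (Fin (n - 1))) :
    flipMap R n (blobRealization R n q Q (x * wordU q Q ks.reverse)) =
      blobAct R n q Q (wordU q Q ks) (flipMap R n (blobRealization R n q Q x)) := by
  induction ks with
  | nil => simp [wordU]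
  | cons k ks ih =>
    have e : x * wordU q Q (k :: ks).reverse =
        x * wordU q Q ks.reverse * Blob.gen q Q (.U k) := by
      simp [wordU, mul_assoc]
    rw [e, blobRealization_mul_gen, flipMap_botOp, ih]
    have e2 : wordU q Q (k :: ks) = Blob.gen q Q (.U k) * wordU q Q ks := by simp [wordU]
    rw [e2, map_mul, blobAct_gen]; rfl

open SignSeq in
/-- Adding boxes to the upper edge of a diagram. -/
theorem SignSeq.BoxChain.exists_good {T s t : Fin n → Bool} {ks : List (Fin (n - 1))} {z : ℕ}
    (h : BoxChain T s ks z) {D : DecMatching (Node n)} (hD : Good (hgt T t) D) :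
    ∃ D', Good (hgt s t) D' ∧ blobAct R n q Q (wordU q Q ks) (Finsupp.single D 1) =
      blobParam q Q ^ z • Finsupp.single D' 1 := by
  induction h with
  | base => exact ⟨D, hD, by simp [wordU]⟩
  | step w ks z k _ ha ih =>
    obtain ⟨D', h1, h2⟩ := ih
    have hk := k.2
    have e1 := lv_lo_succ k w
    have e2 := lv_hi_succ k w
    have e3 := lv_lo_succ k (sw k w)
    rw [lv_sw k w (z := k) (by omega), sw_lo, ha.2] at e3
    rw [ha.2] at e2
    rw [ha.1] at e1
    have hH : hgt w t k = lv w k := by rw [hgt, if_pos (by omega)]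
    have hH1 : hgt w t (k + 1) = lv w (k + 1) := by rw [hgt, if_pos (by omega)]
    have hH2 : hgt w t (k + 2) = lv w (k + 2) := by rw [hgt, if_pos (by omega)]
    have hH3 : hgt (sw k w) t (k + 1) = lv (sw k w) (k + 1) := by rw [hgt, if_pos (by omega)]
    obtain ⟨g1, g2, g3⟩ := h1.cap (H' := hgt (sw k w) t) k
      (fun z hz => by unfold hgt; rw [lv_sw k w hz])
      (by rw [hH2, hH, e2, e1]; by_cases h0 : 0 ≤ lv w k <;> simp [h0])
      (by
        rw [hH1, hH, hH3, e1, e3]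
        by_cases h0 : 0 ≤ lv w k
        · simp [h0]; omega
        · simp [h0]; omega)
    rw [hH] at g2 g3
    refine ⟨_, g1, ?_⟩
    have e : wordU q Q (k :: ks) = Blob.gen q Q (.U k) * wordU q Q ks := by simp [wordU]
    -- A loop is closed exactly when the box is added at level `0`; this is what `z` counts.
    have hs : D'.capScalar (gaussTwo q) (blobParam q Q) (topL k) (topR k) =
        blobParam q Q ^ (if lv w k = 0 then 1 else 0) := by
      unfold capScalar
      simp only [g2]
      split_ifs with h3 h4
      · rw [pow_one]
      · exact absurd (g3 h3) h4
      · rw [pow_zero]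
    rw [e, map_mul, Module.End.mul_apply, h2, map_smul, blobAct_gen, genOp, capOp_single, hs,
      one_mul, pow_add, mul_smul, Finsupp.smul_single _ _ (1 : R), smul_eq_mul, mul_one]

/-! ### Words for the maximal bitableaux -/

theorem blobAct_genSeq (k : ℕ) (hk : k < n - 1) : blobAct R n q Q (Blob.genSeq q Q (k + 1)) =
    capOp R (gaussTwo q) (blobParam q Q) (topL ⟨k, hk⟩) (topR ⟨k, hk⟩) (topL_ne_topR _) := by
  rw [Blob.genSeq, if_neg (by omega), dif_pos (by simpa using hk), blobAct_gen]
  rfl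

/-- The word which moves a blob to the line at the node `2 h`, past `h` decorated lines. -/
noncomputable def pWord : ℕ → Blob R n q Q
  | 0 => Blob.gen q Q .e
  | h + 1 => pWord h * (Blob.genSeq q Q (2 * h + 1) * Blob.genSeq q Q (2 * h + 2))

/-- The word with `h` decorated horizontal lines on each edge. -/
noncomputable def cWord : ℕ → Blob R n q Q
  | 0 => 1
  | h + 1 => pWord q Q h * (Blob.genSeq q Q (2 * h + 1) * (pWord q Q h * cWord h))

/-- The word of the diagram `topDiag`. -/
noncomputable def topWord (h : ℕ) (b : Bool) : Blob R n q Q :=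
  if b then pWord q Q h * cWord q Q h else cWord q Q h

/-- The first two generators that act move the blob of the line joining `2 h` and `2 h + 1` to the
line at `2 h + 2`, and the shorter word then puts a blob back on the line at `2 h`. The net effect
is a new blob to the right of decorated horizontal lines, although `e` itself acts at the first node
only. -/
theorem blobAct_pWord (h : ℕ) (hh : 2 * h < n) (D : DecMatching (Node n))
    (hp : ∀ (i : ℕ) (hi : 2 * i + 1 < n), i < h →
      D.partner (true, ⟨2 * i, by omega⟩) = (true, ⟨2 * i + 1, hi⟩) ∧
      D.dec (true, ⟨2 * i, by omega⟩) = true) :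
    blobAct R n q Q (pWord q Q h) (Finsupp.single D 1) =
      Finsupp.single (D.blob (true, ⟨2 * h, hh⟩)) 1 := by
  induction h generalizing D with
  | zero => rw [pWord, blobAct_gen, genOp, blobOp_single]; rfl
  | succ h ih =>
    obtain ⟨h1, h2⟩ := hp h (by omega) (by omega)
    rw [pWord, map_mul, map_mul, blobAct_genSeq q Q (2 * h) (by omega),
      blobAct_genSeq q Q (2 * h + 1) (by omega)]
    have hab : ((true, ⟨2 * h, by omega⟩) : Node n) ≠ (true, ⟨2 * h + 1, by omega⟩) := by simp
    have hac : ((true, ⟨2 * h, by omega⟩) : Node n) ≠ (true, ⟨2 * h + 2, by omega⟩) := by simp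
    have hbc : ((true, ⟨2 * h + 1, by omega⟩) : Node n) ≠ (true, ⟨2 * h + 2, by omega⟩) := by simp
    simp only [topL, topR, Module.End.mul_apply, capOp_single]
    rw [capScalar_of_partner _ _ hac D h1, capScalar_cap_of_partner _ _ hab hbc hac D h1,
      cap_cap_of_partner hab hbc hac D h1, mul_one, mul_one, ih (by omega)]
    · rw [shiftBlob_blob D h2]; rfl
    · intro i hi hih
      obtain ⟨h3, h4⟩ := hp i hi (by omega)
      refine ⟨h3, ?_⟩
      obtain ⟨h5, -⟩ := hp i hi (by omega)
      simp only [shiftBlob]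
      rw [h1, h4, h2, if_neg, Bool.or_true]
      · simp
      · simp; omega

/-- The inner `pWord` decorates the vertical line at `2 h`, the cap joins it with its right
neighbour so that the blob ends on the new bottom line, and the outer `pWord` decorates the new top
line. -/
theorem blobRealization_cWord (h : ℕ) (hh : 2 * h ≤ n) :
    blobRealization R n q Q (cWord q Q h) = Finsupp.single (topDiag n h hh false) 1 := by
  induction h with
  | zero =>
    rw [cWord, blobRealization_apply, map_one, Module.End.one_apply]
    congr 1
    refine DecMatching.ext (funext fun x => ?_) (funext fun x => ?_)
    · simp [topDiag, DecMatching.one]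
    · simp [topDiag, DecMatching.one]
  | succ h ih =>
    have hne : ((true, ⟨2 * h, by omega⟩) : Node n) ≠ (true, ⟨2 * h + 1, by omega⟩) := by simp
    rw [cWord, blobRealization_mul, blobRealization_mul, blobRealization_mul, ih (by omega),
      blobAct_pWord q Q h (by omega) _ (topDiag_pairs h _ _), topDiag_true,
      blobAct_genSeq q Q (2 * h) (by omega)]
    simp only [topL, topR, capOp_single]
    have e : (topDiag n h (by omega) true).capScalar (gaussTwo q) (blobParam q Q)
        (true, ⟨2 * h, by omega⟩) (true, ⟨2 * h + 1, by omega⟩) = 1 := by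
      simp [capScalar, topDiag]
    rw [e, mul_one, blobAct_pWord q Q h (by omega), topDiag_succ h hh]
    intro i hi hih
    have h1 : (2 * i) < 2 * h := by omega
    have h3 : 2 * i ≠ 2 * h := by omega
    have h4 : 2 * i ≠ 2 * h + 1 := by omega
    simp [cap, topDiag, Prod.ext_iff, Fin.ext_iff, h1, h3, h4, mate]

theorem blobRealization_topWord (h : ℕ) (hh : 2 * h ≤ n) (b : Bool) (hb : b = true → 2 * h < n) :
    blobRealization R n q Q (topWord q Q h b) = Finsupp.single (topDiag n h hh b) 1 := by
  cases b
  · rw [topWord, if_neg (by simp), blobRealization_cWord q Q h hh]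
  · rw [topWord, if_pos rfl, blobRealization_mul, blobRealization_cWord q Q h hh,
      blobAct_pWord q Q h (hb rfl) _ (topDiag_pairs h _ _), topDiag_true]

end Action

end

section

open DecMatching SignSeq

/-! ### The diagram basis -/

/-- Pairs of sign sequences of the same shape. -/
abbrev SignPair (n : ℕ) : Type := {p : (Fin n → Bool) × (Fin n → Bool) // lv p.1 n = lv p.2 n}

/-- A common end level means equally many entries `true`, so the number of pairs is the sum of the
squares of the binomial coefficients `n.choose k`. -/
theorem card_signPair (n : ℕ) : Fintype.card (SignPair n) = (2 * n).choose n := by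
  classical
  have hfib : ∀ k, (Finset.univ.filter fun w : Fin n → Bool => cnt true w n = k).card =
      n.choose k := by
    intro k
    rw [show n.choose k = (Finset.powersetCard k (Finset.univ : Finset (Fin n))).card by simp]
    refine Finset.card_bij' (fun w _ => Finset.univ.filter fun j => w j = true)
      (fun A _ => fun j => decide (j ∈ A)) ?_ ?_ ?_ ?_
    · intro w hw
      simpa [Finset.mem_powersetCard, cnt] using hw
    · intro A hA
      simpa [Finset.mem_powersetCard, cnt] using hA
    · intro w _; ext j; simp
    · intro A _; ext j; simp
  rw [Fintype.card_subtype]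
  have h1 : (Finset.univ.filter fun p : (Fin n → Bool) × (Fin n → Bool) =>
      lv p.1 n = lv p.2 n) = (Finset.range (n + 1)).biUnion fun k =>
        (Finset.univ.filter fun w : Fin n → Bool => cnt true w n = k) ×ˢ
        (Finset.univ.filter fun w : Fin n → Bool => cnt true w n = k) := by
    ext ⟨s, t⟩
    have := cnt_add_cnt s le_rfl
    simp only [Finset.mem_filter, Finset.mem_univ, true_and, Finset.mem_biUnion,
      Finset.mem_range, Finset.mem_product, lv_eq_iff (w := s) (w' := t) le_rfl]
    exact ⟨fun h => ⟨_, by omega, rfl, h.symm⟩, fun ⟨k, _, h1, h2⟩ => h1.trans h2.symm⟩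
  rw [h1, Finset.card_biUnion]
  · simp only [Finset.card_product, hfib]
    rw [← Nat.sum_range_choose_sq]
    exact Finset.sum_congr rfl fun k _ => (sq _).symm
  · intro a _ b _ hab
    rw [Function.onFun, Finset.disjoint_left]
    rintro ⟨s, t⟩ h1 h2
    simp only [Finset.mem_filter, Finset.mem_univ, true_and, Finset.mem_product] at h1 h2
    exact hab (h1.1.symm.trans h2.1)

namespace SignSeq
variable {n : ℕ}

/-- The positions of boxes that lead from the maximal sequence to `w`. -/
noncomputable def chain (w : Fin n → Bool) : List (Fin (n - 1)) := (exists_boxChain w).choose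

/-- The number of boxes at level `0` that lead from the maximal sequence to `w`. -/
noncomputable def chainZero (w : Fin n → Bool) : ℕ := (exists_boxChain w).choose_spec.choose

theorem boxChain_chain (w : Fin n → Bool) :
    BoxChain (SignSeq.top n (lv w n)) w (chain w) (chainZero w) :=
  (exists_boxChain w).choose_spec.choose_spec

/-- The number of horizontal lines on each edge of a diagram of shape `v`. -/
def arcs (n : ℕ) (v : ℤ) : ℕ := (n - v.natAbs) / 2

theorem two_mul_arcs_le (n : ℕ) (v : ℤ) : 2 * arcs n v ≤ n := by unfold arcs; omega

theorem two_mul_arcs_lt (w : Fin n → Bool) (h : decide (lv w n < 0) = true) :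
    2 * arcs n (lv w n) < n := by
  have h1 := lv_half w
  have h2 : lv w n < 0 := by simpa using h
  unfold arcs; omega

end SignSeq

/-! ### The diagram basis, indexed by pairs of sign sequences. -/

section Basis
variable {R : Type*} [CommRing R] {n : ℕ} [NeZero n] (q Q : R)

/-- The element of the blob algebra realized by the diagram of a pair of sign sequences. -/
noncomputable def pairElt (p : SignPair n) : Blob R n q Q :=
  Ring.inverse (blobParam q Q) ^ (chainZero p.1.1 + chainZero p.1.2) •
    (wordU q Q (chain p.1.1) *
      (topWord q Q (arcs n (lv p.1.1 n)) (decide (lv p.1.1 n < 0)) *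
        wordU q Q (chain p.1.2).reverse))

/-- Starting from the diagram of the maximal pair, the boxes of the second sequence are added at the
bottom and those of the first one at the top. Every box at level `0` contributes a factor `y_e`, and
the scalar in `pairElt` cancels these factors; this is where invertibility of `y_e` is needed. -/
theorem exists_good_pairElt (hy : IsUnit (blobParam q Q)) (p : SignPair n) :
    ∃ D : DecMatching (Node n), Good (hgt p.1.1 p.1.2) D ∧
      blobRealization R n q Q (pairElt q Q p) = Finsupp.single D 1 := by
  obtain ⟨⟨s, t⟩, h⟩ := p
  simp only at h
  have hT : lv (SignSeq.top n (lv s n)) n = lv t n := (lv_top s).trans h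
  have hD := good_topDiag (n := n) (arcs n (lv s n)) (two_mul_arcs_le n _) (decide (lv s n < 0))
  have hC := blobRealization_topWord q Q (arcs n (lv s n)) (two_mul_arcs_le n _)
    (decide (lv s n < 0)) (two_mul_arcs_lt s)
  have ht := boxChain_chain t
  rw [← h] at ht
  obtain ⟨D1, h1, h2⟩ := ht.exists_good q Q hD
  have h3 := good_flip hT.symm h1
  obtain ⟨D2, h4, h5⟩ := (boxChain_chain s).exists_good q Q h3
  refine ⟨D2, h4, ?_⟩
  have h6 := flipMap_blobRealization_mul_wordU q Q (topWord q Q (arcs n (lv s n))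
    (decide (lv s n < 0))) (chain t)
  rw [hC, flipMap_single, flip_topDiag, h2] at h6
  have h7 := congrArg (flipMap R n) h6
  rw [flipMap_flipMap, map_smul, flipMap_single] at h7
  simp only [pairElt]
  rw [map_smul, blobRealization_mul, h7, map_smul, h5, smul_smul, smul_smul, pow_add]
  have e : Ring.inverse (blobParam q Q) ^ chainZero s * Ring.inverse (blobParam q Q) ^ chainZero t *
      (blobParam q Q ^ chainZero t * blobParam q Q ^ chainZero s) = 1 := by
    rw [mul_comm (blobParam q Q ^ _), mul_mul_mul_comm, ← mul_pow, ← mul_pow,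
      Ring.inverse_mul_cancel _ hy, one_pow, one_pow, one_mul]
  rw [← mul_assoc] at e
  rw [e, one_smul]

variable {q Q} (hy : IsUnit (blobParam q Q))

/-- The diagram of a pair of sign sequences. -/
noncomputable def pairDiag (p : SignPair n) : DecMatching (Node n) :=
  (exists_good_pairElt q Q hy p).choose

theorem good_pairDiag (p : SignPair n) : Good (hgt p.1.1 p.1.2) (pairDiag hy p) :=
  (exists_good_pairElt q Q hy p).choose_spec.1

theorem blobRealization_pairElt (p : SignPair n) :
    blobRealization R n q Q (pairElt q Q p) = Finsupp.single (pairDiag hy p) 1 :=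
  (exists_good_pairElt q Q hy p).choose_spec.2

theorem pair_eq_of_inSecond {p : SignPair n} {s t : Fin n → Bool}
    (h1 : ∀ k, (pairDiag hy p).InSecond true k ↔ s k = true)
    (h2 : ∀ k, (pairDiag hy p).InSecond false k ↔ t k = true) : p.1.1 = s ∧ p.1.2 = t := by
  constructor
  · ext k
    rw [Bool.eq_iff_iff, ← h1, inSecond_of_good p.2 (good_pairDiag hy p)]
  · ext k
    rw [Bool.eq_iff_iff, ← h2, inSecond_of_good' p.2 (good_pairDiag hy p)]

theorem pairDiag_injective : Function.Injective (pairDiag (n := n) hy) := by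
  intro p p' h
  have := pair_eq_of_inSecond hy (p := p) (s := p'.1.1) (t := p'.1.2)
    (fun k => by rw [h]; exact inSecond_of_good p'.2 (good_pairDiag hy p') k)
    (fun k => by rw [h]; exact inSecond_of_good' p'.2 (good_pairDiag hy p') k)
  exact Subtype.ext (Prod.ext this.1 this.2)

/-- The coordinates of an element with respect to the basis `pairElt`. -/
noncomputable def pairCoord : Blob R n q Q →ₗ[R] (SignPair n → R) :=
  LinearMap.pi fun p => (Finsupp.lapply (pairDiag hy p)).comp (blobRealization R n q Q)

theorem pairCoord_apply (x : Blob R n q Q) (p : SignPair n) :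
    pairCoord hy x p = blobRealization R n q Q x (pairDiag hy p) := rfl

theorem pairCoord_pairElt (p : SignPair n) :
    pairCoord hy (pairElt q Q p) = Pi.single p 1 := by
  classical
  ext p'
  rw [pairCoord_apply, blobRealization_pairElt hy, Finsupp.single_apply, Pi.single_apply]
  simp only [(pairDiag_injective hy).eq_iff, eq_comm]

/-- The coordinate map is onto a free module of rank `(2n choose n)`, and by the normal words its
source is spanned by that many elements. So neither linear independence of the normal words nor a
list of all blob diagrams is required. -/
theorem pairCoord_injective [Nontrivial R] : Function.Injective (pairCoord (n := n) hy) := by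
  obtain ⟨v, hv⟩ := Blob.exists_span_eq_top (n := n) q Q (NeZero.one_le)
  have hsurj : Function.Surjective (pairCoord (n := n) hy) := by
    intro a
    refine ⟨∑ p, a p • pairElt q Q p, ?_⟩
    rw [map_sum]
    ext p'
    simp [pairCoord_pairElt, Pi.single_apply]
  let e : SignPair n ≃ Fin ((2 * n).choose n) := Fintype.equivFinOfCardEq (card_signPair n)
  let ψ := Fintype.linearCombination R (fun p => v (e p))
  have hψ : Function.Surjective ψ := by
    rw [← LinearMap.range_eq_top, Fintype.range_linearCombination, ← hv]
    congr 1
    ext x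
    simp only [Set.mem_range]
    exact ⟨fun ⟨p, h⟩ => ⟨_, h⟩, fun ⟨i, h⟩ => ⟨e.symm i, by simpa using h⟩⟩
  -- A surjective endomorphism of a finitely generated module over a commutative ring is injective.
  have hinj := OrzechProperty.injective_of_surjective_endomorphism
    ((pairCoord (n := n) hy).comp ψ) (hsurj.comp hψ)
  intro x x' h
  obtain ⟨a, rfl⟩ := hψ x
  obtain ⟨a', rfl⟩ := hψ x'
  rw [hinj h]

theorem sum_pairCoord [Nontrivial R] (x : Blob R n q Q) :
    ∑ p, pairCoord hy x p • pairElt q Q p = x := by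
  apply pairCoord_injective hy
  rw [map_sum]
  ext p'
  simp [pairCoord_pairElt, Pi.single_apply]

/-- An element that is realized by a blob diagram is the basis element of its bitableaux. -/
theorem eq_pairElt (hy : IsUnit (blobParam q Q)) [Nontrivial R] {x : Blob R n q Q}
    {D : DecMatching (Node n)} (p : SignPair n)
    (h1 : ∀ k, D.InSecond true k ↔ p.1.1 k = true) (h2 : ∀ k, D.InSecond false k ↔ p.1.2 k = true)
    (hx : blobRealization R n q Q x = Finsupp.single D 1) : x = pairElt q Q p := by
  -- If `D` were none of the diagrams `pairDiag`, all coordinates of `x` would vanish and `x` would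
  -- be zero, which its realization forbids.
  have hD : ∃ p', pairDiag hy p' = D := by
    by_contra hc
    push Not at hc
    have h0 : x = 0 := by
      apply pairCoord_injective hy
      ext p'
      rw [pairCoord_apply, hx, Finsupp.single_eq_of_ne (hc p'), map_zero]; rfl
    rw [h0, map_zero] at hx
    exact one_ne_zero (Finsupp.single_eq_zero.1 hx.symm)
  obtain ⟨p', rfl⟩ := hD
  have := pair_eq_of_inSecond hy h1 h2
  obtain rfl : p' = p := Subtype.ext (Prod.ext this.1 this.2)
  apply pairCoord_injective hy
  ext p''
  rw [pairCoord_apply, pairCoord_apply, hx, blobRealization_pairElt hy]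

end Basis

/-! ### Bitableaux and sign sequences -/

section Tableaux
variable {n : ℕ}

/-- The sign sequence of a standard bitableau. -/
def signs {lam : OneLine n} (t : StdTab lam) : Fin n → Bool := fun k => (t.1.symm k).isRight

theorem signs_inl {lam : OneLine n} (t : StdTab lam) (c : Fin lam.1.1) :
    signs t (t.1 (Sum.inl c)) = false := by simp [signs]

theorem signs_inr {lam : OneLine n} (t : StdTab lam) (c : Fin lam.1.2) :
    signs t (t.1 (Sum.inr c)) = true := by simp [signs]

theorem cnt_signs_false {lam : OneLine n} (t : StdTab lam) (k : ℕ) :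
    cnt false (signs t) k = (Finset.univ.filter fun c => (t.1 (Sum.inl c) : ℕ) < k).card := by
  symm
  refine Finset.card_bij (fun c _ => t.1 (Sum.inl c)) ?_ ?_ ?_
  · intro c hc
    simpa [signs_inl] using hc
  · intro c _ c' _ h
    simpa using h
  · intro j hj
    simp only [Finset.mem_filter, Finset.mem_univ, true_and] at hj
    obtain ⟨c, hc⟩ : ∃ c, t.1.symm j = Sum.inl c := by
      rcases h : t.1.symm j with c | c
      · exact ⟨c, rfl⟩
      · have := hj.2; simp [signs, h] at this
    have : t.1 (Sum.inl c) = j := by rw [← hc, Equiv.apply_symm_apply]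
    exact ⟨c, by simpa [this] using hj.1, this⟩

theorem cnt_signs_true {lam : OneLine n} (t : StdTab lam) (k : ℕ) :
    cnt true (signs t) k = (Finset.univ.filter fun c => (t.1 (Sum.inr c) : ℕ) < k).card := by
  symm
  refine Finset.card_bij (fun c _ => t.1 (Sum.inr c)) ?_ ?_ ?_
  · intro c hc
    simpa [signs_inr] using hc
  · intro c _ c' _ h
    simpa using h
  · intro j hj
    simp only [Finset.mem_filter, Finset.mem_univ, true_and] at hj
    obtain ⟨c, hc⟩ : ∃ c, t.1.symm j = Sum.inr c := by
      rcases h : t.1.symm j with c | c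
      · have := hj.2; simp [signs, h] at this
      · exact ⟨c, rfl⟩
    have : t.1 (Sum.inr c) = j := by rw [← hc, Equiv.apply_symm_apply]
    exact ⟨c, by simpa [this] using hj.1, this⟩

theorem lv_signs {lam : OneLine n} (t : StdTab lam) :
    lv (signs t) n = (lam.1.1 : ℤ) - lam.1.2 := by
  rw [lv, cnt_signs_false, cnt_signs_true]
  simp

theorem restrictShape_eq {lam : OneLine n} (t : StdTab lam) (k : Fin n) :
    restrictShape t k = (cnt false (signs t) (k + 1), cnt true (signs t) (k + 1)) := by
  rw [cnt_signs_false, cnt_signs_true, restrictShape]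
  simp only [Fin.le_def, Nat.lt_succ_iff]

theorem card_filter_lt_fin (a : ℕ) (c : Fin a) :
    (Finset.univ.filter fun c' : Fin a => c' < c).card = c := by
  rw [Finset.filter_gt_eq_Iio, Fin.card_Iio]

theorem cnt_signs_inl {lam : OneLine n} (t : StdTab lam) (c : Fin lam.1.1) :
    cnt false (signs t) (t.1 (Sum.inl c)) = c := by
  rw [cnt_signs_false]
  conv_rhs => rw [← card_filter_lt_fin _ c]
  congr 1; ext c'
  simp only [Finset.mem_filter, Finset.mem_univ, true_and]
  exact t.2.1.lt_iff_lt

theorem cnt_signs_inr {lam : OneLine n} (t : StdTab lam) (c : Fin lam.1.2) :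
    cnt true (signs t) (t.1 (Sum.inr c)) = c := by
  rw [cnt_signs_true]
  conv_rhs => rw [← card_filter_lt_fin _ c]
  congr 1; ext c'
  simp only [Finset.mem_filter, Finset.mem_univ, true_and]
  exact t.2.2.lt_iff_lt

theorem signs_injective {lam : OneLine n} {s t : StdTab lam} (h : signs s = signs t) : s = t := by
  apply Subtype.ext
  have : s.1.symm = t.1.symm := by
    ext k : 1
    have hk := congrFun h k
    rcases hs : s.1.symm k with c | c <;> rcases ht : t.1.symm k with c' | c' <;>
      simp [signs, hs, ht] at hk
    · have e1 := cnt_signs_inl s c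
      have e2 := cnt_signs_inl t c'
      rw [← hs, Equiv.apply_symm_apply] at e1
      rw [← ht, Equiv.apply_symm_apply, ← h, e1] at e2
      rw [Fin.ext e2]
    · have e1 := cnt_signs_inr s c
      have e2 := cnt_signs_inr t c'
      rw [← hs, Equiv.apply_symm_apply] at e1
      rw [← ht, Equiv.apply_symm_apply, ← h, e1] at e2
      rw [Fin.ext e2]
  rw [← Equiv.symm_symm s.1, this, Equiv.symm_symm]

theorem exists_stdTab (lam : OneLine n) (w : Fin n → Bool)
    (h : lv w n = (lam.1.1 : ℤ) - lam.1.2) : ∃ t : StdTab lam, signs t = w := by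
  have h1 := cnt_add_cnt w le_rfl
  have h2 := lam.2
  have ha : (Finset.univ.filter fun j => w j = false).card = lam.1.1 := by
    have : cnt false w n = lam.1.1 := by unfold lv at h; omega
    simpa [cnt] using this
  have hb : (Finset.univ.filter fun j => ¬ w j = false).card = lam.1.2 := by
    have : cnt true w n = lam.1.2 := by unfold lv at h; omega
    simpa [cnt] using this
  let ea := Finset.orderIsoOfFin _ ha
  let eb := Finset.orderIsoOfFin _ hb
  let ea' : Fin lam.1.1 ≃ {j // w j = false} := ea.toEquiv.trans
    (Equiv.subtypeEquivRight fun j => by simp)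
  let eb' : Fin lam.1.2 ≃ {j // ¬ w j = false} := eb.toEquiv.trans
    (Equiv.subtypeEquivRight fun j => by simp)
  let e := (Equiv.sumCongr ea' eb').trans (Equiv.sumCompl fun j => w j = false)
  refine ⟨⟨e, fun c c' hc => ea.strictMono hc, fun c c' hc => eb.strictMono hc⟩, ?_⟩
  ext k
  obtain ⟨x, rfl⟩ := e.surjective k
  simp only [signs, Equiv.symm_apply_apply]
  rcases x with c | c
  · have : w (e (Sum.inl c)) = false := (ea' c).2
    simp [this]
  · have : ¬ w (e (Sum.inr c)) = false := (eb' c).2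
    simpa using this

/-- The shape with a given level. -/
theorem exists_oneLine (w : Fin n → Bool) :
    ∃ lam : OneLine n, lv w n = (lam.1.1 : ℤ) - lam.1.2 :=
  ⟨⟨(cnt false w n, cnt true w n), cnt_add_cnt w le_rfl⟩, rfl⟩

theorem signs_eq_iff (s t : StdAll n) : signs s.2 = signs t.2 ↔ s = t := by
  constructor
  · intro h
    obtain ⟨lam, s⟩ := s
    obtain ⟨mu, t⟩ := t
    simp only at h
    have h1 := lv_signs s
    have h2 := lv_signs t
    have h3 := lam.2
    have h4 := mu.2
    rw [h, h2] at h1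
    obtain rfl : lam = mu := Subtype.ext (Prod.ext (by omega) (by omega))
    rw [signs_injective h]
  · rintro rfl; rfl

theorem exists_stdAll (w : Fin n → Bool) : ∃ t : StdAll n, signs t.2 = w := by
  obtain ⟨lam, h⟩ := exists_oneLine w
  obtain ⟨t, ht⟩ := exists_stdTab lam w h
  exact ⟨⟨lam, t⟩, ht⟩

theorem content_eq {F : Type*} [Field F] (q Q : F) (t : StdAll n) (k : Fin n) :
    content q Q t k = if signs t.2 k then q ^ (2 * cnt true (signs t.2) k) * Q⁻¹
      else q ^ (2 * cnt false (signs t.2) k) * Q := by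
  obtain ⟨x, rfl⟩ := t.2.1.surjective k
  rcases x with c | c
  · rw [signs_inl, cnt_signs_inl, content]; simp
  · rw [signs_inr, cnt_signs_inr, content]; simp

/-- The pair of sign sequences of two bitableaux of the same shape. -/
def tabPair {lam : OneLine n} (s t : StdTab lam) : SignPair n :=
  ⟨(signs s, signs t), by rw [lv_signs, lv_signs]⟩

/-- The choice made in `mElt` is harmless: `pairElt` satisfies the defining property, and
`eq_pairElt` shows that nothing else does. -/
theorem mElt_eq {R : Type*} [CommRing R] [Nontrivial R] [NeZero n] {q Q : R}
    (hy : IsUnit (blobParam q Q)) {lam : OneLine n} (s t : StdTab lam) :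
    mElt q Q s t = pairElt q Q (tabPair s t) := by
  have hex : ∃ x : Blob R n q Q, ∃ D : DecMatching (Node n), D.IsBlobDiagram ∧
      (∀ k, D.InSecond true k ↔ (s.1.symm k).isRight = true) ∧
      (∀ k, D.InSecond false k ↔ (t.1.symm k).isRight = true) ∧
      blobRealization R n q Q x = Finsupp.single D 1 :=
    ⟨pairElt q Q (tabPair s t), pairDiag hy (tabPair s t), (good_pairDiag hy _).isBlobDiagram,
      inSecond_of_good (tabPair s t).2 (good_pairDiag hy _),
      inSecond_of_good' (tabPair s t).2 (good_pairDiag hy _), blobRealization_pairElt hy _⟩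
  obtain ⟨D, -, h1, h2, h3⟩ := Classical.epsilon_spec hex
  exact eq_pairElt hy (tabPair s t) h1 h2 h3

/-- Equal sizes force equal parities of the two differences. Then `|2 f + 1|`, which is `2|f| + 1`
for `f ≥ 0` and `2|f| - 1` for `f < 0`, compares first `|f|` and then prefers the negative sign. -/
theorem shapeGE_iff {a b : ℕ × ℕ} (h : a.1 + a.2 = b.1 + b.2) :
    ShapeGE a b ↔ rk ((a.1 : ℤ) - a.2) ≤ rk ((b.1 : ℤ) - b.2) := by
  unfold ShapeGE rk
  simp only [Int.abs_eq_natAbs]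
  omega

theorem tabGE_iff {lam : OneLine n} (s t : StdTab lam) :
    TabGE s t ↔ ∀ k, k ≤ n → rk (lv (signs s) k) ≤ rk (lv (signs t) k) := by
  have key : ∀ k : Fin n, ShapeGE (restrictShape s k) (restrictShape t k) ↔
      rk (lv (signs s) (k + 1)) ≤ rk (lv (signs t) (k + 1)) := by
    intro k
    rw [restrictShape_eq, restrictShape_eq, shapeGE_iff]
    · rfl
    · rw [cnt_add_cnt _ (by omega), cnt_add_cnt _ (by omega)]
  unfold TabGE
  simp only [key]
  constructor
  · intro h k hk
    rcases k with _ | k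
    · rw [lv_zero, lv_zero]
    · exact h ⟨k, hk⟩
  · exact fun h k => h _ k.2

/-- The maximal standard bitableau. -/
theorem exists_maximal (lam : OneLine n) :
    ∃ T : StdTab lam, signs T = SignSeq.top n ((lam.1.1 : ℤ) - lam.1.2) ∧
      ∀ u : StdTab lam, (∀ t : StdTab lam, TabGE u t) ↔ u = T := by
  have hex : ∃ w : Fin n → Bool, lv w n = (lam.1.1 : ℤ) - lam.1.2 := by
    refine ⟨fun j => decide (lam.1.1 ≤ j), ?_⟩
    have h := lam.2
    have h1 := cnt_add_cnt (fun j : Fin n => decide (lam.1.1 ≤ (j : ℕ))) le_rfl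
    have h2 : cnt false (fun j : Fin n => decide (lam.1.1 ≤ (j : ℕ))) n = lam.1.1 := by
      simp only [cnt, Fin.is_lt, true_and, decide_eq_false_iff_not, not_le]
      rw [Fin.card_filter_val_lt]
      omega
    unfold lv; omega
  obtain ⟨w, hw⟩ := hex
  have hT := lv_top w
  rw [hw] at hT
  obtain ⟨T, hT'⟩ := exists_stdTab lam _ hT
  have hmax : ∀ t : StdTab lam, TabGE T t := by
    intro t
    rw [tabGE_iff, hT', ← lv_signs t]
    exact fun k _ => rk_top_le _ k
  refine ⟨T, hT', fun u => ⟨fun h => ?_, fun h => h ▸ hmax⟩⟩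
  apply signs_injective
  refine eq_of_lv fun k hk => rk_inj hk (le_antisymm ?_ ?_)
  · exact (tabGE_iff _ _).1 (h T) k hk
  · exact (tabGE_iff _ _).1 (hmax u) k hk

end Tableaux

end

section

open SignSeq

/-! ### The seminormal representation -/

/-- The parameters are generic: the contents separate the standard bitableaux. -/
structure GenericParam {F : Type*} [Field F] (q Q : F) : Prop where
  q_ne : q ≠ 0
  Q_ne : Q ≠ 0
  sq_ne : q ^ 2 ≠ 1
  ne : ∀ j : ℤ, q ^ (2 * j) * Q ^ 2 ≠ 1

section SeminormalRep
variable {F : Type*} [Field F] {n : ℕ} (q Q : F)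

/-- The coefficient of `U_k` on a sequence with a step up from level `j`. -/
noncomputable def upCoef (j : ℤ) : F :=
  (q * (q ^ (2 * j) * Q ^ 2) - q⁻¹) / (1 - q ^ (2 * j) * Q ^ 2)

/-- The coefficient of `U_k` on a sequence with a step down from level `j`. -/
noncomputable def downCoef (j : ℤ) : F :=
  (q - q⁻¹ * (q ^ (2 * j) * Q ^ 2)) / (q ^ (2 * j) * Q ^ 2 - 1)

variable {q Q}

namespace GenericParam

theorem zpow_succ (h : GenericParam q Q) (j : ℤ) :
    q ^ (2 * (j + 1)) * Q ^ 2 = q ^ 2 * (q ^ (2 * j) * Q ^ 2) := by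
  rw [mul_add, zpow_add₀ h.q_ne]
  norm_cast
  ring

theorem sub_ne (h : GenericParam q Q) (j : ℤ) : q ^ (2 * j) * Q ^ 2 - 1 ≠ 0 :=
  sub_ne_zero.2 (h.ne j)

theorem sub_ne' (h : GenericParam q Q) (j : ℤ) : 1 - q ^ (2 * j) * Q ^ 2 ≠ 0 :=
  sub_ne_zero.2 (h.ne j).symm

theorem upCoef_add_downCoef (h : GenericParam q Q) (j : ℤ) :
    upCoef q Q j + downCoef q Q j = -(q + q⁻¹) := by
  have h1 := h.sub_ne j
  have h2 := h.sub_ne' j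
  have h3 := h.q_ne
  unfold upCoef downCoef
  generalize q ^ (2 * j) * Q ^ 2 = r at *
  field_simp
  ring

/-- This identity yields `U_i U_j U_i = U_i`, as `upCoef_add_downCoef` yields the relation for
`U_i²` and `downCoef_zero` the one for `U_1 e U_1`. -/
theorem upCoef_mul_downCoef (h : GenericParam q Q) (j : ℤ) :
    upCoef q Q j * downCoef q Q (j + 1) = 1 := by
  have h1 := h.sub_ne (j + 1)
  have h2 := h.sub_ne' j
  have h3 := h.q_ne
  unfold upCoef downCoef
  rw [h.zpow_succ] at h1 ⊢
  generalize q ^ (2 * j) * Q ^ 2 = r at *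
  rw [div_mul_div_comm, div_eq_one_iff_eq (mul_ne_zero h2 h1)]
  field_simp

theorem upCoef_ne (h : GenericParam q Q) (j : ℤ) : upCoef q Q j ≠ 0 :=
  left_ne_zero_of_mul_eq_one (h.upCoef_mul_downCoef j)

theorem downCoef_ne (h : GenericParam q Q) (j : ℤ) : downCoef q Q j ≠ 0 := by
  have := right_ne_zero_of_mul_eq_one (h.upCoef_mul_downCoef (j - 1))
  rwa [sub_add_cancel] at this

theorem Q_sub_ne (h : GenericParam q Q) : Q - Q⁻¹ ≠ 0 := by
  intro h0
  have h2 := h.Q_ne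
  apply h.ne 0
  rw [sub_eq_zero] at h0
  rw [mul_zero, zpow_zero, one_mul, sq]
  nth_rewrite 2 [h0]
  exact mul_inv_cancel₀ h2

theorem downCoef_zero (h : GenericParam q Q) : downCoef q Q 0 = blobParam q Q := by
  have h1 := h.sub_ne 0
  have h2 := h.Q_ne
  have h3 := h.q_ne
  have h4 := h.Q_sub_ne
  unfold downCoef blobParam
  simp only [Ring.inverse_eq_inv']
  rw [← div_eq_mul_inv, ← neg_div, div_eq_div_iff h1 h4]
  simp
  field_simp

theorem isUnit_blobParam (h : GenericParam q Q) : IsUnit (blobParam q Q) :=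
  isUnit_iff_ne_zero.2 (h.downCoef_zero ▸ h.downCoef_ne 0)

end GenericParam

variable (q Q)

/-- The coefficient of `U_k` on the sequence `w`. -/
noncomputable def swCoef (k : Fin (n - 1)) (w : Fin n → Bool) : F :=
  if w (lo k) then downCoef q Q (lv w k) else upCoef q Q (lv w k)

variable {q Q} in
theorem GenericParam.swCoef_ne (h : GenericParam q Q) (k : Fin (n - 1)) (w : Fin n → Bool) :
    swCoef q Q k w ≠ 0 := by
  unfold swCoef
  split_ifs
  exacts [h.downCoef_ne _, h.upCoef_ne _]

variable {q Q} in
theorem GenericParam.swCoef_add (h : GenericParam q Q) (k : Fin (n - 1)) {w : Fin n → Bool}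
    (hw : w (lo k) ≠ w (hi k)) : swCoef q Q k w + swCoef q Q k (sw k w) = -(q + q⁻¹) := by
  have := h.upCoef_add_downCoef (lv w k)
  unfold swCoef
  rw [sw_lo, lv_sw k w (by omega)]
  cases h1 : w (lo k) <;> cases h2 : w (hi k) <;> simp_all
  rw [add_comm, this]

/-- The matrix of `U_k` in the seminormal representation. -/
noncomputable def uMat (k : Fin (n - 1)) : Matrix (Fin n → Bool) (Fin n → Bool) F := fun a b =>
  if b (lo k) ≠ b (hi k) ∧ (a = b ∨ a = sw k b) then swCoef q Q k b else 0

theorem sw_eq_iff {k : Fin (n - 1)} {a b : Fin n → Bool} : a = sw k b ↔ b = sw k a :=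
  ⟨fun h => by rw [h, sw_sw], fun h => by rw [h, sw_sw]⟩

theorem sw_ne_iff {k : Fin (n - 1)} {a : Fin n → Bool} :
    sw k a (lo k) ≠ sw k a (hi k) ↔ a (lo k) ≠ a (hi k) := by
  rw [sw_lo, sw_hi, ne_comm]

theorem uMat_mul_apply {ι : Type*} (k : Fin (n - 1)) (M : Matrix (Fin n → Bool) ι F)
    (a : Fin n → Bool) (x : ι) : (uMat q Q k * M) a x = if a (lo k) ≠ a (hi k) then
      swCoef q Q k a * M a x + swCoef q Q k (sw k a) * M (sw k a) x else 0 := by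
  rw [Matrix.mul_apply]
  split_ifs with h
  · rw [← Finset.sum_subset (Finset.subset_univ {a, sw k a}),
      Finset.sum_pair (sw_ne_self h).symm]
    · simp [uMat, h, h.symm]
    · intro b _ hb
      simp only [Finset.mem_insert, Finset.mem_singleton, not_or] at hb
      rw [uMat, if_neg, zero_mul]
      rw [sw_eq_iff]
      tauto
  · refine Finset.sum_eq_zero fun b _ => ?_
    rw [uMat, if_neg, zero_mul]
    rintro ⟨h1, rfl | rfl⟩
    · exact h h1
    · exact h (sw_ne_iff.2 h1)

theorem mul_uMat_apply {ι : Type*} (k : Fin (n - 1)) (M : Matrix ι (Fin n → Bool) F)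
    (x : ι) (b : Fin n → Bool) : (M * uMat q Q k) x b = if b (lo k) ≠ b (hi k) then
      swCoef q Q k b * (M x b + M x (sw k b)) else 0 := by
  rw [Matrix.mul_apply]
  split_ifs with h
  · rw [← Finset.sum_subset (Finset.subset_univ {b, sw k b}),
      Finset.sum_pair (sw_ne_self h).symm]
    · simp [uMat, h]; ring
    · intro a _ ha
      simp only [Finset.mem_insert, Finset.mem_singleton, not_or] at ha
      rw [uMat, if_neg, mul_zero]
      tauto
  · refine Finset.sum_eq_zero fun a _ => ?_
    rw [uMat, if_neg, mul_zero]
    tauto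

/-- On the pair `a`, `sw k a` the matrix of `U_k` is a block of rank one with two equal rows.
Relations therefore need to be checked on only one row of each pair. -/
theorem uMat_mul_sw {ι : Type*} (k : Fin (n - 1)) (M : Matrix (Fin n → Bool) ι F)
    (a : Fin n → Bool) (x : ι) : (uMat q Q k * M) (sw k a) x = (uMat q Q k * M) a x := by
  rw [uMat_mul_apply, uMat_mul_apply, sw_sw]
  simp only [sw_ne_iff]
  split_ifs
  · ring
  · rfl

theorem uMat_mul_eq_zero {ι : Type*} (k : Fin (n - 1)) (M : Matrix (Fin n → Bool) ι F)
    {a : Fin n → Bool} (h : a (lo k) = a (hi k)) (x : ι) : (uMat q Q k * M) a x = 0 := by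
  rw [uMat_mul_apply, if_neg (by simpa using h)]

variable {q Q}

theorem uMat_sq (h : GenericParam q Q) (k : Fin (n - 1)) :
    uMat q Q k * uMat q Q k = -((q + q⁻¹) • uMat q Q k) := by
  ext a x
  by_cases ha : a (lo k) = a (hi k)
  · rw [uMat_mul_eq_zero q Q k _ ha, Matrix.neg_apply, Matrix.smul_apply,
      ← mul_one (uMat q Q k), uMat_mul_eq_zero q Q k _ ha]
    simp
  · rw [uMat_mul_apply, if_pos ha, ← mul_one (uMat q Q k), uMat_mul_sw, ← add_mul,
      h.swCoef_add k ha, mul_one, Matrix.neg_apply, Matrix.smul_apply, smul_eq_mul, neg_mul]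

/-- Of two sequences that differ by the exchange at `i`, exactly one has different entries at the
two positions of `j`. In the triple product only the path that stays at this sequence survives, and
its two coefficients multiply to `1`; the other row is equal by `uMat_mul_sw`. -/
theorem uMat_tl (h : GenericParam q Q) (i j : Fin (n - 1))
    (hij : (i : ℕ) + 1 = j ∨ (j : ℕ) + 1 = i) :
    uMat q Q i * (uMat q Q j * uMat q Q i) = uMat q Q i := by
  have hbits : (hi i = lo j ∧ lo i ≠ lo j ∧ lo i ≠ hi j ∧ hi j ≠ lo i ∧ hi j ≠ hi i) ∨
      (lo i = hi j ∧ hi i ≠ lo j ∧ hi i ≠ hi j ∧ lo j ≠ lo i ∧ lo j ≠ hi i) := by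
    rcases hij with h1 | h1
    · left; simp only [lo, hi, Fin.ext_iff, ne_eq]; omega
    · right; simp only [lo, hi, Fin.ext_iff, ne_eq]; omega
  have key : ∀ b : Fin n → Bool, b (lo i) ≠ b (hi i) → b (lo j) ≠ b (hi j) →
      swCoef q Q i b * swCoef q Q j b = 1 := by
    intro b h1 h2
    rcases hij with h3 | h3
    · have h4 : hi i = lo j := Fin.ext h3
      have h5 := lv_lo_succ i b
      rw [h3] at h5
      rw [h4] at h1
      unfold swCoef
      rw [h5]
      cases h6 : b (lo i)
      · rw [h6] at h1
        have h7 : b (lo j) = true := by simpa using h1.symm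
        simp [h7, h.upCoef_mul_downCoef]
      · rw [h6] at h1
        have h7 : b (lo j) = false := by simpa using h1.symm
        have := h.upCoef_mul_downCoef (lv b i - 1)
        rw [sub_add_cancel] at this
        simp [h7]
        rw [mul_comm, ← sub_eq_add_neg, this]
    · have h4 : hi j = lo i := Fin.ext h3
      have h5 := lv_lo_succ j b
      rw [h3] at h5
      rw [h4] at h2
      unfold swCoef
      rw [h5]
      cases h6 : b (lo j)
      · rw [h6] at h2
        have h7 : b (lo i) = true := by simpa using h2.symm
        simp [h7]
        rw [mul_comm, h.upCoef_mul_downCoef]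
      · rw [h6] at h2
        have h7 : b (lo i) = false := by simpa using h2.symm
        have := h.upCoef_mul_downCoef (lv b j - 1)
        rw [sub_add_cancel] at this
        simp [h7]
        rw [← sub_eq_add_neg, this]
  -- the sequences `b` and `sw i b` differ in one of the bits that `j` compares
  have hdiff : ∀ b : Fin n → Bool, b (lo i) ≠ b (hi i) →
      (b (lo j) ≠ b (hi j) ↔ sw i b (lo j) = sw i b (hi j)) := by
    intro b hb
    rcases hbits with ⟨h1, -, -, h4, h5⟩ | ⟨h1, -, -, h4, h5⟩
    · rw [sw_of_ne b h4 h5, ← h1, sw_hi]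
      cases h6 : b (lo i) <;> cases h7 : b (hi i) <;> cases h8 : b (hi j) <;> simp_all
    · rw [sw_of_ne b h4 h5, ← h1, sw_lo]
      cases h6 : b (lo i) <;> cases h7 : b (hi i) <;> cases h8 : b (lo j) <;> simp_all
  have hdiff' : ∀ b : Fin n → Bool, b (lo j) ≠ b (hi j) → b (lo i) ≠ b (hi i) →
      sw j b (lo i) = sw j b (hi i) := by
    intro b hb hb'
    rcases hbits with ⟨h1, h2, h3, h4, h5⟩ | ⟨h1, h2, h3, h4, h5⟩
    · rw [sw_of_ne b h2 h3, h1, sw_lo]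
      rw [h1] at hb'
      cases h6 : b (lo i) <;> cases h7 : b (lo j) <;> cases h8 : b (hi j) <;> simp_all
    · rw [sw_of_ne b h2 h3, h1, sw_hi]
      rw [h1] at hb'
      cases h6 : b (hi i) <;> cases h7 : b (lo j) <;> cases h8 : b (hi j) <;> simp_all
  ext a x
  have hM : uMat q Q i = uMat q Q i * 1 := (mul_one _).symm
  have main : ∀ b : Fin n → Bool, b (lo i) ≠ b (hi i) → b (lo j) ≠ b (hi j) →
      (uMat q Q i * (uMat q Q j * uMat q Q i)) b x = uMat q Q i b x := by
    intro b h1 h2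
    rw [uMat_mul_apply, if_pos h1, uMat_mul_eq_zero q Q j _ ((hdiff b h1).1 h2), mul_zero, add_zero,
      uMat_mul_apply, if_pos h2]
    have h3 : uMat q Q i (sw j b) x = 0 := by
      rw [hM]; exact uMat_mul_eq_zero q Q i _ (hdiff' b h2 h1) x
    rw [h3, mul_zero, add_zero, ← mul_assoc, key b h1 h2, one_mul]
  by_cases h1 : a (lo i) = a (hi i)
  · rw [uMat_mul_eq_zero q Q i _ h1, hM, uMat_mul_eq_zero q Q i _ h1]
  by_cases h2 : a (lo j) = a (hi j)
  · have h3 := main (sw i a) (sw_ne_iff.2 h1) (by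
      rw [hdiff _ (sw_ne_iff.2 h1), sw_sw]; exact h2)
    rw [uMat_mul_sw] at h3
    rw [h3, hM, uMat_mul_sw]
  · exact main a h1 h2

theorem uMat_comm (i j : Fin (n - 1)) (hij : (i : ℕ) + 1 < j) :
    uMat q Q i * uMat q Q j = uMat q Q j * uMat q Q i := by
  have h1 : lo i ≠ lo j := by simp only [lo, Fin.ext_iff, ne_eq]; omega
  have h2 : lo i ≠ hi j := by simp only [lo, hi, Fin.ext_iff, ne_eq]; omega
  have h3 : hi i ≠ lo j := by simp only [lo, hi, Fin.ext_iff, ne_eq]; omega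
  have h4 : hi i ≠ hi j := by simp only [hi, Fin.ext_iff, ne_eq]; omega
  have hc : ∀ a : Fin n → Bool, sw i (sw j a) = sw j (sw i a) := by
    intro a
    ext x
    by_cases e1 : x = lo i
    · subst e1; rw [sw_lo, sw_of_ne _ h1 h2, sw_of_ne _ h3 h4, sw_lo]
    by_cases e2 : x = hi i
    · subst e2; rw [sw_hi, sw_of_ne _ h1 h2, sw_of_ne _ h3 h4, sw_hi]
    rw [sw_of_ne _ e1 e2]
    by_cases e3 : x = lo j
    · subst e3; rw [sw_lo, sw_lo, sw_of_ne _ h2.symm h4.symm]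
    by_cases e4 : x = hi j
    · subst e4; rw [sw_hi, sw_hi, sw_of_ne _ h1.symm h3.symm]
    rw [sw_of_ne _ e3 e4, sw_of_ne _ e3 e4, sw_of_ne _ e1 e2]
  have hci : ∀ a : Fin n → Bool, swCoef q Q i (sw j a) = swCoef q Q i a := by
    intro a
    rw [swCoef, swCoef, lv_sw j a (by omega), sw_of_ne _ h1 h2]
  have hcj : ∀ a : Fin n → Bool, swCoef q Q j (sw i a) = swCoef q Q j a := by
    intro a
    rw [swCoef, swCoef, lv_sw i a (by omega), sw_of_ne _ h1.symm h3.symm]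
  have hcj' : ∀ a : Fin n → Bool, swCoef q Q j (sw j (sw i a)) = swCoef q Q j (sw j a) := by
    intro a
    rw [← hc, hcj]
  ext a x
  suffices key : ∀ M : Matrix (Fin n → Bool) (Fin n → Bool) F,
      (uMat q Q i * (uMat q Q j * M)) a x = (uMat q Q j * (uMat q Q i * M)) a x by
    simpa using key 1
  intro M
  simp only [uMat_mul_apply, hci, hcj, hcj', hc, sw_of_ne _ h1 h2, sw_of_ne _ h3 h4,
    sw_of_ne _ h1.symm h3.symm, sw_of_ne _ h2.symm h4.symm]
  split_ifs <;> ring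

variable [NeZero n]

/-- The eigenvalue of `e` on the sequence `w`. -/
def eEig (F : Type*) [Field F] (w : Fin n → Bool) : F := if w 0 then 1 else 0

/-- The matrices of the generators in the seminormal representation. -/
noncomputable def genMat (q Q : F) : BlobGen n → Matrix (Fin n → Bool) (Fin n → Bool) F
  | .e => Matrix.diagonal (eEig F)
  | .U k => uMat q Q k

theorem genMat_rel (h : GenericParam q Q) ⦃x y : FreeAlgebra F (BlobGen n)⦄
    (hr : BlobRel F n q Q x y) :
    FreeAlgebra.lift F (genMat q Q) x = FreeAlgebra.lift F (genMat q Q) y := by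
  induction hr with
  | U_sq i =>
    simpa [genMat, gaussTwo, Ring.inverse_eq_inv'] using uMat_sq h i
  | U_U_U i j hij =>
    simpa [genMat, mul_assoc] using uMat_tl h i j hij
  | U_comm i j hij =>
    rcases hij with hij | hij
    · simpa [genMat] using uMat_comm i j hij
    · simpa [genMat] using (uMat_comm j i hij).symm
  -- Only the sequence of the pair that begins with a step down is seen by `e`. Its coefficient is
  -- `downCoef` at level `0`, which is `y_e`.
  | U_e_U i hi0 =>
    simp only [map_mul, map_smul, FreeAlgebra.lift_ι_apply, genMat]
    have h0 : lo i = 0 := by ext; simp [lo, hi0]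
    ext a x
    rw [mul_assoc]
    by_cases ha : a (lo i) = a (hi i)
    · rw [uMat_mul_eq_zero q Q i _ ha, Matrix.smul_apply, ← mul_one (uMat q Q i),
        uMat_mul_eq_zero q Q i _ ha, smul_zero]
    · have h2 : uMat q Q i (sw i a) x = uMat q Q i a x := by
        rw [← mul_one (uMat q Q i), uMat_mul_sw]
      rw [uMat_mul_apply, if_pos ha, Matrix.diagonal_mul, Matrix.diagonal_mul, h2]
      simp only [eEig, swCoef, ← h0, sw_lo,
        Matrix.smul_apply, smul_eq_mul, hi0, lv_zero, h.downCoef_zero]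
      cases h3 : a (lo i) <;> cases h4 : a (hi i) <;> simp_all
  | e_sq =>
    simp only [map_mul, FreeAlgebra.lift_ι_apply, genMat, Matrix.diagonal_mul_diagonal]
    congr 1
    ext w
    simp [eEig]
  | U_e_comm i hi0 =>
    simp only [map_mul, FreeAlgebra.lift_ι_apply, genMat]
    ext a x
    have h1 : (0 : Fin n) ≠ lo i := by
      intro h; have := congrArg Fin.val h; simp [lo] at this; omega
    have h2 : (0 : Fin n) ≠ hi i := by
      intro h; have := congrArg Fin.val h; simp [hi] at this
    rw [Matrix.diagonal_mul, Matrix.mul_diagonal]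
    by_cases ha : x (lo i) ≠ x (hi i) ∧ (a = x ∨ a = sw i x)
    · have h3 : a 0 = x 0 := by
        rcases ha.2 with h | h
        · rw [h]
        · rw [h, sw_of_ne _ h1 h2]
      rw [eEig, eEig, h3, mul_comm]
    · rw [uMat, if_neg ha]; simp

/-- The seminormal representation. -/
noncomputable def seminormalRep (h : GenericParam q Q) :
    Blob F n q Q →ₐ[F] Matrix (Fin n → Bool) (Fin n → Bool) F :=
  RingQuot.liftAlgHom F ⟨FreeAlgebra.lift F (genMat q Q), genMat_rel h⟩

theorem seminormalRep_gen (h : GenericParam q Q) (g : BlobGen n) :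
    seminormalRep h (Blob.gen q Q g) = genMat q Q g := by
  simp [seminormalRep, Blob.gen]

end SeminormalRep

end

section

open SignSeq

/-! ### Jucys-Murphy elements in the seminormal representation -/

section Diagonal
variable {F : Type*} [Field F] {n : ℕ}

/-- The content at `k` of the bitableau with sign sequence `w`. -/
noncomputable def cont (q Q : F) (w : Fin n → Bool) (k : Fin n) : F :=
  if w k then q ^ (2 * cnt true w k) * Q⁻¹ else q ^ (2 * cnt false w k) * Q

theorem content_eq_cont (q Q : F) (t : StdAll n) (k : Fin n) :
    content q Q t k = cont q Q (signs t.2) k := content_eq q Q t k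

variable {q Q : F}

/-- With equal prefixes, an equality of contents in different rows would read `q^(2j) Q² = 1`, which
is excluded. Step by step, the contents thus determine the whole sequence. -/
theorem GenericParam.cont_eq (h : GenericParam q Q) {w w' : Fin n → Bool} {k : Fin n}
    (hk : ∀ j : Fin n, j < k → w j = w' j) (he : cont q Q w k = cont q Q w' k) : w k = w' k := by
  have key : ∀ a b : ℕ, q ^ (2 * a) * Q ≠ q ^ (2 * b) * Q⁻¹ := by
    intro a b hab
    apply h.ne (a - b)
    have h1 := h.q_ne
    have h2 := h.Q_ne
    rw [mul_sub, zpow_sub₀ h1, div_mul_eq_mul_div, div_eq_one_iff_eq (zpow_ne_zero _ h1)]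
    norm_cast
    rw [sq, ← mul_assoc, hab, mul_assoc, inv_mul_cancel₀ h2, mul_one]
  unfold cont at he
  rw [cnt_congr (b := true) hk, cnt_congr (b := false) hk] at he
  cases h1 : w k <;> cases h2 : w' k <;> simp only [h1, h2, if_true] at he
  · rfl
  · exact absurd he (key _ _)
  · exact absurd he.symm (key _ _)
  · rfl

theorem GenericParam.eq_of_cont (h : GenericParam q Q) {w w' : Fin n → Bool}
    (he : ∀ k, cont q Q w k = cont q Q w' k) : w = w' := by
  ext k
  induction k using WellFoundedLT.induction with
  | _ k ih => rw [h.cont_eq ih (he k)]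

theorem cont_hi_of_eq {w : Fin n → Bool} {k : Fin (n - 1)} (hw : w (lo k) = w (hi k)) :
    cont q Q w (hi k) = q ^ 2 * cont q Q w (lo k) := by
  have h1 := cnt_succ true w (lo k)
  have h2 := cnt_succ false w (lo k)
  unfold cont
  rw [← hw, show ((hi k : Fin n) : ℕ) = (lo k : Fin n) + 1 from rfl, h1, h2]
  cases w (lo k) <;> simp <;> ring

theorem cont_hi_of_ne {w : Fin n → Bool} {k : Fin (n - 1)} (hw : w (lo k) ≠ w (hi k)) :
    cont q Q w (hi k) = cont q Q (sw k w) (lo k) := by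
  have h1 := cnt_succ true w (lo k)
  have h2 := cnt_succ false w (lo k)
  unfold cont
  rw [sw_lo, show ((hi k : Fin n) : ℕ) = (lo k : Fin n) + 1 from rfl, h1, h2,
    cnt_sw true k w (by simp [lo]), cnt_sw false k w (by simp [lo])]
  cases h3 : w (lo k) <;> cases h4 : w (hi k) <;> simp_all

/-- This is the vanishing of the off-diagonal entries of `(U_k + q) L_k (U_k + q)`, up to a non-zero
coefficient. -/
theorem GenericParam.cont_add (h : GenericParam q Q) {w : Fin n → Bool} {k : Fin (n - 1)}
    (hw : w (lo k) ≠ w (hi k)) : cont q Q w (lo k) * (swCoef q Q k w + q) +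
      cont q Q (sw k w) (lo k) * (swCoef q Q k (sw k w) + q) = 0 := by
  have key : ∀ a b : ℕ, q ^ (2 * a) * Q * (upCoef q Q (a - b) + q) +
      q ^ (2 * b) * Q⁻¹ * (downCoef q Q (a - b) + q) = 0 := by
    intro a b
    have h1 := h.sub_ne (a - b)
    have h2 := h.sub_ne' (a - b)
    have h3 := h.q_ne
    have h4 := h.Q_ne
    have h5 : q ^ (2 * a) * Q = q ^ (2 * b) * Q⁻¹ * (q ^ (2 * ((a : ℤ) - b)) * Q ^ 2) := by
      rw [mul_sub, zpow_sub₀ h3]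
      norm_cast
      have := pow_ne_zero (2 * b) h3
      field_simp
    unfold upCoef downCoef
    rw [h5]
    generalize q ^ (2 * ((a : ℤ) - b)) * Q ^ 2 = r at *
    have e1 : (q * r - q⁻¹) / (1 - r) + q = (q - q⁻¹) / (1 - r) := by
      rw [div_add' _ _ _ h2]; congr 1; ring
    have e2 : (q - q⁻¹ * r) / (r - 1) + q = -(r * (q - q⁻¹) / (1 - r)) := by
      rw [div_add' _ _ _ h1, ← div_neg, neg_sub]; congr 1; ring
    rw [e1, e2]
    ring
  unfold cont swCoef
  rw [lv_sw k w (by omega), sw_lo, cnt_sw true k w (by simp [lo]), cnt_sw false k w (by simp [lo])]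
  have h1 := key (cnt false w k) (cnt true w k)
  have h2 : ((cnt false w k : ℤ) - cnt true w k) = lv w k := rfl
  rw [h2] at h1
  cases h3 : w (lo k) <;> cases h4 : w (hi k) <;> simp_all
  · exact h1
  · rw [add_comm]; exact h1

variable [NeZero n]

/-- Induction along the recursion for `L_k`. Where the entries at `k` agree, `U_k` acts by zero and
the eigenvalue is multiplied by `q²`, the next content in the same row. On a pair exchanged by `sw`
the `2 × 2` block is diagonal by `cont_add`, and with the sum of the two coefficients its entries
are the contents of the exchanged sequence. -/
theorem seminormalRep_jm (h : GenericParam q Q) (k : Fin n) :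
    seminormalRep h (jm q Q k) = Matrix.diagonal fun w => cont q Q w k := by
  obtain ⟨k, hk⟩ := k
  unfold jm
  induction k with
  | zero =>
    have h1 := h.q_ne
    have h2 : q - q⁻¹ ≠ 0 := by
      intro h0
      apply h.sq_ne
      rw [sub_eq_zero] at h0
      rw [sq]
      nth_rewrite 2 [h0]
      exact mul_inv_cancel₀ h1
    simp only [jmAux, blobUzero, map_add, map_smul, map_neg, seminormalRep_gen, genMat,
      AlgHom.commutes]
    ext a b
    by_cases hab : a = b
    · subst hab
      have h0 : (⟨0, hk⟩ : Fin n) = 0 := rfl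
      simp only [Matrix.add_apply, Matrix.smul_apply, Matrix.neg_apply, Matrix.diagonal_apply_eq,
        Matrix.algebraMap_matrix_apply, if_true, smul_eq_mul, eEig, cont, cnt_zero, h0]
      cases a 0
      · simp
      · simp only [if_true, mul_one, mul_zero, pow_zero, one_mul, Algebra.algebraMap_self,
          RingHom.id_apply]
        rw [mul_neg, mul_div_cancel₀ _ h2]
        ring
    · simp [hab, Matrix.algebraMap_matrix_apply]
  | succ k ih =>
    have hk' : k < n - 1 := by omega
    rw [jmAux, dif_pos hk', map_mul, map_mul, ih (by omega), map_add, seminormalRep_gen,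
      AlgHom.commutes, genMat]
    set κ : Fin (n - 1) := ⟨k, hk'⟩
    have e1 : (⟨k, by omega⟩ : Fin n) = lo κ := rfl
    have e2 : (⟨k + 1, hk⟩ : Fin n) = hi κ := rfl
    rw [e1, e2]
    have hM : uMat q Q κ = uMat q Q κ * 1 := (mul_one _).symm
    ext a x
    have hN : ∀ b, ((Matrix.diagonal fun w => cont q Q w (lo κ)) *
        (uMat q Q κ + algebraMap F (Matrix (Fin n → Bool) (Fin n → Bool) F) q)) b x =
        cont q Q b (lo κ) * (uMat q Q κ b x + if b = x then q else 0) := by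
      intro b
      rw [Matrix.diagonal_mul, Matrix.add_apply, Matrix.algebraMap_matrix_apply]
      rfl
    rw [mul_assoc, add_mul, Matrix.add_apply, uMat_mul_apply, ← Algebra.smul_def,
      Matrix.smul_apply, hN, hN, smul_eq_mul]
    by_cases ha : a (lo κ) = a (hi κ)
    · rw [if_neg (by simpa using ha), hM, uMat_mul_eq_zero q Q κ _ ha, Matrix.diagonal_apply,
        cont_hi_of_eq ha]
      split_ifs <;> ring
    · have hs := sw_ne_self ha
      have hu : ∀ b c, b (lo κ) ≠ b (hi κ) → (c = b ∨ c = sw κ b) →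
          uMat q Q κ c b = swCoef q Q κ b := fun b c h1 h2 => if_pos ⟨h1, h2⟩
      have h3 := h.cont_add ha
      have h4 := h.swCoef_add κ ha
      rw [if_pos ha, Matrix.diagonal_apply, cont_hi_of_ne ha]
      by_cases hx : a = x
      · subst hx
        rw [hu a a ha (Or.inl rfl), hu a (sw κ a) ha (Or.inr rfl), if_pos rfl, if_neg hs, if_pos rfl]
        have h5 : q * q⁻¹ = 1 := mul_inv_cancel₀ h.q_ne
        linear_combination (swCoef q Q κ a + q) * h3 - q * cont q Q (sw κ a) (lo κ) * h4 +
          cont q Q (sw κ a) (lo κ) * h5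
      by_cases hx' : sw κ a = x
      · subst hx'
        have ha' := sw_ne_iff.2 ha
        rw [hu _ a ha' (Or.inr (sw_sw κ a).symm), hu _ _ ha' (Or.inl rfl), if_neg hx, if_pos rfl,
          if_neg hx]
        linear_combination swCoef q Q κ (sw κ a) * h3
      · have hz : ∀ b, (b = a ∨ b = sw κ a) → uMat q Q κ b x = 0 := by
          rintro b hb
          refine if_neg ?_
          rintro ⟨-, h1⟩
          rw [sw_eq_iff] at h1
          rcases hb with rfl | rfl
          · exact h1.elim hx fun h1 => hx' h1.symm
          · rw [sw_sw] at h1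
            exact h1.elim hx' fun h1 => hx h1.symm
        rw [hz a (Or.inl rfl), hz _ (Or.inr rfl), if_neg hx, if_neg hx']
        simp [hx]

end Diagonal

end

section

open SignSeq

/-! ### Triangularity of the diagram basis in the seminormal representation -/

section Triangular
variable {F : Type*} [Field F] {n : ℕ} {q Q : F}

theorem wordU_cons (k : Fin (n - 1)) (ks : List (Fin (n - 1))) :
    (wordU q Q (k :: ks) : Blob F n q Q) = Blob.gen q Q (.U k) * wordU q Q ks := by simp [wordU]

theorem wordU_reverse_cons (k : Fin (n - 1)) (ks : List (Fin (n - 1))) :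
    (wordU q Q (k :: ks).reverse : Blob F n q Q) =
      wordU q Q ks.reverse * Blob.gen q Q (.U k) := by simp [wordU]

/-- The sequence `w` alternates on the first `2 h` positions. -/
def Alternates (h : ℕ) (w : Fin n → Bool) : Prop :=
  ∀ j : Fin n, (j : ℕ) < 2 * h → w j = decide ((j : ℕ) % 2 = 0)

theorem Alternates.lv_eq {h : ℕ} {w : Fin n → Bool} (hw : Alternates h w) {k : ℕ} (hk : k ≤ n)
    (hkh : k ≤ 2 * h) : lv w k = -((k % 2 : ℕ) : ℤ) := by
  rw [lv_congr (w' := zigzag n h false), lv_zigzag h false hk, if_pos hkh]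
  intro j hj
  rw [hw j (by omega), zigzag, if_pos (by omega)]

variable [NeZero n]

theorem seminormalRep_wordU_lv (h : GenericParam q Q) (ks : List (Fin (n - 1)))
    {a b : Fin n → Bool} (hne : seminormalRep h (wordU q Q ks) a b ≠ 0) : lv a n = lv b n := by
  induction ks generalizing a with
  | nil =>
    by_contra hab
    have : a ≠ b := fun e => hab (by rw [e])
    apply hne
    simp [wordU, this]
  | cons k ks ih =>
    rw [wordU_cons, map_mul, seminormalRep_gen, genMat, uMat_mul_apply] at hne
    split_ifs at hne with hk
    · by_cases h1 : seminormalRep h (wordU q Q ks) a b = 0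
      · rw [h1, mul_zero, zero_add] at hne
        rw [← ih (right_ne_zero_of_mul hne), lv_sw_n]
      · exact ih h1
    · exact absurd rfl hne

/-- The entries of a word in the column of the sequence that its boxes start from. -/
theorem SignSeq.BoxChain.seminormalRep_col (h : GenericParam q Q) {T w : Fin n → Bool}
    {ks : List (Fin (n - 1))} {z : ℕ} (hc : BoxChain T w ks z) :
    (∀ a, seminormalRep h (wordU q Q ks) a T ≠ 0 → boxes a < boxes w ∨ a = w) ∧
      seminormalRep h (wordU q Q ks) w T ≠ 0 := by
  induction hc with
  | base =>
    refine ⟨fun a ha => Or.inr ?_, by simp [wordU]⟩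
    by_contra hne
    exact ha (by simp [wordU, hne])
  | step w ks z k hc hA ih =>
    have hb := hA.boxes_sw
    constructor
    · intro a ha
      rw [wordU_cons, map_mul, seminormalRep_gen, genMat, uMat_mul_apply] at ha
      split_ifs at ha with hk
      · by_cases h1 : seminormalRep h (wordU q Q ks) a T = 0
        · rw [h1, mul_zero, zero_add] at ha
          rcases ih.1 _ (right_ne_zero_of_mul ha) with h2 | h2
          · left
            have := boxes_sw_le (w := sw k a) k
            rw [sw_sw] at this
            omega
          · right; rw [← h2, sw_sw]
        · rcases ih.1 _ h1 with h2 | h2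
          · left; omega
          · left; rw [h2]; omega
      · exact absurd rfl ha
    · rw [wordU_cons, map_mul, seminormalRep_gen, genMat, uMat_mul_apply, sw_sw,
        if_pos (sw_ne_iff.2 hA.ne)]
      have h1 : seminormalRep h (wordU q Q ks) (sw k w) T = 0 := by
        by_contra hne
        rcases ih.1 _ hne with h2 | h2
        · omega
        · exact sw_ne_self hA.ne h2
      rw [h1, mul_zero, zero_add]
      exact mul_ne_zero (h.swCoef_ne k w) ih.2

/-- The entries of a reversed word in the row of the sequence that its boxes start from. -/
theorem SignSeq.BoxChain.seminormalRep_row (h : GenericParam q Q) {T w : Fin n → Bool}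
    {ks : List (Fin (n - 1))} {z : ℕ} (hc : BoxChain T w ks z) :
    (∀ a, seminormalRep h (wordU q Q ks.reverse) T a ≠ 0 → boxes a < boxes w ∨ a = w) ∧
      seminormalRep h (wordU q Q ks.reverse) T w ≠ 0 := by
  induction hc with
  | base =>
    refine ⟨fun a ha => Or.inr ?_, by simp [wordU]⟩
    by_contra hne
    exact ha (by simp [wordU, Ne.symm hne])
  | step w ks z k hc hA ih =>
    have hb := hA.boxes_sw
    constructor
    · intro a ha
      rw [wordU_reverse_cons, map_mul, seminormalRep_gen, genMat, mul_uMat_apply] at ha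
      split_ifs at ha with hk
      · by_cases h1 : seminormalRep h (wordU q Q ks.reverse) T a = 0
        · rw [h1, zero_add] at ha
          rcases ih.1 _ (right_ne_zero_of_mul ha) with h2 | h2
          · left
            have := boxes_sw_le (w := sw k a) k
            rw [sw_sw] at this
            omega
          · right; rw [← h2, sw_sw]
        · rcases ih.1 _ h1 with h2 | h2
          · left; omega
          · left; rw [h2]; omega
      · exact absurd rfl ha
    · rw [wordU_reverse_cons, map_mul, seminormalRep_gen, genMat, mul_uMat_apply, sw_sw,
        if_pos (sw_ne_iff.2 hA.ne)]
      have h1 : seminormalRep h (wordU q Q ks.reverse) T (sw k w) = 0 := by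
        by_contra hne
        rcases ih.1 _ hne with h2 | h2
        · omega
        · exact sw_ne_self hA.ne h2
      rw [h1, zero_add]
      exact mul_ne_zero (h.swCoef_ne k _) ih.2

/-! ### The words of the maximal sequences -/

theorem seminormalRep_genSeq (h : GenericParam q Q) (k : ℕ) (hk : k < n - 1) :
    seminormalRep h (Blob.genSeq q Q (k + 1)) = uMat q Q ⟨k, hk⟩ := by
  rw [Blob.genSeq, if_neg (by omega), dif_pos (by simpa using hk), seminormalRep_gen]
  rfl

/-- Only columns that begin with `h` alternations are computed, since `cWord` kills the others. On
these `pWord` is the projection to the sequences with a step down at `2 h`: all paths through an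
exchanged sequence vanish. -/
theorem seminormalRep_pWord (hg : GenericParam q Q) (h : ℕ) (hh : 2 * h < n) {w : Fin n → Bool}
    (hw : Alternates h w) (x : Fin n → Bool) :
    seminormalRep hg (pWord q Q h) x w = if w ⟨2 * h, hh⟩ ∧ x = w then 1 else 0 := by
  induction h generalizing w with
  | zero =>
    rw [pWord, seminormalRep_gen, genMat, Matrix.diagonal_apply]
    by_cases hx : x = w
    · subst hx
      simp only [eEig, and_true, if_true]
      rfl
    · simp [hx]
  | succ h ih =>
    have h1 : 2 * h < n - 1 := by omega
    have h2 : 2 * h + 1 < n - 1 := by omega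
    have hw' : Alternates h w := fun j hj => hw j (by omega)
    set κ : Fin (n - 1) := ⟨2 * h, h1⟩
    set κ' : Fin (n - 1) := ⟨2 * h + 1, h2⟩
    have e0 : w (lo κ) = true := (hw (lo κ) (by simp [lo, κ])).trans (by simp [lo, κ])
    have e1 : w (hi κ) = false := (hw (hi κ) (by simp [hi, κ]; omega)).trans (by simp [hi, κ])
    have e1' : w (lo κ') = false := e1
    have l0 : lv w (κ : ℕ) = 0 := by
      rw [hw.lv_eq (by simp [κ]; omega) (by simp [κ])]; simp [κ]
    have l1 : lv w (κ' : ℕ) = -1 := by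
      rw [hw.lv_eq (by simp [κ']; omega) (by simp [κ'])]; simp [κ']
    rw [pWord, map_mul, map_mul, seminormalRep_genSeq hg _ h1, seminormalRep_genSeq hg _ h2,
      ← mul_assoc, mul_uMat_apply]
    have hlast : (⟨2 * (h + 1), hh⟩ : Fin n) = hi κ' := rfl
    rw [hlast, e1']
    cases e2 : w (hi κ')
    · simp
    have c1 : (seminormalRep hg (pWord q Q h) * uMat q Q κ : Matrix _ _ F) x (sw κ' w) = 0 := by
      rw [mul_uMat_apply, if_neg]
      have h3 : sw κ' w (lo κ) = w (lo κ) := sw_of_ne w (by simp [lo, κ, κ'])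
        (by simp [lo, hi, κ, κ']; omega)
      have h4 : sw κ' w (hi κ) = w (hi κ') := sw_lo κ' w
      rw [h3, h4, e0, e2]; simp
    have hsw : Alternates h (sw κ w) := by
      intro j hj
      rw [sw_of_ne w, hw' j hj]
      · rintro rfl; simp [lo, κ] at hj
      · rintro rfl; simp [hi, κ] at hj
    have c2 : seminormalRep hg (pWord q Q h) x (sw κ w) = 0 := by
      rw [ih (by omega) hsw, if_neg]
      have h3 : sw κ w ⟨2 * h, by omega⟩ = w (hi κ) := sw_lo κ w
      rw [h3, e1]; simp
    have c3 : w ⟨2 * h, by omega⟩ = true := e0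
    rw [if_pos (by simp), c1, add_zero, mul_uMat_apply, if_pos (by rw [e0, e1]; simp), c2, add_zero,
      ih (by omega) hw', c3, swCoef, swCoef, e0, e1', l0, l1, ← mul_assoc]
    -- The surviving path meets a step down from `0` and a step up from `-1`, whose coefficients
    -- cancel.
    have := hg.upCoef_mul_downCoef (-1)
    rw [neg_add_cancel] at this
    simp [this]

-- The factors `pWord` on both sides of `U` keep only the sequences with a step down at `2 h`. Of
-- the block of `U` this leaves one diagonal entry, `downCoef` at level `0`, so each further
-- alternation contributes a factor `y_e`.
open Classical in
theorem seminormalRep_cWord (hg : GenericParam q Q) (h : ℕ) (hh : 2 * h ≤ n) :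
    seminormalRep hg (cWord q Q h : Blob F n q Q) =
      Matrix.diagonal fun w => if Alternates h w then blobParam q Q ^ h else 0 := by
  induction h with
  | zero =>
    have : ∀ w : Fin n → Bool, Alternates 0 w := fun w j hj => absurd hj (by omega)
    simp [cWord, this]
  | succ h ih =>
    have h1 : 2 * h < n - 1 := by omega
    set κ : Fin (n - 1) := ⟨2 * h, h1⟩
    rw [cWord, map_mul, map_mul, map_mul, ih (by omega), seminormalRep_genSeq hg _ h1,
      ← mul_assoc, ← mul_assoc]
    ext x w
    have hdiag : ∀ d : (Fin n → Bool) → F,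
        Matrix.diagonal d x w = if x = w then d w else 0 := by
      intro d
      rw [Matrix.diagonal_apply]
      split_ifs with e
      · rw [e]
      · rfl
    rw [Matrix.mul_diagonal, hdiag]
    by_cases hw : Alternates h w
    · have l0 : lv w (κ : ℕ) = 0 := by
        rw [hw.lv_eq (by simp [κ]; omega) (by simp [κ])]; simp [κ]
      have hiff : Alternates (h + 1) w ↔ w (lo κ) = true ∧ w (hi κ) = false := by
        constructor
        · intro hw'
          exact ⟨(hw' (lo κ) (by simp [lo, κ])).trans (by simp [lo, κ]),
            (hw' (hi κ) (by simp [hi, κ]; omega)).trans (by simp [hi, κ])⟩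
        · rintro ⟨h2, h3⟩ j hj
          by_cases hj1 : (j : ℕ) < 2 * h
          · exact hw j hj1
          by_cases hj2 : (j : ℕ) = 2 * h
          · obtain rfl : j = lo κ := Fin.ext hj2
            rw [h2]; simp [lo, κ]
          · obtain rfl : j = hi κ := Fin.ext (by simp [hi, κ]; omega)
            rw [h3]; simp [hi, κ]
      have hP : ∀ (M : Matrix (Fin n → Bool) (Fin n → Bool) F),
          (M * seminormalRep hg (pWord q Q h) : Matrix _ _ F) x w = if w (lo κ) then M x w else 0 := by
        intro M
        have hlo : (⟨2 * h, by omega⟩ : Fin n) = lo κ := rfl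
        rw [Matrix.mul_apply, Finset.sum_eq_single w]
        · rw [seminormalRep_pWord hg h (by omega) hw, hlo]; simp
        · intro b _ hb
          rw [seminormalRep_pWord hg h (by omega) hw, if_neg (by tauto), mul_zero]
        · simp
      have hsw : Alternates h (sw κ w) := by
        intro j hj
        rw [sw_of_ne w, hw j hj]
        · rintro rfl; simp [lo, κ] at hj
        · rintro rfl; simp [hi, κ] at hj
      have h3 : sw κ w ⟨2 * h, by omega⟩ = w (hi κ) := sw_lo κ w
      have hlo : w (⟨2 * h, by omega⟩ : Fin n) = w (lo κ) := rfl
      rw [hP, mul_uMat_apply, seminormalRep_pWord hg h (by omega) hw,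
        seminormalRep_pWord hg h (by omega) hsw, if_pos hw, hiff, swCoef, l0, hg.downCoef_zero, h3,
        hlo, pow_succ']
      cases e0 : w (lo κ)
      · simp
      cases e1 : w (hi κ)
      · by_cases hx : x = w <;> simp [hx, κ]
      · simp
    · have hw' : ¬ Alternates (h + 1) w := fun h' => hw fun j hj => h' j (by omega)
      rw [if_neg hw, mul_zero]
      rw [if_neg hw', ite_self]

/-- The sequence `w` starts as the maximal sequence with `h` alternations that continues with steps
down if `b` holds. -/
def StartsWith (h : ℕ) (b : Bool) (w : Fin n → Bool) : Prop :=
  Alternates h w ∧ (b = true → ∀ j : Fin n, (j : ℕ) = 2 * h → w j = true)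

open Classical in
theorem seminormalRep_topWord (hg : GenericParam q Q) (h : ℕ) (hh : 2 * h ≤ n) (b : Bool)
    (hb : b = true → 2 * h < n) : seminormalRep hg (topWord q Q h b : Blob F n q Q) =
      Matrix.diagonal fun w => if StartsWith h b w then blobParam q Q ^ h else 0 := by
  cases b
  · simp [topWord, seminormalRep_cWord hg h hh, StartsWith]
  · have hh' := hb rfl
    rw [topWord, if_pos rfl, map_mul, seminormalRep_cWord hg h hh]
    ext x w
    rw [Matrix.mul_diagonal, Matrix.diagonal_apply]
    have hlast : (∀ j : Fin n, (j : ℕ) = 2 * h → w j = true) ↔ w ⟨2 * h, hh'⟩ = true :=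
      ⟨fun H => H _ rfl, fun H j hj => by rwa [show j = ⟨2 * h, hh'⟩ from Fin.ext hj]⟩
    by_cases hx : x = w
    · subst hx
      rw [if_pos rfl]
      by_cases hw : Alternates h x
      · rw [seminormalRep_pWord hg h hh' hw, if_pos hw]
        simp [StartsWith, hw, hlast]
      · simp [StartsWith, hw]
    · by_cases hw : Alternates h w
      · rw [seminormalRep_pWord hg h hh' hw]; simp [hx]
      · simp [hx, hw]

end Triangular

/-! ### Ends of sequences that start like a maximal one. -/

namespace SignSeq
variable {n : ℕ}

theorem startsWith_top (v : ℤ) : StartsWith (arcs n v) (decide (v < 0)) (SignSeq.top n v) := by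
  constructor
  · intro j hj
    rw [SignSeq.top, ← arcs, zigzag, if_pos hj]
  · intro hb j hj
    rw [SignSeq.top, ← arcs, zigzag, if_neg (by omega), hb]

theorem abs_lv_sub_le (w : Fin n → Bool) {j k : ℕ} (hjk : j ≤ k) (hkn : k ≤ n) :
    |lv w k - lv w j| ≤ k - j := by
  induction k, hjk using Nat.le_induction with
  | base => simp
  | succ k hk ih =>
    have h1 := lv_succ w ⟨k, hkn⟩
    simp only at h1
    have h2 := ih (by omega)
    rw [abs_le] at h2 ⊢
    push_cast
    rw [h1]
    split_ifs <;> constructor <;> linarith [h2.1, h2.2]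

theorem StartsWith.eq_top {u w : Fin n → Bool}
    (hw : StartsWith (arcs n (lv u n)) (decide (lv u n < 0)) w) (he : lv w n = lv u n) :
    w = SignSeq.top n (lv u n) := by
  have hh : 2 * arcs n (lv u n) + (lv u n).natAbs = n := lv_half u
  refine eq_of_lv fun k hk => ?_
  rw [SignSeq.top, ← arcs, lv_zigzag _ _ hk]
  split_ifs with h1 h2
  · exact hw.1.lv_eq hk h1
  all_goals
    have h3 := hw.1.lv_eq (two_mul_arcs_le n _) le_rfl
    have h4 := abs_lv_sub_le w (show 2 * arcs n (lv u n) ≤ k by omega) hk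
    have h5 := abs_lv_sub_le w hk le_rfl
    rw [h3, abs_le] at h4
    rw [he, abs_le] at h5
    simp at h2
    push_cast at *
    omega

/-- After the alternations only `|lv u n|` steps remain, so the end cannot be farther out. If `lv u
n` is negative, the prescribed step down also excludes the end of opposite sign, which would have
larger rank. -/
theorem StartsWith.rk_le {u w : Fin n → Bool}
    (hw : StartsWith (arcs n (lv u n)) (decide (lv u n < 0)) w) : rk (lv w n) ≤ rk (lv u n) := by
  have hh : 2 * arcs n (lv u n) + (lv u n).natAbs = n := lv_half u
  have h3 := hw.1.lv_eq (two_mul_arcs_le n _) le_rfl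
  by_cases hv : lv u n < 0
  · have hlt := two_mul_arcs_lt u (by simpa using hv)
    have h4 := lv_succ w ⟨2 * arcs n (lv u n), hlt⟩
    rw [hw.2 (by simpa using hv) _ rfl] at h4
    have h5 := abs_lv_sub_le w (show 2 * arcs n (lv u n) + 1 ≤ n by omega) le_rfl
    simp only [h3] at h4
    rw [h4, abs_le] at h5
    unfold rk
    simp at h5
    omega
  · have h5 := abs_lv_sub_le w (two_mul_arcs_le n (lv u n)) le_rfl
    rw [h3, abs_le] at h5
    unfold rk
    push_cast at h5
    omega

end SignSeq

end

section

open SignSeq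

/-! ### Triangularity of the diagram basis and faithfulness of the seminormal representation. -/

section PairTriangular
variable {F : Type*} [Field F] {n : ℕ} [NeZero n] {q Q : F}

open Classical in
theorem seminormalRep_pairElt (h : GenericParam q Q) (p : SignPair n) (a b : Fin n → Bool) :
    seminormalRep h (pairElt q Q p) a b =
      (blobParam q Q)⁻¹ ^ (chainZero p.1.1 + chainZero p.1.2) *
        ∑ z, seminormalRep h (wordU q Q (chain p.1.1)) a z *
          ((if StartsWith (arcs n (lv p.1.1 n)) (decide (lv p.1.1 n < 0)) z then
            blobParam q Q ^ arcs n (lv p.1.1 n) else 0) *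
          seminormalRep h (wordU q Q (chain p.1.2).reverse) z b) := by
  rw [pairElt, map_smul, map_mul, map_mul,
    seminormalRep_topWord h _ (two_mul_arcs_le n _) _ (two_mul_arcs_lt _), Matrix.smul_apply,
    smul_eq_mul, Ring.inverse_eq_inv', Matrix.mul_apply]
  simp only [Matrix.diagonal_mul]

/-- A non-zero entry comes from a sequence `z` on which `topWord` does not vanish, and box moves
preserve the end of a sequence; hence the bound for the rank. In the block of the pair itself `z`
must be the maximal sequence, and the box chains then bound the number of boxes on both sides. -/
theorem rk_le_of_seminormalRep_pairElt_ne (h : GenericParam q Q) (p : SignPair n)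
    {a b : Fin n → Bool} (hne : seminormalRep h (pairElt q Q p) a b ≠ 0) :
    rk (lv a n) ≤ rk (lv p.1.1 n) ∧ (rk (lv a n) = rk (lv p.1.1 n) →
      boxes a + boxes b < boxes p.1.1 + boxes p.1.2 ∨ (a = p.1.1 ∧ b = p.1.2)) := by
  rw [seminormalRep_pairElt] at hne
  obtain ⟨z, -, hz⟩ := Finset.exists_ne_zero_of_sum_ne_zero (right_ne_zero_of_mul hne)
  have h1 := left_ne_zero_of_mul hz
  have h2 := right_ne_zero_of_mul (right_ne_zero_of_mul hz)
  have h3 := left_ne_zero_of_mul (right_ne_zero_of_mul hz)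
  have hs : StartsWith (arcs n (lv p.1.1 n)) (decide (lv p.1.1 n < 0)) z := by
    by_contra hs
    exact h3 (if_neg hs)
  have hlv := seminormalRep_wordU_lv h _ h1
  rw [hlv]
  refine ⟨hs.rk_le, fun he => ?_⟩
  have hz := hs.eq_top (rk_inj le_rfl he)
  subst hz
  have hc := boxChain_chain p.1.2
  rw [← p.2] at hc
  rcases ((boxChain_chain p.1.1).seminormalRep_col h).1 a h1 with h4 | h4 <;>
    rcases (hc.seminormalRep_row h).1 b h2 with h5 | h5
  · left; omega
  · left; rw [h5]; omega
  · left; rw [h4]; omega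
  · exact Or.inr ⟨h4, h5⟩

theorem seminormalRep_pairElt_self_ne (h : GenericParam q Q) (p : SignPair n) :
    seminormalRep h (pairElt q Q p) p.1.1 p.1.2 ≠ 0 := by
  have hy : blobParam q Q ≠ 0 := h.isUnit_blobParam.ne_zero
  have hc := boxChain_chain p.1.2
  rw [← p.2] at hc
  rw [seminormalRep_pairElt, Finset.sum_eq_single (SignSeq.top n (lv p.1.1 n)),
    if_pos (startsWith_top _)]
  · exact mul_ne_zero (pow_ne_zero _ (inv_ne_zero hy))
      (mul_ne_zero ((boxChain_chain p.1.1).seminormalRep_col h).2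
        (mul_ne_zero (pow_ne_zero _ hy) (hc.seminormalRep_row h).2))
  · intro z _ hz
    by_contra hne
    have h1 := seminormalRep_wordU_lv h _ (left_ne_zero_of_mul hne)
    have hs : StartsWith (arcs n (lv p.1.1 n)) (decide (lv p.1.1 n < 0)) z := by
      by_contra hs
      exact left_ne_zero_of_mul (right_ne_zero_of_mul hne) (if_neg hs)
    exact hz (hs.eq_top h1.symm)
  · simp

/-- An element whose matrix vanishes on the blocks of rank at least `G` has no diagrams of rank at
least `G`. -/
theorem pairCoord_eq_zero_of_seminormalRep (h : GenericParam q Q) (x : Blob F n q Q) (G : ℕ)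
    (hx : ∀ a b, lv a n = lv b n → G ≤ rk (lv a n) → seminormalRep h x a b = 0)
    (p : SignPair n) (hp : G ≤ rk (lv p.1.1 n)) : pairCoord h.isUnit_blobParam x p = 0 := by
  classical
  by_contra hne
  -- Among the pairs that contradict the claim take one of largest rank and, within this rank, with
  -- the most boxes. No other pair that occurs in `x` contributes to the matrix entry at its
  -- position.
  obtain ⟨p, hp', hmax⟩ := Finset.exists_max_image
    (Finset.univ.filter fun p : SignPair n =>
      pairCoord h.isUnit_blobParam x p ≠ 0 ∧ G ≤ rk (lv p.1.1 n))
    (fun p => toLex (rk (lv p.1.1 n), boxes p.1.1 + boxes p.1.2)) ⟨p, by simp [hne, hp]⟩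
  simp only [Finset.mem_filter, Finset.mem_univ, true_and] at hp' hmax
  have h0 := hx p.1.1 p.1.2 p.2 hp'.2
  rw [← sum_pairCoord h.isUnit_blobParam x, map_sum, Matrix.sum_apply, Finset.sum_eq_single p] at h0
  · rw [map_smul, Matrix.smul_apply, smul_eq_mul] at h0
    exact mul_ne_zero hp'.1 (seminormalRep_pairElt_self_ne h p) h0
  · intro p' _ hpp
    rw [map_smul, Matrix.smul_apply, smul_eq_mul]
    by_contra hc
    have h1 := left_ne_zero_of_mul hc
    obtain ⟨h2, h3⟩ := rk_le_of_seminormalRep_pairElt_ne h p' (right_ne_zero_of_mul hc)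
    have h4 := hmax p' ⟨h1, hp'.2.trans h2⟩
    rw [Prod.Lex.toLex_le_toLex] at h4
    rcases h4 with h4 | ⟨h4, h5⟩
    · simp only at h4; omega
    · rcases h3 h4.symm with h6 | h6
      · simp only at h5; omega
      · exact hpp (Subtype.ext (Prod.ext h6.1.symm h6.2.symm))
  · simp

theorem seminormalRep_injective (h : GenericParam q Q) :
    Function.Injective (seminormalRep h : Blob F n q Q → _) := by
  rw [injective_iff_map_eq_zero]
  intro x hx
  rw [← sum_pairCoord h.isUnit_blobParam x]
  refine Finset.sum_eq_zero fun p _ => ?_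
  rw [pairCoord_eq_zero_of_seminormalRep h x 0 (fun a b _ _ => by rw [hx]; rfl) p (Nat.zero_le _),
    zero_smul]

/-! ### The seminormal idempotents -/

open Classical Polynomial in
/-- Products of polynomials in the Jucys-Murphy elements are diagonal. -/
theorem seminormalRep_prod_aeval (h : GenericParam q Q) (p : Fin n → F[X]) :
    seminormalRep h ((List.ofFn fun k : Fin n => aeval (jm q Q k) (p k)).prod) =
      Matrix.diagonal fun w => ∏ k, (p k).eval (cont q Q w k) := by
  have h1 : ∀ k, seminormalRep h (aeval (jm q Q k) (p k)) =
      Matrix.diagonalAlgHom F (fun w : Fin n → Bool => (p k).eval (cont q Q w k)) := by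
    intro k
    rw [← aeval_algHom_apply, seminormalRep_jm]
    change aeval (Matrix.diagonalAlgHom F fun w : Fin n → Bool => cont q Q w k) (p k) = _
    rw [aeval_algHom_apply]
    congr 1
    ext w
    rw [aeval_pi_apply₂, coe_aeval_eq_eval]
  rw [map_list_prod, List.map_ofFn]
  have h2 : (⇑(seminormalRep h) ∘ fun k => aeval (jm q Q k) (p k)) =
      ⇑(Matrix.diagonalAlgHom F) ∘ fun k (w : Fin n → Bool) => (p k).eval (cont q Q w k) :=
    funext h1
  rw [h2, ← List.map_ofFn, ← map_list_prod, List.prod_ofFn]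
  change Matrix.diagonal _ = _
  congr 1
  ext w
  rw [Finset.prod_apply]

/-- All factors are `1` on the sequence of `t`. Any other sequence differs from it in some content,
and the factor for its own bitableau vanishes there. -/
theorem seminormalRep_seminormalF (h : GenericParam q Q) (t : StdAll n) :
    seminormalRep h (seminormalF q Q t) = Matrix.diagonal (Pi.single (signs t.2) 1) := by
  classical
  rw [seminormalF, seminormalRep_prod_aeval]
  congr 1
  ext w
  simp only [Polynomial.eval_prod, Polynomial.eval_mul, Polynomial.eval_C, Polynomial.eval_sub,
    Polynomial.eval_X]
  by_cases hw : w = signs t.2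
  · subst hw
    rw [Pi.single_eq_same]
    refine Finset.prod_eq_one fun k _ => Finset.prod_eq_one fun s hs => ?_
    rw [← content_eq_cont]
    exact inv_mul_cancel₀ (sub_ne_zero.2 (Finset.mem_filter.1 hs).2.symm)
  · rw [Pi.single_eq_of_ne hw]
    obtain ⟨k, hk⟩ : ∃ k, cont q Q w k ≠ cont q Q (signs t.2) k := by
      by_contra hc
      push Not at hc
      exact hw (h.eq_of_cont hc)
    obtain ⟨s, hs⟩ := exists_stdAll w
    refine Finset.prod_eq_zero (Finset.mem_univ k)
      (Finset.prod_eq_zero (i := s) (Finset.mem_filter.2 ⟨Finset.mem_univ _, ?_⟩) ?_)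
    · rwa [content_eq_cont, content_eq_cont, hs]
    · rw [content_eq_cont q Q s, hs, sub_self, mul_zero]

/-- The scalar `γ_t`. -/
noncomputable def gam (h : GenericParam q Q) (t : StdAll n) : F :=
  seminormalRep h (mElt q Q t.2 t.2) (signs t.2) (signs t.2)

theorem gam_ne (h : GenericParam q Q) (t : StdAll n) : gam h t ≠ 0 := by
  rw [gam, mElt_eq h.isUnit_blobParam]
  exact seminormalRep_pairElt_self_ne h (tabPair t.2 t.2)

/-- Between two copies of a diagonal matrix unit only one entry of `m_{tt}` survives. Thus `γ_t⁻¹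
f_{tt}` is `F_t`, and all further work is with diagonal matrices. -/
theorem seminormalDiag_eq (h : GenericParam q Q) (t : StdAll n) :
    seminormalDiag q Q t = gam h t • seminormalF q Q t := by
  apply seminormalRep_injective h
  rw [seminormalDiag, seminormalElt, map_mul, map_mul, map_smul, seminormalRep_seminormalF]
  ext a b
  rw [Matrix.mul_diagonal, Matrix.diagonal_mul, Matrix.smul_apply, smul_eq_mul]
  by_cases ha : a = signs t.2
  · by_cases hb : b = signs t.2
    · rw [ha, hb]
      simp [gam]
    · have hab : a ≠ b := fun e => hb (e ▸ ha)
      rw [Matrix.diagonal_apply_ne _ hab, Pi.single_eq_of_ne hb]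
      simp
  · rw [Matrix.diagonal_apply, Pi.single_eq_of_ne ha]
    simp

theorem seminormalF_sq (h : GenericParam q Q) (t : StdAll n) :
    seminormalF q Q t * seminormalF q Q t = seminormalF q Q t := by
  apply seminormalRep_injective h
  rw [map_mul, seminormalRep_seminormalF, Matrix.diagonal_mul_diagonal]
  congr 1
  ext w
  rw [Pi.single_apply]
  split_ifs <;> simp

theorem seminormalF_ne (h : GenericParam q Q) (t : StdAll n) : seminormalF q Q t ≠ 0 := by
  intro h0
  have := congrArg (fun x => seminormalRep h x (signs t.2) (signs t.2)) h0
  simp [seminormalRep_seminormalF] at this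

theorem seminormalDiag_mul_self_eq_iff (h : GenericParam q Q) (t : StdAll n) (c : F) :
    seminormalDiag q Q t * seminormalDiag q Q t = c • seminormalDiag q Q t ↔ c = gam h t := by
  have h1 := gam_ne h t
  rw [seminormalDiag_eq h, smul_mul_smul_comm, seminormalF_sq h, smul_smul,
    (smul_left_injective F (seminormalF_ne h t)).eq_iff, mul_left_inj' h1, eq_comm]

end PairTriangular

end

section

open SignSeq

/-! ### Change of scalars and the diagram basis -/

section MapBasis
variable {R S : Type*} [CommRing R] [CommRing S] (f : R →+* S) {n : ℕ} {q Q : R}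
  (hq : IsUnit q) (hQ : IsUnit Q) (hd : IsUnit (Q - Ring.inverse Q)) {q' Q' : S} (h1 : f q = q')
  (h2 : f Q = Q')

theorem Blob.map_smul_apply (r : R) (x : Blob R n q Q) :
    Blob.map f n hq hQ hd h1 h2 (r • x) = f r • Blob.map f n hq hQ hd h1 h2 x := by
  rw [Algebra.smul_def, map_mul, Blob.map_algebraMap, Algebra.smul_def]

theorem Blob.map_wordU (ks : List (Fin (n - 1))) :
    Blob.map f n hq hQ hd h1 h2 (wordU q Q ks) = wordU q' Q' ks := by
  rw [wordU, map_list_prod, List.map_map, wordU]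
  congr 2
  ext k
  exact Blob.map_gen f n hq hQ hd h1 h2 _

theorem Blob.map_genSeq (k : ℕ) :
    Blob.map f n hq hQ hd h1 h2 (Blob.genSeq q Q k) = Blob.genSeq q' Q' k := by
  unfold Blob.genSeq
  split_ifs
  · exact Blob.map_gen f n hq hQ hd h1 h2 _
  · exact Blob.map_gen f n hq hQ hd h1 h2 _
  · exact map_zero _

theorem Blob.map_pWord (k : ℕ) :
    Blob.map f n hq hQ hd h1 h2 (pWord q Q k) = pWord q' Q' k := by
  induction k with
  | zero => exact Blob.map_gen f n hq hQ hd h1 h2 _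
  | succ k ih => rw [pWord, map_mul, map_mul, ih, Blob.map_genSeq, Blob.map_genSeq, pWord]

theorem Blob.map_cWord (k : ℕ) :
    Blob.map f n hq hQ hd h1 h2 (cWord q Q k) = cWord q' Q' k := by
  induction k with
  | zero => exact map_one _
  | succ k ih =>
    rw [cWord, map_mul, map_mul, map_mul, ih, Blob.map_genSeq, Blob.map_pWord, cWord]

theorem Blob.map_topWord (k : ℕ) (b : Bool) :
    Blob.map f n hq hQ hd h1 h2 (topWord q Q k b) = topWord q' Q' k b := by
  unfold topWord
  split_ifs
  · rw [map_mul, Blob.map_pWord, Blob.map_cWord]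
  · exact Blob.map_cWord f hq hQ hd h1 h2 k

theorem Blob.map_pairElt (hy : IsUnit (blobParam q Q)) (p : SignPair n) :
    Blob.map f n hq hQ hd h1 h2 (pairElt q Q p) = pairElt q' Q' p := by
  rw [pairElt, Blob.map_smul_apply, map_mul, map_mul, Blob.map_wordU, Blob.map_wordU,
    Blob.map_topWord, map_pow, map_ringInverse f hy, map_blobParam f hq hQ hd, h1, h2, pairElt]

variable [NeZero n]

/-- The basis elements are words in the generators with coefficients that are powers of `y_e⁻¹`, so
a base change carries them to each other. This moves coordinates from `𝒦` to `𝒪` and then to `ℂ`. -/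
theorem pairCoord_map [Nontrivial R] (hy : IsUnit (blobParam q Q))
    (hy' : IsUnit (blobParam q' Q')) (x : Blob R n q Q) (p : SignPair n) :
    pairCoord hy' (Blob.map f n hq hQ hd h1 h2 x) p = f (pairCoord hy x p) := by
  conv_lhs => rw [← sum_pairCoord hy x]
  rw [map_sum, map_sum, Finset.sum_apply, Finset.sum_eq_single p]
  · rw [Blob.map_smul_apply, Blob.map_pairElt f hq hQ hd h1 h2 hy, map_smul, pairCoord_pairElt]
    simp
  · intro p' _ hne
    rw [Blob.map_smul_apply, Blob.map_pairElt f hq hQ hd h1 h2 hy, map_smul, pairCoord_pairElt]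
    simp [Pi.single_eq_of_ne hne.symm]
  · simp

end MapBasis

/-! ### The modular system -/

section Modular
variable {l : ℕ} {m : ℤ}

theorem isUnit_of_residueMap_ne_zero {x : LocRing l m} (hx : residueMap l m x ≠ 0) : IsUnit x := by
  obtain ⟨p, s, rfl⟩ := IsLocalization.exists_mk'_eq (RingHom.ker (evalPoint l m)).primeCompl x
  have h1 : residueMap l m (algebraMap _ _ p) ≠ 0 := by
    rw [← IsLocalization.mk'_spec (LocRing l m) p s, map_mul]
    refine mul_ne_zero hx ?_
    rw [residueMap_algebraMap]
    exact s.2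
  rw [residueMap_algebraMap] at h1
  have h2 := isUnit_algebraMap_locRing l m p h1
  rw [← IsLocalization.mk'_spec (LocRing l m) p s] at h2
  exact isUnit_of_mul_isUnit_left h2

theorem algebraMap_fractionRing_injective (A : Type*) [CommRing A] :
    Function.Injective (algebraMap A (FractionRing A)) :=
  IsFractionRing.injective A (FractionRing A)

-- Both are ring homomorphisms out of a localization, so it suffices that they agree on polynomials.
-- The equality makes injectivity into the fraction field available for the algebra structure used
-- on `𝒦`.
variable (l m) in
theorem algebraMap_genField_eq : algebraMap (LocRing l m) (GenField l m) =
    @algebraMap (LocRing l m) (GenField l m) _ _ OreLocalization.instAlgebra :=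
  IsLocalization.ringHom_ext (RingHom.ker (evalPoint l m)).primeCompl
    (RingHom.ext fun p => IsLocalization.lift_eq _ p)

variable (l m) in
theorem algebraMap_genField_injective :
    Function.Injective (algebraMap (LocRing l m) (GenField l m)) := by
  rw [algebraMap_genField_eq]
  exact algebraMap_fractionRing_injective (LocRing l m)

variable (l m) in
/-- The embedding of the polynomials in `q` and `Q` into `𝒦`. -/
noncomputable def polyToGenField : MvPolynomial (Fin 2) ℂ →+* GenField l m :=
  (algebraMap (LocRing l m) (GenField l m)).comp
    (algebraMap (MvPolynomial (Fin 2) ℂ) (LocRing l m))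

variable (l m) in
theorem polyToGenField_injective : Function.Injective (polyToGenField l m) :=
  (algebraMap_genField_injective l m).comp (IsLocalization.injective (LocRing l m)
    (Ideal.primeCompl_le_nonZeroDivisors (RingHom.ker (evalPoint l m))))

variable (l m) in
theorem polyToGenField_X_zero : polyToGenField l m (MvPolynomial.X 0) = qGen l m := rfl

variable (l m) in
theorem polyToGenField_X_one : polyToGenField l m (MvPolynomial.X 1) = QGen l m := rfl

variable (l m) in
theorem qGen_ne_zero : qGen l m ≠ 0 :=
  ((isUnit_qLoc l m).map (algebraMap (LocRing l m) (GenField l m))).ne_zero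

variable (l m) in
theorem QGen_ne_zero : QGen l m ≠ 0 :=
  ((isUnit_QLoc l m).map (algebraMap (LocRing l m) (GenField l m))).ne_zero

variable (l m) in
theorem genericParam : GenericParam (qGen l m) (QGen l m) where
  q_ne := qGen_ne_zero l m
  Q_ne := QGen_ne_zero l m
  sq_ne := by
    intro h0
    have h1 : (MvPolynomial.X 0 ^ 2 : MvPolynomial (Fin 2) ℂ) = 1 := by
      apply polyToGenField_injective l m
      rw [map_pow, map_one, polyToGenField_X_zero, h0]
    simpa using congrArg (MvPolynomial.eval ![(0 : ℂ), 0]) h1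
  ne j := by
    intro h0
    obtain ⟨a, b, rfl⟩ : ∃ a b : ℕ, j = a - b := ⟨j.toNat, (-j).toNat, by omega⟩
    rw [mul_sub, zpow_sub₀ (qGen_ne_zero l m), div_mul_eq_mul_div,
      div_eq_one_iff_eq (zpow_ne_zero _ (qGen_ne_zero l m))] at h0
    have h1 : (MvPolynomial.X 0 ^ (2 * a) * MvPolynomial.X 1 ^ 2 : MvPolynomial (Fin 2) ℂ) =
        MvPolynomial.X 0 ^ (2 * b) := by
      apply polyToGenField_injective l m
      rw [map_mul, map_pow, map_pow, map_pow, polyToGenField_X_zero, polyToGenField_X_one]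
      exact_mod_cast h0
    -- At `q = 1`, `Q = 0` the polynomial identity reads `0 = 1`.
    simpa using congrArg (MvPolynomial.eval ![(1 : ℂ), 0]) h1

theorem Admissible.blobParam_ne (h : Admissible l m) : blobParam (zeta l) (zeta l ^ m) ≠ 0 := by
  have h1 := zeta_ne_zero l
  have h2 := zpow_ne_zero m h1
  have h3 := h.Q_ne_inv
  have h4 := h.Q_ne
  unfold blobParam
  simp only [Ring.inverse_eq_inv']
  refine neg_ne_zero.2 (mul_ne_zero (sub_ne_zero.2 fun h0 => h4 ?_)
    (inv_ne_zero (sub_ne_zero.2 h3)))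
  rw [← div_eq_mul_inv, div_eq_iff h1] at h0
  nth_rewrite 1 [h0]
  ring

theorem Admissible.isUnit_blobParam (h : Admissible l m) :
    IsUnit (blobParam (qLoc l m) (QLoc l m)) := by
  apply isUnit_of_residueMap_ne_zero
  rw [map_blobParam _ (isUnit_qLoc l m) (isUnit_QLoc l m) (isUnit_QLoc_sub h), residueMap_qLoc,
    residueMap_QLoc]
  exact h.blobParam_ne

theorem blobToK_injective (h : Admissible l m) (n : ℕ) [NeZero n] :
    Function.Injective (blobToK n h) := by
  intro x y hxy
  apply pairCoord_injective h.isUnit_blobParam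
  ext p
  apply algebraMap_genField_injective l m
  have hy := (genericParam l m).isUnit_blobParam
  rw [← pairCoord_map _ (isUnit_qLoc l m) (isUnit_QLoc l m) (isUnit_QLoc_sub h) rfl rfl
      h.isUnit_blobParam hy, ← pairCoord_map _ (isUnit_qLoc l m) (isUnit_QLoc l m)
      (isUnit_QLoc_sub h) rfl rfl h.isUnit_blobParam hy]
  exact congrArg (fun z => pairCoord hy z p) hxy

/-! ### Residue classes -/

variable {n : ℕ}

/-- At the first place where two sequences differ their contents lie in different rows; if these
agree, they give an equation that depends on the common level only. -/
theorem cont_eq_iff_of_ne {F : Type*} [Field F] {q Q : F} (hq : q ≠ 0) (hQ : Q ≠ 0)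
    {w w' : Fin n → Bool} {k : Fin n} (hk : ∀ j : Fin n, j < k → w j = w' j) (hne : w k ≠ w' k)
    (he : cont q Q w k = cont q Q w' k) : q ^ (2 * lv w k) * Q ^ 2 = 1 := by
  have key : ∀ a b : ℕ, q ^ (2 * a) * Q = q ^ (2 * b) * Q⁻¹ →
      q ^ (2 * ((a : ℤ) - b)) * Q ^ 2 = 1 := by
    intro a b hab
    rw [mul_sub, zpow_sub₀ hq, div_mul_eq_mul_div, div_eq_one_iff_eq (zpow_ne_zero _ hq)]
    norm_cast
    rw [sq, ← mul_assoc, hab, mul_assoc, inv_mul_cancel₀ hQ, mul_one]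
  unfold cont at he
  rw [← cnt_congr (b := true) hk, ← cnt_congr (b := false) hk] at he
  cases h1 : w k <;> cases h2 : w' k <;> simp only [h1, h2, if_true] at he
  · exact absurd (h1.trans h2.symm) hne
  · exact key _ _ he
  · exact key _ _ he.symm
  · exact absurd (h1.trans h2.symm) hne

/-- The three conditions on `Q` in `Admissible` exclude exactly the levels `0`, `-1` and `1`:
`Q_ne_inv`, `Q_ne` and `Q_inv_ne` in this order. -/
theorem Admissible.two_le_of_eq (h : Admissible l m) {j : ℤ}
    (hj : zeta l ^ (2 * j) * (zeta l ^ m) ^ 2 = 1) : j ≤ -2 ∨ 2 ≤ j := by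
  have h1 := zeta_ne_zero l
  have h2 := zpow_ne_zero m h1
  have h3 := h.Q_ne_inv
  have h4 := h.Q_ne
  have h5 := h.Q_inv_ne
  generalize zeta l ^ m = Q at *
  by_contra hc
  have : j = -1 ∨ j = 0 ∨ j = 1 := by omega
  rcases this with rfl | rfl | rfl
  · apply h4
    rw [mul_neg, mul_one, zpow_neg, inv_mul_eq_one₀ (zpow_ne_zero _ h1)] at hj
    norm_cast at hj
    rw [hj, sq, mul_assoc, mul_inv_cancel₀ h2, mul_one]
  · apply h3
    rw [mul_zero, zpow_zero, one_mul, sq] at hj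
    exact eq_inv_of_mul_eq_one_left hj
  · apply h5
    rw [mul_one] at hj
    norm_cast at hj
    rw [inv_eq_iff_eq_inv]
    apply eq_inv_of_mul_eq_one_left
    rw [← hj]; ring

/-- A sequence which first leaves the maximal sequence at a level of absolute value at least two
has smaller rank. -/
theorem SignSeq.rk_lt_of_leaves_top {u w : Fin n → Bool} {k : Fin n}
    (hk : ∀ j : Fin n, j < k → w j = SignSeq.top n (lv u n) j)
    (hne : w k ≠ SignSeq.top n (lv u n) k) (h2 : lv w k ≤ -2 ∨ 2 ≤ lv w k) :
    rk (lv w n) < rk (lv u n) := by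
  have hh : 2 * arcs n (lv u n) + (lv u n).natAbs = n := lv_half u
  have h3 : lv w k = lv (SignSeq.top n (lv u n)) k := lv_congr hk
  have h4 := lv_succ w k
  have h5 := abs_lv_sub_le w (show (k : ℕ) + 1 ≤ n from k.2) le_rfl
  rw [SignSeq.top, ← arcs] at hne h3
  rw [lv_zigzag _ _ k.2.le] at h3
  rw [abs_le] at h5
  push_cast at h5
  split_ifs at h3 with h6 h7
  -- On the alternating part the level is `0` or `-1`, against the hypothesis.
  · omega
  · rw [zigzag, if_neg (by omega)] at hne
    simp only [h7, ne_eq, Bool.not_eq_true] at hne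
    simp at h7
    rw [hne] at h4
    simp at h4
    unfold rk
    omega
  · rw [zigzag, if_neg (by omega)] at hne
    simp only [h7, ne_eq, Bool.not_eq_false] at hne
    simp at h7
    rw [hne] at h4
    simp at h4
    unfold rk
    omega

/-- The residue class of the maximal bitableau contains no other bitableaux of at least its rank. -/
theorem SameResidues.eq_or_rk_lt (h : Admissible l m) {s t : StdAll n} {u : Fin n → Bool}
    (ht : signs t.2 = SignSeq.top n (lv u n)) (hst : SameResidues l m s t) :
    signs s.2 = signs t.2 ∨ rk (lv (signs s.2) n) < rk (lv u n) := by
  by_cases he : signs s.2 = signs t.2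
  · exact Or.inl he
  right
  obtain ⟨k, hk, hmin⟩ : ∃ k, signs s.2 k ≠ signs t.2 k ∧
      ∀ j, j < k → signs s.2 j = signs t.2 j := by
    have hex : ∃ k, signs s.2 k ≠ signs t.2 k := by
      by_contra hc
      push Not at hc
      exact he (funext hc)
    obtain ⟨k, hk, hmin⟩ := WellFounded.has_min (wellFounded_lt (α := Fin n))
      {k | signs s.2 k ≠ signs t.2 k} hex
    exact ⟨k, hk, fun j hj => by_contra fun hc => hmin j hc hj⟩
  have h1 := hst k
  rw [content_eq_cont, content_eq_cont] at h1
  have h2 := cont_eq_iff_of_ne (zeta_ne_zero l) (zpow_ne_zero m (zeta_ne_zero l)) hmin hk h1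
  rw [ht] at hk hmin
  exact SignSeq.rk_lt_of_leaves_top hmin hk (h.two_le_of_eq h2)

end Modular

end

section

open SignSeq

/-! ### The idempotent of a residue class is integral -/

section Integral
variable {l : ℕ} {m : ℤ} {n : ℕ}

variable (l m) in
/-- The content over `𝒪`. -/
noncomputable def contLoc (w : Fin n → Bool) (k : Fin n) : LocRing l m :=
  if w k then qLoc l m ^ (2 * cnt true w k) * Ring.inverse (QLoc l m)
    else qLoc l m ^ (2 * cnt false w k) * QLoc l m

theorem algebraMap_contLoc (w : Fin n → Bool) (k : Fin n) :
    algebraMap (LocRing l m) (GenField l m) (contLoc l m w k) =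
      cont (qGen l m) (QGen l m) w k := by
  unfold contLoc cont
  split_ifs
  · rw [map_mul, map_pow, map_ringInverse _ (isUnit_QLoc l m), Ring.inverse_eq_inv']; rfl
  · rw [map_mul, map_pow]; rfl

theorem residueMap_contLoc (w : Fin n → Bool) (k : Fin n) :
    residueMap l m (contLoc l m w k) = cont (zeta l) (zeta l ^ m) w k := by
  unfold contLoc cont
  split_ifs
  · rw [map_mul, map_pow, map_ringInverse _ (isUnit_QLoc l m), Ring.inverse_eq_inv',
      residueMap_qLoc, residueMap_QLoc]
  · rw [map_mul, map_pow, residueMap_qLoc, residueMap_QLoc]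

/-- Contents with different residues differ by a unit of the local ring. -/
theorem exists_algebraMap_eq_inv_cont_sub (w w' : Fin n → Bool) (k : Fin n)
    (h : cont (zeta l) (zeta l ^ m) w k ≠ cont (zeta l) (zeta l ^ m) w' k) :
    ∃ r, algebraMap (LocRing l m) (GenField l m) r =
      (cont (qGen l m) (QGen l m) w k - cont (qGen l m) (QGen l m) w' k)⁻¹ := by
  refine ⟨Ring.inverse (contLoc l m w k - contLoc l m w' k), ?_⟩
  rw [map_ringInverse, Ring.inverse_eq_inv', map_sub, algebraMap_contLoc, algebraMap_contLoc]
  apply isUnit_of_residueMap_ne_zero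
  rw [map_sub, residueMap_contLoc, residueMap_contLoc]
  exact sub_ne_zero.2 h

theorem algebraMap_mem_range_blobToK (h : Admissible l m) (r : LocRing l m) :
    algebraMap (GenField l m) (BlobK l m n) (algebraMap (LocRing l m) (GenField l m) r) ∈
      (blobToK n h).range :=
  ⟨algebraMap _ _ r, Blob.map_algebraMap _ n _ _ _ _ _ r⟩

theorem gen_mem_range_blobToK (h : Admissible l m) (g : BlobGen n) :
    (Blob.gen (qGen l m) (QGen l m) g : BlobK l m n) ∈ (blobToK n h).range :=
  ⟨Blob.gen _ _ g, Blob.map_gen _ n _ _ _ _ _ g⟩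

/-- The denominator `q - q⁻¹` in `U_0` is cancelled in `L_1 = Q - (Q - Q⁻¹) e`, and the recursion
for the later `L_k` has no denominators. -/
theorem jmAux_mem_range_blobToK (h : Admissible l m) (k : ℕ) :
    (jmAux (qGen l m) (QGen l m) k : BlobK l m n) ∈ (blobToK n h).range := by
  induction k with
  | zero =>
    have hg := genericParam l m
    have h2 : qGen l m - (qGen l m)⁻¹ ≠ 0 := by
      intro h0
      apply hg.sq_ne
      rw [sub_eq_zero] at h0
      rw [sq]
      nth_rewrite 2 [h0]
      exact mul_inv_cancel₀ hg.q_ne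
    have e : QGen l m - (QGen l m)⁻¹ =
        algebraMap (LocRing l m) (GenField l m) (QLoc l m - Ring.inverse (QLoc l m)) := by
      rw [map_sub, map_ringInverse _ (isUnit_QLoc l m), Ring.inverse_eq_inv']; rfl
    rw [jmAux, blobUzero, smul_neg, smul_smul, mul_div_cancel₀ _ h2, Algebra.smul_def, e]
    exact add_mem (neg_mem (mul_mem (algebraMap_mem_range_blobToK h _)
      (gen_mem_range_blobToK h _))) (algebraMap_mem_range_blobToK h _)
  | succ k ih =>
    rw [jmAux]
    split_ifs
    · have h1 := fun i => add_mem (gen_mem_range_blobToK (n := n) h (.U i))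
        (algebraMap_mem_range_blobToK h (qLoc l m))
      exact mul_mem (mul_mem (h1 _) ih) (h1 _)
    · exact zero_mem _

open Classical Polynomial in
variable (l m) in
/-- The polynomials in the Jucys-Murphy elements which separate the residues of `w` from other
residues. -/
noncomputable def resPoly (w : Fin n → Bool) (k : Fin n) : (GenField l m)[X] :=
  ∏ u : Fin n → Bool with cont (zeta l) (zeta l ^ m) w k ≠ cont (zeta l) (zeta l ^ m) u k,
    (C (cont (qGen l m) (QGen l m) w k - cont (qGen l m) (QGen l m) u k)⁻¹ *
      (X - C (cont (qGen l m) (QGen l m) u k)))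

variable (l m) in
/-- The product of the elements `resPoly`. -/
noncomputable def resElt (w : Fin n → Bool) : BlobK l m n :=
  (List.ofFn fun k : Fin n =>
    Polynomial.aeval (jm (qGen l m) (QGen l m) k) (resPoly l m w k)).prod

theorem resElt_mem_range_blobToK (h : Admissible l m) (w : Fin n → Bool) :
    resElt l m w ∈ (blobToK n h).range := by
  refine list_prod_mem fun x hx => ?_
  obtain ⟨k, rfl⟩ := (List.mem_ofFn' _ _).1 hx
  have hmem : resPoly l m w k ∈ (blobToK n h).range.comap
      (Polynomial.aeval (jm (qGen l m) (QGen l m) k : BlobK l m n)).toRingHom := by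
    refine prod_mem fun u hu => mul_mem ?_ (sub_mem ?_ ?_)
    · obtain ⟨r, hr⟩ := exists_algebraMap_eq_inv_cont_sub w u k (Finset.mem_filter.1 hu).2
      rw [Subring.mem_comap, ← hr]
      change Polynomial.aeval _ (Polynomial.C _) ∈ _
      rw [Polynomial.aeval_C]
      exact algebraMap_mem_range_blobToK h r
    · rw [Subring.mem_comap]
      change Polynomial.aeval _ Polynomial.X ∈ _
      rw [Polynomial.aeval_X]
      exact jmAux_mem_range_blobToK h k
    · rw [Subring.mem_comap, ← algebraMap_contLoc]
      change Polynomial.aeval _ (Polynomial.C _) ∈ _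
      rw [Polynomial.aeval_C]
      exact algebraMap_mem_range_blobToK h _
  exact hmem

variable [NeZero n]

/-- The eigenvalues at the other members of the residue class of `w` are not controlled. Hence one
such element does not suffice, and those of all members of the class are combined in
`residueIdem_mem_range_blobToK`. -/
theorem seminormalRep_resElt (w : Fin n → Bool) : ∃ d : (Fin n → Bool) → GenField l m,
    seminormalRep (genericParam l m) (resElt l m w) = Matrix.diagonal d ∧ d w = 1 ∧
      ∀ u k, cont (zeta l) (zeta l ^ m) w k ≠ cont (zeta l) (zeta l ^ m) u k → d u = 0 := by
  refine ⟨_, seminormalRep_prod_aeval (genericParam l m) _, ?_, fun u k hk => ?_⟩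
  · refine Finset.prod_eq_one fun k _ => ?_
    rw [resPoly, Polynomial.eval_prod]
    refine Finset.prod_eq_one fun u hu => ?_
    have hne := (Finset.mem_filter.1 hu).2
    simp only [Polynomial.eval_mul, Polynomial.eval_C, Polynomial.eval_sub, Polynomial.eval_X]
    refine inv_mul_cancel₀ (sub_ne_zero.2 fun h0 => hne ?_)
    rw [← residueMap_contLoc, ← residueMap_contLoc]
    rw [← algebraMap_contLoc, ← algebraMap_contLoc] at h0
    rw [algebraMap_genField_injective l m h0]
  · refine Finset.prod_eq_zero (Finset.mem_univ k) ?_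
    rw [resPoly, Polynomial.eval_prod]
    refine Finset.prod_eq_zero (Finset.mem_filter.2 ⟨Finset.mem_univ u, hk⟩) ?_
    simp

/-- The indicator matrix of a residue class. -/
theorem seminormalRep_residueIdem (t : StdAll n) [∀ w : Fin n → Bool, Decidable (∀ k,
      cont (zeta l) (zeta l ^ m) w k = cont (zeta l) (zeta l ^ m) (signs t.2) k)] :
    seminormalRep (genericParam l m) (residueIdem l m (gam (genericParam l m)) t) =
      Matrix.diagonal fun w => if ∀ k, cont (zeta l) (zeta l ^ m) w k =
        cont (zeta l) (zeta l ^ m) (signs t.2) k then 1 else 0 := by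
  classical
  have hsm : ∀ s : StdAll n, (gam (genericParam l m) s)⁻¹ •
      seminormalDiag (qGen l m) (QGen l m) s = seminormalF (qGen l m) (QGen l m) s := by
    intro s
    rw [seminormalDiag_eq (genericParam l m), smul_smul,
      inv_mul_cancel₀ (gam_ne (genericParam l m) s), one_smul]
  rw [residueIdem]
  simp only [hsm]
  rw [map_sum]
  simp only [seminormalRep_seminormalF]
  ext a b
  rw [Matrix.sum_apply]
  by_cases hab : a = b
  · subst hab
    simp only [Matrix.diagonal_apply_eq]
    obtain ⟨s, rfl⟩ := exists_stdAll a
    have hiff : (∀ k, cont (zeta l) (zeta l ^ m) (signs s.2) k =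
        cont (zeta l) (zeta l ^ m) (signs t.2) k) ↔ SameResidues l m s t := by
      simp only [SameResidues, content_eq_cont]
    rw [Finset.sum_filter, Finset.sum_eq_single s]
    · rw [Pi.single_eq_same]
      simp only [hiff]
    · intro u _ hu
      rw [Pi.single_eq_of_ne, ite_self]
      exact fun h => hu ((signs_eq_iff s u).1 h).symm
    · simp
  · rw [Matrix.diagonal_apply_ne _ hab]
    exact Finset.sum_eq_zero fun s _ => Matrix.diagonal_apply_ne _ hab

theorem residueIdem_mem_range_blobToK (h : Admissible l m) (t : StdAll n) :
    residueIdem l m (gam (genericParam l m)) t ∈ (blobToK n h).range := by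
  classical
  let c : Finset (Fin n → Bool) := Finset.univ.filter fun w => ∀ k,
    cont (zeta l) (zeta l ^ m) w k = cont (zeta l) (zeta l ^ m) (signs t.2) k
  -- At a member of the class its own factor in the product vanishes; outside the class all factors
  -- are `1`. So the right-hand side has eigenvalues `1` and `0` respectively.
  have hmain : residueIdem l m (gam (genericParam l m)) t =
      1 - (c.toList.map fun w => 1 - resElt l m w).prod := by
    apply seminormalRep_injective (genericParam l m)
    choose d hd hd1 hd0 using fun w : Fin n → Bool => seminormalRep_resElt (l := l) (m := m) w
    rw [seminormalRep_residueIdem, map_sub, map_one, map_list_prod, List.map_map]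
    have e : (⇑(seminormalRep (genericParam l m)) ∘ fun w => 1 - resElt l m w) =
        ⇑(Matrix.diagonalAlgHom (GenField l m)) ∘ fun w => 1 - d w := by
      ext1 w
      simp only [Function.comp, map_sub, map_one, hd]
      rfl
    rw [e, ← List.map_map, ← map_list_prod, Finset.prod_map_toList, ← map_one
      (Matrix.diagonalAlgHom (GenField l m)), ← map_sub]
    change _ = Matrix.diagonal _
    congr 1
    ext w
    rw [Pi.sub_apply, Finset.prod_apply, Pi.one_apply]
    split_ifs with hw
    · rw [Finset.prod_eq_zero (i := w) (Finset.mem_filter.2 ⟨Finset.mem_univ _, hw⟩), sub_zero]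
      rw [Pi.sub_apply, Pi.one_apply, hd1, sub_self]
    · rw [Finset.prod_eq_one, sub_self]
      intro u hu
      push Not at hw
      obtain ⟨k, hk⟩ := hw
      rw [Pi.sub_apply, Pi.one_apply, hd0 u w k, sub_zero]
      rw [(Finset.mem_filter.1 hu).2 k]
      exact hk.symm
  rw [hmain]
  refine sub_mem (one_mem _) (list_prod_mem fun x hx => ?_)
  obtain ⟨w, -, rfl⟩ := List.mem_map.1 hx
  exact sub_mem (one_mem _) (resElt_mem_range_blobToK h w)

end Integral

/-! ### The leading term -/

section LeadingTerm

theorem SignSeq.BoxChain.boxes_eq {n : ℕ} {T w : Fin n → Bool} {ks : List (Fin (n - 1))} {z : ℕ}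
    (h : BoxChain T w ks z) : boxes w = boxes T + ks.length := by
  induction h with
  | base => rfl
  | step w ks z k _ ha ih => rw [ha.boxes_sw, ih, List.length_cons, add_assoc]

variable {n : ℕ}

/-- The length of a chain is the difference of the numbers of boxes at its two ends, so the chain
chosen for a maximal sequence is empty. Therefore `m_{TT}` is the word `topWord` without further
factors. -/
theorem chain_top (u : Fin n → Bool) : chain (SignSeq.top n (lv u n)) = [] ∧
    chainZero (SignSeq.top n (lv u n)) = 0 := by
  have h := boxChain_chain (SignSeq.top n (lv u n))
  rw [lv_top] at h
  have h1 := h.boxes_eq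
  have h2 : chain (SignSeq.top n (lv u n)) = [] := List.eq_nil_of_length_eq_zero (by omega)
  rw [h2] at h
  generalize chainZero (SignSeq.top n (lv u n)) = z at h
  generalize SignSeq.top n (lv u n) = w at h h2
  cases h
  exact ⟨h2, rfl⟩

theorem pairElt_top {R : Type*} [CommRing R] [NeZero n] (q Q : R) (u : Fin n → Bool)
    (p : SignPair n) (h1 : p.1.1 = SignSeq.top n (lv u n)) (h2 : p.1.2 = SignSeq.top n (lv u n)) :
    pairElt q Q p = topWord q Q (arcs n (lv u n)) (decide (lv u n < 0)) := by
  rw [pairElt, h1, h2, (chain_top u).1, (chain_top u).2, lv_top]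
  simp [wordU]

variable [NeZero n] {l : ℕ} {m : ℤ}

/-- The coordinates of the idempotent of the residue class of the maximal bitableau. -/
theorem pairCoord_residueIdem (h : Admissible l m) {t : StdAll n} {u : Fin n → Bool}
    (ht : signs t.2 = SignSeq.top n (lv u n)) (p : SignPair n)
    (hp : rk (lv u n) ≤ rk (lv p.1.1 n)) :
    pairCoord (genericParam l m).isUnit_blobParam
      (residueIdem l m (gam (genericParam l m)) t) p =
      if p = tabPair t.2 t.2 then (blobParam (qGen l m) (QGen l m))⁻¹ ^ arcs n (lv u n) else 0 := by
  classical
  set hg := genericParam l m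
  set y := blobParam (qGen l m) (QGen l m)
  have hy : y ≠ 0 := hg.isUnit_blobParam.ne_zero
  -- The indicator matrix of the class is compared with `y⁻¹ ^ h` times the diagonal matrix of
  -- `topWord`. Once they agree on all blocks of rank at least that of `u`, triangularity compares
  -- the coordinates.
  have key := pairCoord_eq_zero_of_seminormalRep hg (residueIdem l m (gam hg) t -
    y⁻¹ ^ arcs n (lv u n) • pairElt (qGen l m) (QGen l m) (tabPair t.2 t.2)) (rk (lv u n)) ?_ p hp
  · rw [map_sub, map_smul, pairCoord_pairElt, Pi.sub_apply, Pi.smul_apply, sub_eq_zero] at key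
    rw [key, Pi.single_apply, smul_eq_mul, mul_ite, mul_one, mul_zero]
  · intro a b hab hG
    rw [map_sub, map_smul, seminormalRep_residueIdem, pairElt_top _ _ u _ ht ht,
      seminormalRep_topWord hg _ (two_mul_arcs_le n _) _ (two_mul_arcs_lt u), Matrix.sub_apply,
      Matrix.smul_apply]
    by_cases e : a = b
    · subst e
      rw [Matrix.diagonal_apply_eq, Matrix.diagonal_apply_eq]
      by_cases hat : a = signs t.2
      · rw [if_pos (by rw [hat]; exact fun _ => rfl), if_pos (by rw [hat, ht]; exact startsWith_top _),
          smul_eq_mul, ← mul_pow, inv_mul_cancel₀ hy, one_pow, sub_self]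
      -- Away from the maximal sequence both entries vanish at this rank: `StartsWith.eq_top`
      -- handles `topWord`, and `SameResidues.eq_or_rk_lt` the residue class.
      · rw [if_neg, if_neg, smul_zero, sub_zero]
        · intro hs
          exact hat ((hs.eq_top (rk_inj le_rfl (le_antisymm hs.rk_le hG))).trans ht.symm)
        · intro hres
          obtain ⟨s, rfl⟩ := exists_stdAll a
          have hst : SameResidues l m s t := by
            intro k
            rw [content_eq_cont, content_eq_cont]
            exact hres k
          rcases hst.eq_or_rk_lt h ht with h1 | h1
          · exact hat h1
          · omega
    · rw [Matrix.diagonal_apply_ne _ e, Matrix.diagonal_apply_ne _ e, smul_zero, sub_zero]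

theorem pairElt_mem_cellIdeal {R : Type*} [CommRing R] [Nontrivial R] {q Q : R}
    (hy : IsUnit (blobParam q Q)) (lam : OneLine n) (p : SignPair n)
    (hp : rk (lv p.1.1 n) < rk ((lam.1.1 : ℤ) - lam.1.2)) : pairElt q Q p ∈ cellIdeal q Q lam := by
  obtain ⟨mu, hmu⟩ := exists_oneLine p.1.1
  obtain ⟨s, hs⟩ := exists_stdTab mu p.1.1 hmu
  obtain ⟨t, ht⟩ := exists_stdTab mu p.1.2 (p.2.symm.trans hmu)
  refine Submodule.subset_span ⟨mu, s, t, ⟨?_, ?_⟩, ?_⟩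
  · rw [shapeGE_iff (mu.2.trans lam.2.symm), ← hmu]
    exact hp.le
  · intro he
    rw [hmu, he] at hp
    exact lt_irrefl _ hp
  · rw [mElt_eq hy]
    congr 1
    exact Subtype.ext (Prod.ext hs.symm ht.symm)

/-- The coordinates of `x` over `𝒪` are read off in `𝒦` and then reduced. In ranks at least that of
`lam` only the one at `(T, T)` is left, a power of the unit `y_e⁻¹`, whose residue is `r`; all other
terms have smaller rank and lie in the ideal. -/
theorem blobReduce_sub_mem_cellIdeal (h : Admissible l m) {lam : OneLine n} {T : StdTab lam}
    (hT : signs T = SignSeq.top n ((lam.1.1 : ℤ) - lam.1.2)) {x : BlobO l m n}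
    (hx : blobToK n h x = residueIdem l m (gam (genericParam l m)) ⟨lam, T⟩) :
    ∃ r : ℂ, r ≠ 0 ∧ blobReduce n h x - r • mElt (zeta l) (zeta l ^ m) T T ∈
      cellIdeal (zeta l) (zeta l ^ m) lam := by
  have hyC : IsUnit (blobParam (zeta l) (zeta l ^ m)) := isUnit_iff_ne_zero.2 h.blobParam_ne
  have hlv : lv (signs T) n = (lam.1.1 : ℤ) - lam.1.2 := lv_signs T
  have hT' : signs T = SignSeq.top n (lv (signs T) n) := by rw [hlv]; exact hT
  set a := arcs n (lv (signs T) n)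
  have hcoord : ∀ p : SignPair n, rk (lv (signs T) n) ≤ rk (lv p.1.1 n) →
      pairCoord h.isUnit_blobParam x p =
        if p = tabPair T T then Ring.inverse (blobParam (qLoc l m) (QLoc l m)) ^ a else 0 := by
    intro p hp
    apply algebraMap_genField_injective l m
    have h1 := pairCoord_residueIdem h (t := ⟨lam, T⟩) hT' p hp
    rw [← hx] at h1
    rw [← pairCoord_map (algebraMap (LocRing l m) (GenField l m)) (isUnit_qLoc l m)
      (isUnit_QLoc l m) (isUnit_QLoc_sub h) rfl rfl h.isUnit_blobParam
      (genericParam l m).isUnit_blobParam]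
    refine h1.trans ?_
    split_ifs
    · rw [map_pow, map_ringInverse _ h.isUnit_blobParam, map_blobParam _ (isUnit_qLoc l m)
        (isUnit_QLoc l m) (isUnit_QLoc_sub h), Ring.inverse_eq_inv']
      rfl
    · rw [map_zero]
  have hred : ∀ p, pairCoord hyC (blobReduce n h x) p =
      residueMap l m (pairCoord h.isUnit_blobParam x p) := fun p =>
    pairCoord_map (residueMap l m) (isUnit_qLoc l m) (isUnit_QLoc l m) (isUnit_QLoc_sub h)
      (residueMap_qLoc l m) (residueMap_QLoc l m) h.isUnit_blobParam hyC x p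
  refine ⟨residueMap l m (Ring.inverse (blobParam (qLoc l m) (QLoc l m)) ^ a),
    ((h.isUnit_blobParam.ringInverse.pow a).map (residueMap l m)).ne_zero, ?_⟩
  rw [mElt_eq hyC, ← sum_pairCoord hyC (blobReduce n h x),
    ← Finset.add_sum_erase _ _ (Finset.mem_univ (tabPair T T)), hred,
    hcoord (tabPair T T) le_rfl, if_pos rfl, add_sub_cancel_left]
  refine Submodule.sum_mem _ fun p hp => ?_
  by_cases hr : rk (lv (signs T) n) ≤ rk (lv p.1.1 n)
  · rw [hred, hcoord p hr, if_neg (Finset.ne_of_mem_erase hp), map_zero, zero_smul]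
    exact Submodule.zero_mem _
  · exact Submodule.smul_mem _ _ (pairElt_mem_cellIdeal hyC lam p (by rw [← hlv]; omega))

end LeadingTerm

end

theorem theorem6p2 (l : ℕ) (m : ℤ) (h : Admissible l m) (n : ℕ) [NeZero n] (lam : OneLine n) :
    -- `T` is the unique maximal standard bitableau of shape `lam`
    ∃ T : StdTab lam, (∀ u : StdTab lam, (∀ t : StdTab lam, TabGE u t) ↔ u = T) ∧
    -- `γ s` is the unique scalar with `f_{ss} f_{ss} = γ_s f_{ss}`, and it is nonzero
    ∃ γ : StdAll n → GenField l m,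
      (∀ s, γ s ≠ 0 ∧ ∀ c : GenField l m,
        seminormalDiag (qGen l m) (QGen l m) s * seminormalDiag (qGen l m) (QGen l m) s =
          c • seminormalDiag (qGen l m) (QGen l m) s ↔ c = γ s) ∧
    -- the idempotent of the residue sequence of `T` comes from a unique `x` over `𝒪`, and the
    -- reduction of `x` is congruent to a nonzero multiple of `m_{TT}`
    ∃ x : BlobO l m n, (∀ y : BlobO l m n,
        blobToK n h y = residueIdem l m γ ⟨lam, T⟩ ↔ y = x) ∧
      ∃ r : ℂ, r ≠ 0 ∧
        blobReduce n h x - r • mElt (zeta l) (zeta l ^ m) T T ∈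
          cellIdeal (zeta l) (zeta l ^ m) lam := by
  obtain ⟨T, hT, hmax⟩ := exists_maximal lam
  have hg := genericParam l m
  obtain ⟨x, hx⟩ := residueIdem_mem_range_blobToK h ⟨lam, T⟩
  refine ⟨T, hmax, gam hg, fun s => ⟨gam_ne hg s, seminormalDiag_mul_self_eq_iff hg s⟩, x,
    fun y => ⟨fun hy => blobToK_injective h n (hy.trans hx.symm), fun hy => hy ▸ hx⟩,
    blobReduce_sub_mem_cellIdeal h hT hx⟩
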